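/- Let $Y,Y'$ be Riemann surfaces (Hausdorff one-dimensional complex manifolds, not necessarily connected) and let $\nu:Y\to Y'$ be a finite branched covering, i.e. a proper surjective holomorphic map with finite fibres. Let $f:Y\to\mathbb R\cup\{\pm\infty\}$ be harmonic and real-valued except at a finite set $Pol\subset Y$ of logarithmic singularities: near $p\in Pol$ one has $f=r\log|z|+\tilde f$, where $z$ is a local coordinate centred at $p$, $r\in\mathbb R\setminus\{0\}$ is the residue of $f$ at $p$, and $\tilde f$ is harmonic near $p$; the value of $f$ at $p$ is its limit there ($-\infty$ if $r>0$, $+\infty$ if $r<0$). Let $Pol^-$ (resp. $Pol^+$) be the set of $p\in Pol$ with $r<0$ (resp. $r>0$). The tropical trace of $f$ is $$\nu_*f(z)=\max_{y\in\nu^{-1}(z)}f(y),\qquad z\in Y'.$$ By a real semi-analytic curve in $Y'$ we mean a closed semi-analytic subset of $Y'$ of pure dimension $1$ (possibly empty); semi-analytic means that every point of $Y'$ has a neighbourhood in which the set is a finite union of sets $\{F=0,\,G_1>0,\dots,G_m>0\}$ with $F,G_j$ real analytic. A function is piecewise-harmonic in an open set $W\subset Y'$ if there is a real semi-analytic curve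 $S\subset Y'$ such that the function is harmonic on $W\setminus S$ and the connected components of $W\setminus S$ form a family that is locally finite in $W$. Then: 1. $\nu_*f$ is real-valued, continuous and piecewise-harmonic in the open set $Y'\setminus\nu(Pol)$. 2. $\nu_*f$ is subharmonic in $U=Y'\setminus\nu(Pol^-)$. 3. $\nu_*f$ has at most logarithmic singularities: for every $q\in\nu(Pol)$, with a local coordinate $z$ centred at $q$, there are $\rho\in\mathbb R$ and a continuous real function $h$ defined near $q$ such that $\nu_*f=\rho\log|z|+h$ in a punctured neighbourhood of $q$, and $\nu_*f(q)=\lim_{z\to q}\nu_*f(z)\in\mathbb R\cup\{\pm\infty\}$. 4. $\nu_*f$ is locally integrable on $U$, and the support of its distributional Laplacian in $U$ is contained in the union of a real semi-analytic curve $S\subset Y'$ and a finite set of points $Q\subset\nu(Pol)$. Moreover, $S$ is the union of a locally finite family of connected real semi-analytic curves, and this family is finite if $Y'$ is compact. -/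

import Mathlib

open Set Filter Topology MeasureTheory
open scoped Manifold ContDiff

namespace TropicalTrace

section Surface

variable {X : Type*} [TopologicalSpace X] [ChartedSpace ℂ X]

/-- `g` is real-valued and harmonic in a neighbourhood of `x`, read in the chart at `x`
(harmonicity does not depend on the holomorphic coordinate). -/
def IsHarmonicAt (g : X → EReal) (x : X) : Prop :=
  ∃ h : ℂ → ℝ, InnerProductSpace.HarmonicAt h (chartAt ℂ x x) ∧
    ∀ᶠ y in 𝓝 x, g y = ((h (chartAt ℂ x y) : ℝ) : EReal)

/-- Near `x`, `g = r log |z| + h`, where `z` is the local coordinate centred at `x`, and the value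
of `g` at `x` (possibly `±∞`) is the limit of `g` there. -/
def HasLogExpansionAt (g : X → EReal) (x : X) (r : ℝ) (h : ℂ → ℝ) : Prop :=
  (∀ᶠ y in 𝓝[≠] x, g y =
    ((r * Real.log ‖chartAt ℂ x y - chartAt ℂ x x‖ + h (chartAt ℂ x y) : ℝ) : EReal)) ∧
  ContinuousAt g x

/-- `f` has a logarithmic singularity with residue `r` at `y`: `f = r log |z| + harmonic`. -/
def HasLogSingularityAt (f : X → EReal) (y : X) (r : ℝ) : Prop :=
  ∃ h : ℂ → ℝ, InnerProductSpace.HarmonicAt h (chartAt ℂ y y) ∧ HasLogExpansionAt f y r h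

/-- The logarithmic singularities with negative residue. -/
def polNeg (f : X → EReal) : Set X := {y | ∃ r : ℝ, r < 0 ∧ HasLogSingularityAt f y r}

/-- The logarithmic singularities with positive residue. -/
def polPos (f : X → EReal) : Set X := {y | ∃ r : ℝ, 0 < r ∧ HasLogSingularityAt f y r}

/-- All logarithmic singularities. -/
def pol (f : X → EReal) : Set X := polNeg f ∪ polPos f

/-- `f` is harmonic except at a finite set where it has logarithmic singularities. -/
structure IsHarmonicWithLogPoles (f : X → EReal) : Prop where
  finite_pol : (pol f).Finite
  harmonic : ∀ y, y ∉ pol f → IsHarmonicAt f y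

/-- At most a logarithmic singularity at `x`: up to a real multiple (possibly zero) of `log |z|`,
`g` is continuous near `x`. -/
def HasAtMostLogSingularityAt (g : X → EReal) (x : X) : Prop :=
  ∃ (r : ℝ) (h : ℂ → ℝ), (∀ᶠ w in 𝓝 (chartAt ℂ x x), ContinuousAt h w) ∧
    HasLogExpansionAt g x r h

/-- Semianalytic subsets: every point of `X` has a neighbourhood on which the set is a finite union
of sets of the form `{F = 0, G₁ > 0, …, Gₘ > 0}` with real analytic functions. -/
def IsSemianalytic (S : Set X) : Prop :=
  ∀ x : X, ∃ V : Set ℂ, IsOpen V ∧ chartAt ℂ x x ∈ V ∧ V ⊆ (chartAt ℂ x).target ∧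
    ∃ (n m : ℕ) (F : Fin n → ℂ → ℝ) (G : Fin n → Fin m → ℂ → ℝ),
      (∀ i, AnalyticOnNhd ℝ (F i) V) ∧ (∀ i j, AnalyticOnNhd ℝ (G i j) V) ∧
      ∀ w ∈ V, ((chartAt ℂ x).symm w ∈ S ↔ ∃ i, F i w = 0 ∧ ∀ j, 0 < G i j w)

/-- Semianalytic curves: closed semianalytic sets of pure dimension one. In a surface, a closed
semianalytic set has dimension at most one iff its interior is empty, and has no zero-dimensional
part iff it has no isolated points. -/
structure IsSemianalyticCurve (S : Set X) : Prop where
  semianalytic : IsSemianalytic S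
  perfect : Perfect S
  interior_eq_empty : interior S = ∅

/-- `g` is piecewise harmonic in the open set `W`: there is a semianalytic curve `S` such that `g`
is harmonic on `W \ S`, and the pieces (the connected components of `W \ S`) are locally finite
in `W`. -/
def IsPiecewiseHarmonicOn (g : X → EReal) (W : Set X) : Prop :=
  ∃ S : Set X, IsSemianalyticCurve S ∧ (∀ x ∈ W \ S, IsHarmonicAt g x) ∧
    ∀ x ∈ W, ∃ N ∈ 𝓝 x,
      {C : Set X | (∃ y ∈ W \ S, C = connectedComponentIn (W \ S) y) ∧ (C ∩ N).Nonempty}.Finite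

/-- Subharmonic functions on an open set `U`: upper semicontinuous with values in `[-∞, ∞)`, not
identically `-∞` on any connected component, and below every harmonic function on a closed
coordinate disc which dominates them on the boundary circle. -/
structure IsSubharmonicOn (u : X → EReal) (U : Set X) : Prop where
  upperSemicontinuous : UpperSemicontinuousOn u U
  lt_top : ∀ x ∈ U, u x < ⊤
  ne_bot : ∀ x ∈ U, ∃ y ∈ connectedComponentIn U x, u y ≠ ⊥
  le_harmonic : ∀ e ∈ IsManifold.maximalAtlas 𝓘(ℂ) ω X, ∀ (c : ℂ) (R : ℝ), 0 < R →
    Metric.closedBall c R ⊆ e.target → e.symm '' Metric.closedBall c R ⊆ U →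
    ∀ h : ℂ → ℝ, ContinuousOn h (Metric.closedBall c R) →
      InnerProductSpace.HarmonicOnNhd h (Metric.ball c R) →
      (∀ w ∈ Metric.sphere c R, u (e.symm w) ≤ (h w : EReal)) →
      ∀ w ∈ Metric.ball c R, u (e.symm w) ≤ (h w : EReal)

/-- `g` is locally integrable on the open set `U`, read in charts. -/
def IsLocallyIntegrableOn (g : X → EReal) (U : Set X) : Prop :=
  ∀ x : X, LocallyIntegrableOn (fun w : ℂ => (g ((chartAt ℂ x).symm w)).toReal)
    ((chartAt ℂ x).target ∩ (chartAt ℂ x).symm ⁻¹' U) volume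

/-- The distributional Laplacian of `g` in the chart at `x`, evaluated at a test function `ψ`. -/
noncomputable def laplacianPairing (g : X → EReal) (x : X) (ψ : ℂ → ℝ) : ℝ :=
  ∫ w : ℂ, (g ((chartAt ℂ x).symm w)).toReal * Laplacian.laplacian ψ w

/-- The support of the distributional Laplacian of `g`: `x` is not in it iff the Laplacian vanishes
on all test functions supported in some neighbourhood of `x`. The vanishing of the Laplacian does
not depend on the holomorphic coordinate. -/
def laplacianSupport (g : X → EReal) : Set X :=
  {x | ¬ ∃ V : Set ℂ, IsOpen V ∧ chartAt ℂ x x ∈ V ∧ V ⊆ (chartAt ℂ x).target ∧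
    ∀ ψ : ℂ → ℝ, ContDiff ℝ ∞ ψ → HasCompactSupport ψ → tsupport ψ ⊆ V →
      laplacianPairing g x ψ = 0}

end Surface

section Covering

variable {Y Y' : Type*} [TopologicalSpace Y] [ChartedSpace ℂ Y]
  [TopologicalSpace Y'] [ChartedSpace ℂ Y']

/-- Finite branched coverings of Riemann surfaces: proper surjective holomorphic maps with finite
fibres. -/
structure IsBranchedCovering (ν : Y → Y') : Prop where
  holomorphic : MDifferentiable 𝓘(ℂ) 𝓘(ℂ) ν
  proper : IsProperMap ν
  surjective : Function.Surjective ν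
  finite_fiber : ∀ z, (ν ⁻¹' {z}).Finite

/-- The tropical trace: the maximum of `f` over the fibre (fibres of a branched covering are finite
and non-empty, so the supremum is a maximum). -/
noncomputable def tropicalTrace (ν : Y → Y') (f : Y → EReal) (z : Y') : EReal :=
  ⨆ y ∈ ν ⁻¹' {z}, f y

end Covering

end TropicalTrace

open TropicalTrace

/-!
Near a point `q` of `Y'`, the substitution `z = ξ ^ m` in a centred coordinate makes the branches of
the inverse of `ν` single-valued, if `m` is a common multiple of the ramification indices over `q`.
The trace then becomes the maximum of finitely many functions `ρⱼ log |ξ| + Hⱼ` with `Hⱼ` harmonic,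
where `ρⱼ = 0` away from the images of the poles and `ρⱼ ≥ 0` away from the images of those with
negative residue.

Outside the origin, such a maximum fails to be harmonic exactly where two terms with distinct germs
attain it. Two terms with different `ρⱼ` do not meet near the origin, and a nonzero difference of
harmonic functions is the real part of a holomorphic function, so it vanishes along finitely many
arcs `θ = β (|ξ|)` with `β` analytic. In the coordinate `z` these become arcs `θ = β (r ^ (1 / m))`.
The Puiseux series on the right is a root of a monic polynomial over the ring of analytic functions
of `r`, and by Thom's lemma it is distinguished from the other roots by the signs of the derivatives
of this polynomial; hence the arcs are semianalytic.

The curve is the derived set of the set of points of non-harmonicity. It contains all of these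
points outside the images of the poles: near an isolated one a single term would attain the maximum,
and averaging over the `m`-th roots descends its harmonicity from `ξ` to `z`.

For subharmonicity, if a harmonic function dominates the trace near `q` and touches it at `q`, then
some term touches it there as well and agrees with it by the maximum principle.
-/

namespace TropicalTrace

open InnerProductSpace

/-! ### Sign conditions on Puiseux series -/

section Thom

lemma sign_eq_of_monotoneOn {φ : ℝ → ℝ} {a b t : ℝ} (hφ : MonotoneOn φ (Icc a b))
    (hab : SignType.sign (φ a) = SignType.sign (φ b)) (ht : t ∈ Icc a b) :
    SignType.sign (φ t) = SignType.sign (φ a) := by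
  have hle : a ≤ b := ht.1.trans ht.2
  refine le_antisymm ?_ (SignType.sign.monotone (hφ (left_mem_Icc.2 hle) ht ht.1))
  exact hab ▸ SignType.sign.monotone (hφ ht (right_mem_Icc.2 hle) ht.2)

lemma sign_eq_of_antitoneOn {φ : ℝ → ℝ} {a b t : ℝ} (hφ : AntitoneOn φ (Icc a b))
    (hab : SignType.sign (φ a) = SignType.sign (φ b)) (ht : t ∈ Icc a b) :
    SignType.sign (φ t) = SignType.sign (φ a) := by
  have h := sign_eq_of_monotoneOn (φ := fun x => -φ x) hφ.neg
    (by simp only [Left.sign_neg, hab]) ht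
  simpa only [Left.sign_neg, neg_inj] using h

open Polynomial

lemma sign_eval_eq_of_sign_iterate_derivative_eq (p : ℝ[X]) {a b t : ℝ}
    (h : ∀ k, SignType.sign ((derivative^[k] p).eval a) =
      SignType.sign ((derivative^[k] p).eval b)) (ht : t ∈ Icc a b) :
    SignType.sign (p.eval t) = SignType.sign (p.eval a) := by
  induction hn : p.natDegree generalizing p t with
  | zero => rw [eq_C_of_natDegree_eq_zero hn]; simp
  | succ n ih =>
    have hderiv {x : ℝ} (hx : x ∈ interior (Icc a b)) :
        SignType.sign (deriv (fun y => p.eval y) x) = SignType.sign (p.derivative.eval a) := by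
      rw [Polynomial.deriv]
      refine ih p.derivative (fun k => ?_) (interior_subset hx) (by simp [hn])
      simpa only [Function.iterate_succ_apply] using h (k + 1)
    have hdiff : DifferentiableOn ℝ (fun x => p.eval x) (interior (Icc a b)) :=
      p.differentiable.differentiableOn
    rcases le_total 0 (p.derivative.eval a) with h0 | h0
    · refine sign_eq_of_monotoneOn (monotoneOn_of_deriv_nonneg (convex_Icc a b)
        p.continuous.continuousOn hdiff fun x hx => ?_) (h 0) ht
      rwa [← sign_nonneg_iff, hderiv hx, sign_nonneg_iff]
    · refine sign_eq_of_antitoneOn (antitoneOn_of_deriv_nonpos (convex_Icc a b)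
        p.continuous.continuousOn hdiff fun x hx => ?_) (h 0) ht
      rwa [← sign_nonpos_iff, hderiv hx, sign_nonpos_iff]

/-- Thom's lemma. -/
lemma eq_of_sign_iterate_derivative_eq {p : ℝ[X]} (hp : p ≠ 0) {a b : ℝ} (ha : p.eval a = 0)
    (h : ∀ k ≤ p.natDegree, SignType.sign ((derivative^[k] p).eval a) =
      SignType.sign ((derivative^[k] p).eval b)) : a = b := by
  have hall (k : ℕ) : SignType.sign ((derivative^[k] p).eval a) =
      SignType.sign ((derivative^[k] p).eval b) := by
    rcases le_or_gt k p.natDegree with hk | hk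
    · exact h k hk
    · simp [iterate_derivative_eq_zero hk]
  have hb : SignType.sign (p.eval b) = 0 := by simpa [ha] using (hall 0).symm
  have hnot_lt {c d : ℝ} (hc : SignType.sign (p.eval c) = 0)
      (hcd : ∀ k, SignType.sign ((derivative^[k] p).eval c) =
        SignType.sign ((derivative^[k] p).eval d)) : ¬ c < d := fun hlt =>
    hp <| eq_zero_of_infinite_isRoot p <| (Icc_infinite hlt).mono fun t ht =>
      sign_eq_zero_iff.1 ((sign_eval_eq_of_sign_iterate_derivative_eq p hcd ht).trans hc)
  exact le_antisymm (not_lt.1 (hnot_lt hb fun k => (hall k).symm))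
    (not_lt.1 (hnot_lt (by simp [ha]) hall))

end Thom

lemma exists_eventually_sign_eq_of_analyticAt {φ : ℝ → ℝ} {a : ℝ} (hφ : AnalyticAt ℝ φ a) :
    ∃ σ : SignType, ∀ᶠ s in 𝓝[>] a, SignType.sign (φ s) = σ := by
  by_cases h0 : ∀ᶠ s in 𝓝 a, φ s = 0
  · exact ⟨0, (h0.filter_mono nhdsWithin_le_nhds).mono fun s hs => by simp [hs]⟩
  · obtain ⟨n, g, hg, hg0, hev⟩ := hφ.exists_eventuallyEq_pow_smul_nonzero_iff.2 h0
    have hsign : ∀ᶠ s in 𝓝 a, SignType.sign (g s) = SignType.sign (g a) := by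
      have := (continuousAt_sign_of_ne_zero hg0).comp hg.continuousAt
      rwa [ContinuousAt, nhds_discrete SignType, tendsto_pure] at this
    refine ⟨SignType.sign (g a), ?_⟩
    filter_upwards [nhdsWithin_le_nhds hev, nhdsWithin_le_nhds hsign, self_mem_nhdsWithin]
      with s hφs hgs hs
    rw [hφs, smul_eq_mul, sign_mul, sign_pow, sign_pos (sub_pos.2 hs), one_pow, one_mul, hgs]

section Puiseux

open Polynomial

variable {𝕜 : Type*} [NontriviallyNormedField 𝕜]

lemma norm_coeff_mul_pow_add_le {p : FormalMultilinearSeries 𝕜 𝕜 𝕜} {C : ℝ} {ρ : NNReal}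
    (hρ : 0 < ρ) (hC : ∀ n, ‖p n‖ * ρ ^ n ≤ C) (j M n : ℕ) :
    ‖p.coeff (j + M * n)‖ * ((ρ ^ M : NNReal) : ℝ) ^ n ≤ C / ρ ^ j := by
  rw [le_div_iff₀ (by positivity)]
  refine le_trans (le_of_eq ?_) (hC (j + M * n))
  rw [FormalMultilinearSeries.norm_apply_eq_norm_coef]
  push_cast
  ring

lemma exists_eventuallyEq_sum_zmod_of_analyticAt [CompleteSpace 𝕜] (M : ℕ) [NeZero M] {b : 𝕜 → 𝕜}
    (hb : AnalyticAt 𝕜 b 0) :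
    ∃ B : ZMod M → 𝕜 → 𝕜, (∀ j, AnalyticAt 𝕜 (B j) 0) ∧
      ∀ᶠ s in 𝓝 (0 : 𝕜), b s = ∑ j : ZMod M, s ^ j.val * B j (s ^ M) := by
  obtain ⟨p, r, hp⟩ := hb
  obtain ⟨ρ, hρ0, hρr⟩ := ENNReal.lt_iff_exists_nnreal_btwn.1 hp.r_pos
  have hρ : 0 < ρ := by exact_mod_cast hρ0
  obtain ⟨C, -, hC⟩ := p.norm_mul_pow_le_of_lt_radius (hρr.trans_le hp.r_le)
  let q (j : ZMod M) : FormalMultilinearSeries 𝕜 𝕜 𝕜 :=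
    .ofScalars 𝕜 fun n => p.coeff (j.val + M * n)
  have hradius (j : ZMod M) : 0 < (q j).radius := by
    refine lt_of_lt_of_le (by exact_mod_cast pow_pos hρ M)
      ((q j).le_radius_of_bound (r := ρ ^ M) (C / ρ ^ j.val) fun n => ?_)
    simpa only [q, FormalMultilinearSeries.norm_apply_eq_norm_coef,
      FormalMultilinearSeries.coeff_ofScalars] using norm_coeff_mul_pow_add_le hρ hC j.val M n
  refine ⟨fun j => (q j).sum, fun j => ((q j).hasFPowerSeriesOnBall (hradius j)).analyticAt, ?_⟩
  filter_upwards [Metric.eball_mem_nhds (0 : 𝕜) hp.r_pos] with s hs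
  have hsum : HasSum (fun n => p.coeff n * s ^ n) (b s) := by
    refine (zero_add s ▸ hp.hasSum hs).congr_fun fun n => ?_
    rw [FormalMultilinearSeries.apply_eq_pow_smul_coeff, smul_eq_mul, mul_comm]
  rw [← hsum.tsum_eq, Nat.sumByResidueClasses hsum.summable M]
  refine Finset.sum_congr rfl fun j _ => ?_
  rw [FormalMultilinearSeries.sum, ← tsum_mul_left]
  refine tsum_congr fun n => ?_
  rw [FormalMultilinearSeries.apply_eq_pow_smul_coeff, FormalMultilinearSeries.coeff_ofScalars,
    smul_eq_mul]
  ring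

variable (𝕜) in
/-- The ring of functions `𝕜 → 𝕜` which are analytic at the origin. Its elements are functions and
not germs, so that they can be evaluated everywhere. -/
def analyticAtZero : Subring (𝕜 → 𝕜) where
  carrier := {g | AnalyticAt 𝕜 g 0}
  mul_mem' h₁ h₂ := AnalyticAt.mul h₁ h₂
  add_mem' h₁ h₂ := AnalyticAt.add h₁ h₂
  one_mem' := analyticAt_const
  zero_mem' := analyticAt_const
  neg_mem' h := AnalyticAt.neg h

/-- The ring endomorphism `g ↦ g (s ^ M)` of the ring of functions analytic at the origin. -/
def powSubst (M : ℕ) [NeZero M] : analyticAtZero 𝕜 →+* analyticAtZero 𝕜 where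
  toFun g := ⟨fun s => g.1 (s ^ M), AnalyticAt.fun_comp (f := fun s : 𝕜 => s ^ M)
    (by rw [zero_pow (NeZero.ne M)]; exact g.2) (analyticAt_id.pow M)⟩
  map_one' := rfl
  map_mul' _ _ := rfl
  map_zero' := rfl
  map_add' _ _ := rfl

/-- Evaluation at `v` on the ring of functions analytic at the origin. -/
def evalAt (v : 𝕜) : analyticAtZero 𝕜 →+* 𝕜 :=
  (Pi.evalRingHom (fun _ : 𝕜 => 𝕜) v).comp (analyticAtZero 𝕜).subtype

lemma evalAt_apply (v : 𝕜) (g : analyticAtZero 𝕜) : evalAt v g = g.1 v := rfl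

lemma evalAt_comp_powSubst (M : ℕ) [NeZero M] (s : 𝕜) :
    (evalAt s).comp (powSubst M) = evalAt (s ^ M) := rfl

lemma evalAt_eval₂_powSubst (M : ℕ) [NeZero M] (P : (analyticAtZero 𝕜)[X]) (g : analyticAtZero 𝕜)
    (s : 𝕜) : (P.eval₂ (powSubst M) g).1 s = (P.map (evalAt (s ^ M))).eval (g.1 s) := by
  rw [← evalAt_apply, hom_eval₂, evalAt_comp_powSubst, evalAt_apply, eval_map]

lemma isIntegralElem_powSubst_id (M : ℕ) [NeZero M] :
    (powSubst M).IsIntegralElem (⟨fun s => s, analyticAt_id⟩ : analyticAtZero 𝕜) := by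
  let := (powSubst (𝕜 := 𝕜) M).toAlgebra
  exact IsIntegral.of_pow (NeZero.pos M)
    (isIntegral_algebraMap (x := (⟨fun s => s, analyticAt_id⟩ : analyticAtZero 𝕜)))

lemma exists_isIntegralElem_powSubst_of_analyticAt [CompleteSpace 𝕜] (M : ℕ) [NeZero M] {b : 𝕜 → 𝕜}
    (hb : AnalyticAt 𝕜 b 0) :
    ∃ g : analyticAtZero 𝕜, b =ᶠ[𝓝 0] g.1 ∧ (powSubst M).IsIntegralElem g := by
  obtain ⟨B, hB, hbB⟩ := exists_eventuallyEq_sum_zmod_of_analyticAt M hb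
  let x : analyticAtZero 𝕜 := ⟨fun s => s, analyticAt_id⟩
  refine ⟨∑ j : ZMod M, x ^ j.val * powSubst M ⟨B j, hB j⟩, ?_, ?_⟩
  · filter_upwards [hbB] with s hs
    rw [hs, ← evalAt_apply, map_sum]
    rfl
  · let := (powSubst (𝕜 := 𝕜) M).toAlgebra
    exact IsIntegral.sum _ fun j _ =>
      (IsIntegral.pow (x := x) (isIntegralElem_powSubst_id M) _).mul isIntegral_algebraMap

/-- A convergent Puiseux series `b (v ^ (1 / M))` is a root of a monic polynomial with coefficients
analytic in `v`, and Thom's lemma singles it out among the roots. -/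
lemma exists_forall_eq_iff_sign_of_analyticAt (M : ℕ) [NeZero M] {b : ℝ → ℝ}
    (hb : AnalyticAt ℝ b 0) :
    ∃ (N : ℕ) (D : Fin N → (analyticAtZero ℝ)[X]) (σ : Fin N → SignType),
      ∀ᶠ s in 𝓝[>] (0 : ℝ), ∀ t : ℝ, t = b s ↔
        ∀ k, SignType.sign (((D k).map (evalAt (s ^ M))).eval t) = σ k := by
  obtain ⟨g, hbg, P, hP, hroot⟩ := exists_isIntegralElem_powSubst_of_analyticAt M hb
  let D (k : Fin (P.natDegree + 1)) : (analyticAtZero ℝ)[X] := derivative^[k] P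
  have hsign (k) : ∃ σ : SignType, ∀ᶠ s in 𝓝[>] (0 : ℝ),
      SignType.sign (((D k).map (evalAt (s ^ M))).eval (g.1 s)) = σ := by
    simp only [← evalAt_eval₂_powSubst]
    exact exists_eventually_sign_eq_of_analyticAt ((D k).eval₂ (powSubst M) g).2
  choose σ hσ using hsign
  refine ⟨P.natDegree + 1, D, σ, ?_⟩
  filter_upwards [nhdsWithin_le_nhds hbg, eventually_all.2 hσ] with s hs hsσ t
  rw [hs]
  refine ⟨fun h => h ▸ hsσ, fun h => ?_⟩
  have hzero : (P.map (evalAt (s ^ M))).eval (g.1 s) = 0 := by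
    rw [← evalAt_eval₂_powSubst, hroot]
    rfl
  refine (eq_of_sign_iterate_derivative_eq (hP.map _).ne_zero hzero fun k hk => ?_).symm
  rw [hP.natDegree_map] at hk
  rw [iterate_derivative_map]
  exact (hsσ ⟨k, by omega⟩).trans (h ⟨k, by omega⟩).symm

end Puiseux

/-! ### Semianalytic germs -/

section SemianalyticGerms

variable {E E' : Type*} [NormedAddCommGroup E] [NormedSpace ℝ E]
  [NormedAddCommGroup E'] [NormedSpace ℝ E']

/-- `T` is semianalytic at `c`: near `c` it is a finite union of sets
`{F = 0, G₁ > 0, …, Gₘ > 0}` with functions analytic at `c`. Only the germ of `T` at `c` matters. -/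
def IsSemianalyticAt (T : Set E) (c : E) : Prop :=
  ∃ (ι κ : Type) (_ : Finite ι) (_ : Finite κ) (F : ι → E → ℝ) (G : ι → κ → E → ℝ),
    (∀ i, AnalyticAt ℝ (F i) c) ∧ (∀ i j, AnalyticAt ℝ (G i j) c) ∧
    ∀ᶠ w in 𝓝 c, (w ∈ T ↔ ∃ i, F i w = 0 ∧ ∀ j, 0 < G i j w)

lemma IsSemianalyticAt.congr {T T' : Set E} {c : E} (h : IsSemianalyticAt T c)
    (hT : ∀ᶠ w in 𝓝 c, (w ∈ T' ↔ w ∈ T)) : IsSemianalyticAt T' c := by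
  obtain ⟨ι, κ, _, _, F, G, hF, hG, hev⟩ := h
  exact ⟨ι, κ, ‹_›, ‹_›, F, G, hF, hG, (hT.and hev).mono fun _ hw => hw.1.trans hw.2⟩

lemma isSemianalyticAt_empty (c : E) : IsSemianalyticAt ∅ c :=
  ⟨Empty, Empty, inferInstance, inferInstance, fun i => i.elim, fun i => i.elim,
    fun i => i.elim, fun i => i.elim, by simp⟩

lemma IsSemianalyticAt.union {T T' : Set E} {c : E} (h : IsSemianalyticAt T c)
    (h' : IsSemianalyticAt T' c) : IsSemianalyticAt (T ∪ T') c := by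
  obtain ⟨ι, κ, _, _, F, G, hF, hG, hev⟩ := h
  obtain ⟨ι', κ', _, _, F', G', hF', hG', hev'⟩ := h'
  refine ⟨ι ⊕ ι', κ ⊕ κ', inferInstance, inferInstance, Sum.elim F F',
    Sum.elim (fun i => Sum.elim (G i) fun _ _ => 1) (fun i => Sum.elim (fun _ _ => 1) (G' i)),
    ?_, ?_, ?_⟩
  · rintro (i | i)
    exacts [hF i, hF' i]
  · rintro (i | i) (j | j)
    exacts [hG i j, analyticAt_const, analyticAt_const, hG' i j]
  · filter_upwards [hev, hev'] with w hw hw'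
    simp [hw, hw']

lemma IsSemianalyticAt.biUnion {α : Type*} (s : Finset α) {T : α → Set E} {c : E}
    (h : ∀ a ∈ s, IsSemianalyticAt (T a) c) : IsSemianalyticAt (⋃ a ∈ s, T a) c := by
  classical
  induction s using Finset.induction_on with
  | empty => simpa using isSemianalyticAt_empty c
  | insert a s _ ih =>
    rw [Finset.set_biUnion_insert]
    exact (h a (by simp)).union (ih fun b hb => h b (by simp [hb]))

lemma IsSemianalyticAt.preimage {T : Set E'} {c : E} {φ : E → E'}
    (h : IsSemianalyticAt T (φ c)) (hφ : AnalyticAt ℝ φ c) :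
    IsSemianalyticAt (φ ⁻¹' T) c := by
  obtain ⟨ι, κ, _, _, F, G, hF, hG, hev⟩ := h
  exact ⟨ι, κ, ‹_›, ‹_›, fun i => F i ∘ φ, fun i j => G i j ∘ φ, fun i => (hF i).comp hφ,
    fun i j => (hG i j).comp hφ, hφ.continuousAt.eventually hev⟩

lemma isSemianalyticAt_setOf_sign_eq {K : Type} [Finite K] {Φ : K → E → ℝ} {σ : K → SignType}
    {c : E} (hΦ : ∀ k, AnalyticAt ℝ (Φ k) c) :
    IsSemianalyticAt {w | ∀ k, SignType.sign (Φ k w) = σ k} c := by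
  classical
  cases nonempty_fintype K
  refine ⟨Unit, K, inferInstance, inferInstance,
    fun _ w => ∑ k, if σ k = 0 then (Φ k w) ^ 2 else 0,
    fun _ k w => if σ k = 0 then 1 else (σ k : ℝ) * Φ k w, fun _ => ?_, fun _ k => ?_, ?_⟩
  · refine Finset.analyticAt_fun_sum _ fun k _ => ?_
    split_ifs
    exacts [(hΦ k).pow 2, analyticAt_const]
  · dsimp only
    split_ifs
    exacts [analyticAt_const, analyticAt_const.mul (hΦ k)]
  · refine Eventually.of_forall fun w => ?_
    have hsum : (∑ k, if σ k = 0 then (Φ k w) ^ 2 else 0) = 0 ↔ ∀ k, σ k = 0 → Φ k w = 0 := by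
      rw [Finset.sum_eq_zero_iff_of_nonneg fun k _ => by split_ifs <;> positivity]
      simp
    simp only [exists_const, hsum, mem_ofPred_eq, ← forall_and]
    refine forall_congr' fun k => ?_
    rcases σ k with _ | _ | _
    · simp
    · simpa using sign_eq_neg_one_iff
    · simpa using sign_eq_one_iff

lemma isSemianalyticAt_singleton [FiniteDimensional ℝ E] (c : E) : IsSemianalyticAt {c} c := by
  let b := Module.finBasis ℝ E
  refine (isSemianalyticAt_setOf_sign_eq (σ := fun _ => 0)
    (Φ := fun k w => (b.coord k).toContinuousLinearMap (w - c)) fun k => ?_).congr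
    (Eventually.of_forall fun w => ?_)
  · exact (((b.coord k).toContinuousLinearMap).analyticAt _).comp
      (f := fun w => w - c) (analyticAt_id.sub analyticAt_const)
  · simp only [mem_singleton_iff, mem_ofPred_eq, sign_eq_zero_iff,
      LinearMap.coe_toContinuousLinearMap', b.forall_coord_eq_zero_iff, sub_eq_zero]

end SemianalyticGerms

/-! ### Arcs -/

section Arcs

/-- The arc `θ = β (r ^ (1 / m))` in polar coordinates, without its end point at the origin: the
germ of a branch of a real analytic curve, parametrized by the root `r ^ (1 / m)` of the radius. -/
def arc (m : ℕ) (β : ℝ → ℝ) : Set ℂ :=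
  {z | z ≠ 0 ∧ z = ‖z‖ * Complex.exp (β (‖z‖ ^ (1 / m : ℝ)) * Complex.I)}

variable {m : ℕ} {β : ℝ → ℝ} {z : ℂ}

lemma tendsto_norm_rpow (hm : m ≠ 0) :
    Tendsto (fun z : ℂ => ‖z‖ ^ (1 / m : ℝ)) (𝓝[≠] 0) (𝓝[>] 0) := by
  have hm' : (0 : ℝ) < 1 / m := by positivity
  refine tendsto_nhdsWithin_iff.2 ⟨?_, ?_⟩
  · refine (Continuous.tendsto' ?_ 0 0 ?_).mono_left nhdsWithin_le_nhds
    · exact continuous_norm.rpow_const fun _ => Or.inr hm'.le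
    · rw [norm_zero, Real.zero_rpow hm'.ne']
  · filter_upwards [self_mem_nhdsWithin] with z hz
    exact Real.rpow_pos_of_pos (norm_pos_iff.2 hz) _

lemma norm_rpow_pow (hm : m ≠ 0) (z : ℂ) : (‖z‖ ^ (1 / m : ℝ)) ^ m = ‖z‖ := by
  rw [one_div, Real.rpow_inv_natCast_pow (norm_nonneg z) hm]

lemma eq_norm_mul_exp_iff_of_abs_lt {θ : ℝ} (hz : z ≠ 0) (hθ : |θ| < Real.pi / 2) :
    z = ‖z‖ * Complex.exp (θ * Complex.I) ↔ 0 < z.re ∧ z.im / z.re = Real.tan θ := by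
  have hθ' : θ ∈ Ioo (-(Real.pi / 2)) (Real.pi / 2) := abs_lt.1 hθ
  constructor
  · intro h
    have hnorm : 0 < ‖z‖ := norm_pos_iff.2 hz
    have hre : z.re = ‖z‖ * Real.cos θ := by
      simpa [Complex.exp_ofReal_mul_I_re] using congrArg Complex.re h
    have him : z.im = ‖z‖ * Real.sin θ := by
      simpa [Complex.exp_ofReal_mul_I_im] using congrArg Complex.im h
    refine ⟨hre ▸ mul_pos hnorm (Real.cos_pos_of_mem_Ioo hθ'), ?_⟩
    rw [him, hre, Real.tan_eq_sin_div_cos, mul_div_mul_left _ _ hnorm.ne']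
  · rintro ⟨hre, h⟩
    have harg := abs_lt.1 (Complex.abs_arg_lt_pi_div_two_iff.2 (Or.inl hre))
    rw [← Complex.tan_arg] at h
    rw [← Real.injOn_tan harg hθ' h, Complex.norm_mul_exp_arg_mul_I]

open Polynomial in
lemma sum_coeff_mul_pow_mul_pow {p : ℝ[X]} {n : ℕ} (hp : p.natDegree ≤ n) {x : ℝ} (hx : x ≠ 0)
    (y : ℝ) : ∑ i ∈ Finset.range (n + 1), p.coeff i * x ^ (n - i) * y ^ i =
      x ^ n * p.eval (y / x) := by
  rw [eval_eq_sum_range' (Nat.lt_succ_of_le hp), Finset.mul_sum]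
  refine Finset.sum_congr rfl fun i hi => ?_
  obtain ⟨j, rfl⟩ := Nat.exists_eq_add_of_le (Finset.mem_range_succ_iff.1 hi)
  rw [Nat.add_sub_cancel_left, div_pow, pow_add]
  field_simp

open Polynomial in
lemma isSemianalyticAt_setOf_sign_eval_slope_eq {K : Type} [Finite K]
    (D : K → (analyticAtZero ℝ)[X]) (σ : K → SignType) :
    IsSemianalyticAt {z : ℂ | 0 < z.re ∧
      ∀ k, SignType.sign (((D k).map (evalAt (Complex.normSq z))).eval (z.im / z.re)) = σ k} 0 := by
  let Φ (k : Option K) (z : ℂ) : ℝ := k.elim z.re fun k =>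
    ∑ i ∈ Finset.range ((D k).natDegree + 1),
      ((D k).coeff i).1 (Complex.normSq z) * z.re ^ ((D k).natDegree - i) * z.im ^ i
  have hre : AnalyticAt ℝ (fun z : ℂ => z.re) 0 := Complex.reCLM.analyticAt _
  have him : AnalyticAt ℝ (fun z : ℂ => z.im) 0 := Complex.imCLM.analyticAt _
  have hnormSq : AnalyticAt ℝ (fun z : ℂ => Complex.normSq z) 0 := by
    simp only [Complex.normSq_apply]
    exact (hre.mul hre).add (him.mul him)
  refine (isSemianalyticAt_setOf_sign_eq (Φ := Φ) (σ := fun k => k.elim 1 σ) ?_).congr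
    (Eventually.of_forall fun z => ?_)
  · rintro (_ | k)
    · exact hre
    · refine Finset.analyticAt_fun_sum _ fun i _ => (AnalyticAt.mul ?_ (hre.pow _)).mul (him.pow _)
      refine AnalyticAt.fun_comp (f := fun z : ℂ => Complex.normSq z) ?_ hnormSq
      rw [map_zero]
      exact ((D k).coeff i).2
  · simp only [mem_ofPred_eq, Option.forall, Option.elim_none, Option.elim_some, sign_eq_one_iff, Φ]
    refine and_congr_right fun hx => forall_congr' fun k => ?_
    have hsum := sum_coeff_mul_pow_mul_pow
      (natDegree_map_le (f := evalAt (Complex.normSq z)) (p := D k)) hx.ne' z.im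
    simp only [coeff_map, evalAt_apply] at hsum
    rw [hsum, sign_mul, sign_pos (pow_pos hx _), one_mul]

lemma analyticAt_tan_comp (hβ : AnalyticAt ℝ β 0) (h0 : β 0 = 0) :
    AnalyticAt ℝ (fun s => Real.tan (β s)) 0 := by
  simp only [Real.tan_eq_sin_div_cos]
  exact (Real.analyticAt_sin.comp hβ).div (Real.analyticAt_cos.comp hβ) (by simp [h0])

lemma isSemianalyticAt_arc_of_apply_zero_eq_zero (hm : m ≠ 0) (hβ : AnalyticAt ℝ β 0)
    (h0 : β 0 = 0) : IsSemianalyticAt (arc m β) 0 := by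
  have : NeZero (2 * m) := ⟨by omega⟩
  obtain ⟨N, D, σ, hD⟩ :=
    exists_forall_eq_iff_sign_of_analyticAt (2 * m) (analyticAt_tan_comp hβ h0)
  have hsmall : ∀ᶠ s in 𝓝[>] (0 : ℝ), |β s| < Real.pi / 2 :=
    nhdsWithin_le_nhds <| hβ.continuousAt.abs.eventually_lt continuousAt_const <| by
      rw [h0, abs_zero]
      positivity
  refine (isSemianalyticAt_setOf_sign_eval_slope_eq D σ).congr ?_
  filter_upwards [eventually_nhdsWithin_iff.1 ((tendsto_norm_rpow hm).eventually (hD.and hsmall))]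
    with z hz
  rcases eq_or_ne z 0 with rfl | hz0
  · simp [arc]
  · obtain ⟨hsign, hlt⟩ := hz hz0
    have hpow : (‖z‖ ^ (1 / m : ℝ)) ^ (2 * m) = Complex.normSq z := by
      rw [mul_comm, pow_mul, norm_rpow_pow hm, Complex.normSq_eq_norm_sq]
    simp only [arc, mem_ofPred_eq, hz0, ne_eq, not_false_eq_true, true_and,
      eq_norm_mul_exp_iff_of_abs_lt hz0 hlt, hsign, hpow]

lemma isSemianalyticAt_arc (hm : m ≠ 0) (hβ : AnalyticAt ℝ β 0) :
    IsSemianalyticAt (arc m β) 0 := by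
  set a : ℂ := Complex.exp (β 0 * Complex.I) with ha
  have ha0 : a ≠ 0 := Complex.exp_ne_zero _
  have hna : ‖a‖ = 1 := Complex.norm_exp_ofReal_mul_I _
  have hrot : AnalyticAt ℝ (fun z : ℂ => a⁻¹ * z) 0 := by fun_prop
  have h := isSemianalyticAt_arc_of_apply_zero_eq_zero hm (β := fun s => β s - β 0)
    (hβ.sub analyticAt_const) (sub_self _)
  rw [← mul_zero a⁻¹] at h
  refine (h.preimage hrot).congr (Eventually.of_forall fun z => ?_)
  simp only [arc, mem_preimage, mem_ofPred_eq, norm_mul, norm_inv, hna, inv_one, one_mul]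
  refine and_congr (by simp [ha0]) ?_
  have hexp : Complex.exp (((β (‖z‖ ^ (1 / m : ℝ)) - β 0 : ℝ) : ℂ) * Complex.I) =
      a⁻¹ * Complex.exp (β (‖z‖ ^ (1 / m : ℝ)) * Complex.I) := by
    rw [ha, ← Complex.exp_neg, ← Complex.exp_add]
    push_cast
    ring_nf
  rw [hexp, mul_left_comm, mul_right_inj' (inv_ne_zero ha0)]

end Arcs

/-! ### Topology of arcs -/

section ArcPath

/-- The parametrization of `arc m β` by the root of the radius. -/
noncomputable def arcPath (m : ℕ) (β : ℝ → ℝ) (s : ℝ) : ℂ :=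
  (s : ℂ) ^ m * Complex.exp (β s * Complex.I)

variable {m : ℕ} {β γ : ℝ → ℝ} {s δ : ℝ} {z : ℂ}

lemma norm_arcPath (hs : 0 ≤ s) : ‖arcPath m β s‖ = s ^ m := by
  rw [arcPath, norm_mul, Complex.norm_exp_ofReal_mul_I, mul_one, norm_pow, Complex.norm_real,
    Real.norm_of_nonneg hs]

lemma arcPath_zero (hm : m ≠ 0) (β : ℝ → ℝ) : arcPath m β 0 = 0 := by
  simp [arcPath, hm]

lemma arcPath_ne_zero (hs : 0 < s) : arcPath m β s ≠ 0 := by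
  rw [← norm_pos_iff, norm_arcPath hs.le]
  positivity

lemma norm_arcPath_rpow (hm : m ≠ 0) (hs : 0 ≤ s) : ‖arcPath m β s‖ ^ (1 / m : ℝ) = s := by
  rw [norm_arcPath hs, one_div, Real.pow_rpow_inv_natCast hs hm]

lemma arcPath_mem_ball (hm : m ≠ 0) (hs : s ∈ Ico 0 δ) :
    arcPath m β s ∈ Metric.ball 0 (δ ^ m) := by
  rw [mem_ball_zero_iff, norm_arcPath hs.1]
  exact pow_lt_pow_left₀ hs.2 hs.1 hm

lemma norm_rpow_mem_Ico (hm : m ≠ 0) (hδ : 0 ≤ δ) (hz : z ∈ Metric.ball 0 (δ ^ m)) :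
    ‖z‖ ^ (1 / m : ℝ) ∈ Ico 0 δ :=
  ⟨by positivity, lt_of_pow_lt_pow_left₀ m hδ <| by
    rw [norm_rpow_pow hm]
    exact mem_ball_zero_iff.1 hz⟩

lemma arcPath_mem_arc_iff (hm : m ≠ 0) (hs : 0 < s) :
    arcPath m β s ∈ arc m γ ↔ Complex.exp (β s * Complex.I) = Complex.exp (γ s * Complex.I) := by
  have hs' : (s : ℂ) ^ m ≠ 0 := pow_ne_zero _ (by exact_mod_cast hs.ne')
  simp only [arc, mem_ofPred_eq, norm_arcPath_rpow hm hs.le]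
  rw [norm_arcPath hs.le, and_iff_right (arcPath_ne_zero hs), arcPath, Complex.ofReal_pow,
    mul_right_inj' hs']

lemma arcPath_mem_arc (hm : m ≠ 0) (hs : 0 < s) : arcPath m β s ∈ arc m β :=
  (arcPath_mem_arc_iff hm hs).2 rfl

lemma arcPath_const_arg (hm : m ≠ 0) (z : ℂ) :
    arcPath m (fun _ => z.arg) (‖z‖ ^ (1 / m : ℝ)) = z := by
  rw [arcPath, ← Complex.ofReal_pow, norm_rpow_pow hm, Complex.norm_mul_exp_arg_mul_I]

lemma eq_arcPath_of_mem_arc (hm : m ≠ 0) (hz : z ∈ arc m β) :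
    z = arcPath m β (‖z‖ ^ (1 / m : ℝ)) := by
  rw [arcPath, ← Complex.ofReal_pow, norm_rpow_pow hm]
  exact hz.2

lemma continuousAt_arcPath (hβ : ContinuousAt β s) : ContinuousAt (arcPath m β) s := by
  unfold arcPath
  fun_prop

lemma injOn_arcPath (hm : m ≠ 0) (β : ℝ → ℝ) : InjOn (arcPath m β) (Ici 0) :=
  fun s hs t ht h => by rw [← norm_arcPath_rpow (β := β) hm hs, h, norm_arcPath_rpow hm ht]

lemma accPt_arcPath (hm : m ≠ 0) (hs : 0 ≤ s) (hβ : ContinuousAt β s) :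
    AccPt (arcPath m β s) (𝓟 (arc m β)) := by
  have h : Tendsto (arcPath m β) (𝓝[>] s) (𝓝[≠] arcPath m β s ⊓ 𝓟 (arc m β)) := by
    refine tendsto_inf.2 ⟨tendsto_nhdsWithin_iff.2
      ⟨(continuousAt_arcPath hβ).tendsto.mono_left nhdsWithin_le_nhds, ?_⟩, tendsto_principal.2 ?_⟩
    · filter_upwards [self_mem_nhdsWithin] with t ht h
      exact (ne_of_gt (show s < t from ht)) (injOn_arcPath hm β (hs.trans (le_of_lt ht)) hs h)
    · filter_upwards [self_mem_nhdsWithin] with t ht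
      exact arcPath_mem_arc hm (hs.trans_lt ht)
  exact h.neBot

lemma accPt_of_mem_arc (hm : m ≠ 0) (hz : z ∈ arc m β)
    (hβ : ContinuousAt β (‖z‖ ^ (1 / m : ℝ))) : AccPt z (𝓟 (arc m β)) := by
  have h := accPt_arcPath hm (by positivity) hβ
  rwa [← eq_arcPath_of_mem_arc hm hz] at h

lemma insert_arc_inter_ball_eq_image (hm : m ≠ 0) (hδ : 0 < δ) (β : ℝ → ℝ) :
    insert 0 (arc m β ∩ Metric.ball 0 (δ ^ m)) = arcPath m β '' Ico 0 δ := by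
  ext z
  constructor
  · rintro (rfl | ⟨hz, hzδ⟩)
    · exact ⟨0, ⟨le_rfl, hδ⟩, arcPath_zero hm β⟩
    · exact ⟨_, norm_rpow_mem_Ico hm hδ.le hzδ, (eq_arcPath_of_mem_arc hm hz).symm⟩
  · rintro ⟨s, hs, rfl⟩
    rcases hs.1.eq_or_lt with rfl | hs0
    · exact Or.inl (arcPath_zero hm β)
    · exact Or.inr ⟨arcPath_mem_arc hm hs0, arcPath_mem_ball hm hs⟩

lemma isPreconnected_insert_arc_inter_ball (hm : m ≠ 0) (hδ : 0 < δ)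
    (hβ : ∀ s ∈ Ico 0 δ, ContinuousAt β s) :
    IsPreconnected (insert 0 (arc m β ∩ Metric.ball 0 (δ ^ m))) := by
  rw [insert_arc_inter_ball_eq_image hm hδ]
  exact isPreconnected_Ico.image _ fun s hs =>
    (continuousAt_arcPath (hβ s hs)).continuousWithinAt

lemma finite_sphere_inter_arc (m : ℕ) (β : ℝ → ℝ) (r : ℝ) :
    (Metric.sphere 0 r ∩ arc m β).Finite := by
  refine (finite_singleton ((r : ℂ) * Complex.exp (β (r ^ (1 / m : ℝ)) * Complex.I))).subset ?_
  rintro z ⟨hzr, -, hz⟩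
  rw [mem_sphere_zero_iff_norm] at hzr
  rwa [hzr] at hz

lemma not_eventually_mem_arc (m : ℕ) (A : Finset (ℝ → ℝ)) :
    ¬ ∀ᶠ z in 𝓝[≠] (0 : ℂ), ∃ β ∈ A, z ∈ arc m β := by
  intro h
  rw [eventually_nhdsWithin_iff, Metric.eventually_nhds_iff] at h
  obtain ⟨ε, hε, h⟩ := h
  have hr : 0 < ε / 2 := by positivity
  have hfin : (Metric.sphere (0 : ℂ) (ε / 2)).Finite := by
    refine (A.finite_toSet.biUnion fun β _ => finite_sphere_inter_arc m β (ε / 2)).subset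
      fun z hz => ?_
    have hzr : ‖z‖ = ε / 2 := mem_sphere_zero_iff_norm.1 hz
    obtain ⟨β, hβ, hzβ⟩ := h (y := z) (by rw [dist_zero_right, hzr]; exact half_lt_self hε)
      (norm_pos_iff.1 (hzr ▸ hr))
    exact mem_biUnion hβ ⟨hz, hzβ⟩
  have hconn : IsPreconnected (Metric.sphere (0 : ℂ) (ε / 2)) :=
    isPreconnected_sphere (by rw [Complex.rank_real_complex]; norm_num) 0 _
  have hmem : ((ε / 2 : ℝ) : ℂ) ∈ Metric.sphere (0 : ℂ) (ε / 2) := by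
    rw [mem_sphere_zero_iff_norm, Complex.norm_real, Real.norm_of_nonneg hr.le]
  have hneg : -((ε / 2 : ℝ) : ℂ) ∈ Metric.sphere (0 : ℂ) (ε / 2) := by
    rwa [mem_sphere_zero_iff_norm, norm_neg, ← mem_sphere_zero_iff_norm]
  refine hconn.infinite_of_nontrivial ⟨_, hmem, _, hneg, fun h => ?_⟩ hfin
  rw [self_eq_neg, Complex.ofReal_eq_zero] at h
  exact hr.ne' h

end ArcPath

section Sectors

variable {α : Type*} [TopologicalSpace α] {I : Set α}

lemma isPreconnected_setOf_between {lo hi : α → ℝ} (hI : IsPreconnected I)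
    (hlo : ContinuousOn lo I) (hhi : ContinuousOn hi I) (hlt : ∀ s ∈ I, lo s < hi s) :
    IsPreconnected {p : α × ℝ | p.1 ∈ I ∧ lo p.1 < p.2 ∧ p.2 < hi p.1} := by
  have himage : {p : α × ℝ | p.1 ∈ I ∧ lo p.1 < p.2 ∧ p.2 < hi p.1} =
      (fun p : α × ℝ => (p.1, lo p.1 + p.2 * (hi p.1 - lo p.1))) '' (I ×ˢ Ioo 0 1) := by
    ext ⟨s, θ⟩
    constructor
    · rintro ⟨hs, h1, h2⟩
      dsimp only at hs h1 h2
      have hd : 0 < hi s - lo s := sub_pos.2 (hlt s hs)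
      refine ⟨(s, (θ - lo s) / (hi s - lo s)), ⟨hs, div_pos (by linarith) hd,
        (div_lt_one hd).2 (by linarith)⟩, Prod.ext rfl ?_⟩
      simp only [div_mul_cancel₀ _ hd.ne', add_sub_cancel]
    · rintro ⟨⟨s', l⟩, ⟨hs, h1, h2⟩, h⟩
      dsimp only at hs h1 h2 h
      obtain ⟨rfl, rfl⟩ := Prod.mk.inj h
      have hd : 0 < hi s' - lo s' := sub_pos.2 (hlt s' hs)
      refine ⟨hs, ?_, ?_⟩ <;> dsimp only <;> nlinarith
  rw [himage]
  refine (hI.prod isPreconnected_Ioo).image _ ?_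
  have h1 : ContinuousOn (fun p : α × ℝ => lo p.1) (I ×ˢ Ioo 0 1) :=
    hlo.comp continuousOn_fst fun p hp => hp.1
  have h2 : ContinuousOn (fun p : α × ℝ => hi p.1) (I ×ˢ Ioo 0 1) :=
    hhi.comp continuousOn_fst fun p hp => hp.1
  exact continuousOn_fst.prodMk (h1.add (continuousOn_snd.mul (h2.sub h1)))

lemma isPreconnected_setOf_between_finset (hI : IsPreconnected I) {L R : Finset (α → ℝ)}
    (hL : L.Nonempty) (hR : R.Nonempty) (hcL : ∀ b ∈ L, ContinuousOn b I)
    (hcR : ∀ b ∈ R, ContinuousOn b I)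
    (horder : ∀ b ∈ L, ∀ c ∈ R, ∀ s ∈ I, ∀ t ∈ I, b s < c s → b t < c t) :
    IsPreconnected
      {p : α × ℝ | p.1 ∈ I ∧ (∀ b ∈ L, b p.1 < p.2) ∧ ∀ c ∈ R, p.2 < c p.1} := by
  rcases Set.eq_empty_or_nonempty
    {p : α × ℝ | p.1 ∈ I ∧ (∀ b ∈ L, b p.1 < p.2) ∧ ∀ c ∈ R, p.2 < c p.1} with he | ⟨q, hq⟩
  · rw [he]
    exact isPreconnected_empty
  have hlt : ∀ s ∈ I, (L.sup' hL fun b => b s) < R.inf' hR fun c => c s := by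
    intro s hs
    simp only [Finset.sup'_lt_iff, Finset.lt_inf'_iff]
    exact fun c hc b hb => horder b hb c hc q.1 hq.1 s hs ((hq.2.1 b hb).trans (hq.2.2 c hc))
  convert isPreconnected_setOf_between hI (ContinuousOn.finset_sup'_apply hL hcL)
    (ContinuousOn.finset_inf'_apply hR hcR) hlt using 3
  simp only [Finset.sup'_lt_iff, Finset.lt_inf'_iff]

lemma exists_finite_isPreconnected_sUnion_eq_compl_graphs (hI : IsPreconnected I)
    {Λ : Finset (α → ℝ)} {lo hi : α → ℝ} (hlo : lo ∈ Λ) (hhi : hi ∈ Λ)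
    (hc : ∀ b ∈ Λ, ContinuousOn b I)
    (horder : ∀ b ∈ Λ, ∀ c ∈ Λ, ∀ s ∈ I, ∀ t ∈ I, b s < c s → b t < c t) :
    ∃ 𝓑 : Set (Set (α × ℝ)), 𝓑.Finite ∧ (∀ B ∈ 𝓑, IsPreconnected B) ∧
      ⋃₀ 𝓑 = {p | p.1 ∈ I ∧ lo p.1 < p.2 ∧ p.2 < hi p.1 ∧ ∀ b ∈ Λ, p.2 ≠ b p.1} := by
  classical
  let E (L : Finset (α → ℝ)) : Set (α × ℝ) :=
    {p | p.1 ∈ I ∧ (∀ b ∈ L, b p.1 < p.2) ∧ ∀ c ∈ Λ \ L, p.2 < c p.1}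
  refine ⟨E '' {L | L ⊆ Λ ∧ lo ∈ L ∧ hi ∉ L},
    (Λ.powerset.finite_toSet.subset fun L hL => by simpa using hL.1).image _, ?_, ?_⟩
  · rintro _ ⟨L, ⟨hL, h1, h2⟩, rfl⟩
    exact isPreconnected_setOf_between_finset hI ⟨_, h1⟩ ⟨_, Finset.mem_sdiff.2 ⟨hhi, h2⟩⟩
      (fun b hb => hc b (hL hb)) (fun b hb => hc b (Finset.mem_sdiff.1 hb).1)
      fun b hb c hc => horder b (hL hb) c (Finset.mem_sdiff.1 hc).1
  · ext p
    constructor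
    · rintro ⟨_, ⟨L, ⟨-, h1, h2⟩, rfl⟩, hp, hbelow, habove⟩
      refine ⟨hp, hbelow _ h1, habove _ (Finset.mem_sdiff.2 ⟨hhi, h2⟩), fun b hb => ?_⟩
      by_cases hbL : b ∈ L
      · exact (hbelow b hbL).ne'
      · exact (habove b (Finset.mem_sdiff.2 ⟨hb, hbL⟩)).ne
    · rintro ⟨hp, h1, h2, hne⟩
      refine ⟨_, ⟨Λ.filter fun b => b p.1 < p.2, ⟨Finset.filter_subset _ _, ?_, ?_⟩, rfl⟩, hp,
        fun b hb => (Finset.mem_filter.1 hb).2, fun c hc => ?_⟩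
      · exact Finset.mem_filter.2 ⟨hlo, h1⟩
      · exact fun h => (Finset.mem_filter.1 h).2.not_gt h2
      · rw [Finset.mem_sdiff, Finset.mem_filter, not_and, not_lt] at hc
        exact (hc.2 hc.1).lt_of_ne (hne c hc.1)

lemma eventually_forall_mem_Ioo {a : ℝ} {P : ℝ → Prop} (h : ∀ᶠ s in 𝓝[>] a, P s) :
    ∀ᶠ δ in 𝓝[>] a, ∀ s ∈ Ioo a δ, P s := by
  obtain ⟨δ₀, hδ₀, h⟩ := mem_nhdsGT_iff_exists_Ioo_subset.1 h
  filter_upwards [Ioo_mem_nhdsGT hδ₀] with δ hδ s hs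
  exact h ⟨hs.1, hs.2.trans hδ.2⟩

lemma eventually_forall_lt_imp_lt_of_analyticAt {b c : ℝ → ℝ} {a : ℝ} (hb : AnalyticAt ℝ b a)
    (hc : AnalyticAt ℝ c a) :
    ∀ᶠ δ in 𝓝[>] a, ∀ s ∈ Ioo a δ, ∀ t ∈ Ioo a δ, b s < c s → b t < c t := by
  obtain ⟨σ, hσ⟩ := exists_eventually_sign_eq_of_analyticAt (hc.sub hb)
  filter_upwards [eventually_forall_mem_Ioo hσ] with δ hδ s hs t ht hlt
  have hs' := hδ s hs
  rw [Pi.sub_apply, sign_pos (sub_pos.2 hlt)] at hs'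
  exact sub_pos.1 (sign_eq_one_iff.1 ((hδ t ht).trans hs'.symm))

lemma exp_mul_I_eq_exp_mul_I_iff {θ η : ℝ} :
    Complex.exp (θ * Complex.I) = Complex.exp (η * Complex.I) ↔
      ∃ k : ℤ, θ = η + k * (2 * Real.pi) := by
  rw [Complex.exp_eq_exp_iff_exists_int]
  refine exists_congr fun k => ?_
  rw [← mul_assoc, ← mul_assoc, ← add_mul, mul_left_inj' Complex.I_ne_zero]
  rw [← Complex.ofReal_inj]
  push_cast
  rw [mul_assoc]

lemma exists_finset_forall_exp_eq_iff {A : Finset (ℝ → ℝ)} (hA : ∀ β ∈ A, AnalyticAt ℝ β 0)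
    (M : ℝ) : ∃ Λ : Finset (ℝ → ℝ), (∀ b ∈ Λ, AnalyticAt ℝ b 0) ∧ ∀ᶠ s in 𝓝[>] (0 : ℝ),
      ∀ θ : ℝ, |θ| < M →
        ((∃ β ∈ A, Complex.exp (θ * Complex.I) = Complex.exp (β s * Complex.I)) ↔
          ∃ b ∈ Λ, θ = b s) := by
  classical
  have hbdd : ∃ C : ℝ, ∀ᶠ s in 𝓝[>] (0 : ℝ), ∀ β ∈ A, |β s| ≤ C := by
    refine ⟨∑ β ∈ A, (|β 0| + 1), A.eventually_all.2 fun β hβ => nhdsWithin_le_nhds ?_⟩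
    filter_upwards [(hA β hβ).continuousAt.abs.eventually_lt continuousAt_const
      (lt_add_one |β 0|)] with s hs
    exact hs.le.trans (Finset.single_le_sum (f := fun β : ℝ → ℝ => |β 0| + 1)
      (fun β _ => by positivity) hβ)
  obtain ⟨C, hC⟩ := hbdd
  obtain ⟨K, hK⟩ := exists_nat_ge (C + M)
  refine ⟨(A ×ˢ Finset.Icc (-(K : ℤ)) K).image fun p s => p.1 s + p.2 * (2 * Real.pi), ?_, ?_⟩
  · intro b hb
    obtain ⟨p, hp, rfl⟩ := Finset.mem_image.1 hb
    exact (hA _ (Finset.mem_product.1 hp).1).add analyticAt_const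
  filter_upwards [hC] with s hs θ hθ
  simp only [exp_mul_I_eq_exp_mul_I_iff, Finset.exists_mem_image, Prod.exists, Finset.mem_product,
    Finset.mem_Icc]
  constructor
  · rintro ⟨β, hβ, k, hk⟩
    refine ⟨β, k, ⟨hβ, ?_⟩, hk⟩
    have hkK : |(k : ℝ)| ≤ K := by
      have hπ : |(k : ℝ)| * 1 ≤ |(k : ℝ)| * |2 * Real.pi| := by
        gcongr
        rw [abs_of_pos Real.two_pi_pos]
        linarith [Real.pi_gt_three]
      rw [← abs_mul, show (k : ℝ) * (2 * Real.pi) = θ - β s by rw [hk]; ring] at hπ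
      linarith [abs_sub θ (β s), hs β hβ]
    exact abs_le.1 (by exact_mod_cast hkK)
  · rintro ⟨β, k, ⟨hβ, -⟩, hk⟩
    exact ⟨β, hβ, k, hk⟩

lemma image_arcPath_eq_ball_diff_arcs {m : ℕ} (hm : m ≠ 0) {δ : ℝ} (hδ : 0 < δ)
    {A Λ : Finset (ℝ → ℝ)} (hexp : ∀ s ∈ Ioo 0 δ, ∀ θ : ℝ, |θ| < 4 →
      ((∃ β ∈ A, Complex.exp (θ * Complex.I) = Complex.exp (β s * Complex.I)) ↔
        ∃ b ∈ Λ, θ = b s)) :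
    (fun p : ℝ × ℝ => arcPath m (fun _ => p.2) p.1) ''
        {p | p.1 ∈ Ioo 0 δ ∧ -4 < p.2 ∧ p.2 < 4 ∧ ∀ b ∈ Λ, p.2 ≠ b p.1} =
      {z | z ∈ Metric.ball (0 : ℂ) (δ ^ m) ∧ z ≠ 0 ∧ ∀ β ∈ A, z ∉ arc m β} := by
  ext z
  constructor
  · rintro ⟨⟨s, θ⟩, ⟨hs, h1, h2, hne⟩, rfl⟩
    refine ⟨arcPath_mem_ball hm ⟨hs.1.le, hs.2⟩, arcPath_ne_zero hs.1, fun β hβ hmem => ?_⟩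
    obtain ⟨b, hb, hθ⟩ := (hexp s hs θ (abs_lt.2 ⟨h1, h2⟩)).1
      ⟨β, hβ, (arcPath_mem_arc_iff hm hs.1).1 hmem⟩
    exact hne b hb hθ
  · rintro ⟨hz, hz0, hzA⟩
    have hs : ‖z‖ ^ (1 / m : ℝ) ∈ Ioo 0 δ :=
      ⟨Real.rpow_pos_of_pos (norm_pos_iff.2 hz0) _, (norm_rpow_mem_Ico hm hδ.le hz).2⟩
    have hθ : |z.arg| < 4 := (Complex.abs_arg_le_pi z).trans_lt Real.pi_lt_four
    refine ⟨(_, z.arg), ⟨hs, (abs_lt.1 hθ).1, (abs_lt.1 hθ).2, fun b hb hb' => ?_⟩,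
      arcPath_const_arg hm z⟩
    obtain ⟨β, hβ, h⟩ := (hexp _ hs _ hθ).2 ⟨b, hb, hb'⟩
    refine hzA β hβ ?_
    rw [← arcPath_const_arg hm z]
    exact (arcPath_mem_arc_iff hm hs.1).2 h

lemma exists_finite_isPreconnected_sUnion_eq_ball_diff_arcs {m : ℕ} (hm : m ≠ 0)
    {A : Finset (ℝ → ℝ)} (hA : ∀ β ∈ A, AnalyticAt ℝ β 0) :
    ∀ᶠ δ in 𝓝[>] (0 : ℝ), ∃ 𝓑 : Set (Set ℂ), 𝓑.Finite ∧ (∀ B ∈ 𝓑, IsPreconnected B) ∧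
      ⋃₀ 𝓑 = {z | z ∈ Metric.ball (0 : ℂ) (δ ^ m) ∧ z ≠ 0 ∧ ∀ β ∈ A, z ∉ arc m β} := by
  classical
  -- The principal argument lies in `(-π, π] ⊆ (-4, 4)`.
  obtain ⟨Λ₀, hΛ₀, hexp⟩ := exists_finset_forall_exp_eq_iff hA 4
  set Λ : Finset (ℝ → ℝ) := insert (fun _ => -4) (insert (fun _ => 4) Λ₀) with hΛdef
  have hΛ : ∀ b ∈ Λ, AnalyticAt ℝ b 0 := by
    simpa only [hΛdef, Finset.forall_mem_insert] using ⟨analyticAt_const, analyticAt_const, hΛ₀⟩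
  have hexp : ∀ᶠ s in 𝓝[>] (0 : ℝ), ∀ θ : ℝ, |θ| < 4 →
      ((∃ β ∈ A, Complex.exp (θ * Complex.I) = Complex.exp (β s * Complex.I)) ↔
        ∃ b ∈ Λ, θ = b s) := by
    filter_upwards [hexp] with s hs θ hθ
    rw [hs θ hθ]
    simp only [hΛdef, Finset.exists_mem_insert, (abs_lt.1 hθ).1.ne', (abs_lt.1 hθ).2.ne, false_or]
  have hcont : ∀ᶠ s in 𝓝[>] (0 : ℝ), ∀ b ∈ Λ, ContinuousAt b s :=
    Λ.eventually_all.2 fun b hb => nhdsWithin_le_nhds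
      ((hΛ b hb).eventually_analyticAt.mono fun s hs => hs.continuousAt)
  have horder := Λ.eventually_all.2 fun b hb => Λ.eventually_all.2 fun c hc =>
    eventually_forall_lt_imp_lt_of_analyticAt (hΛ b hb) (hΛ c hc)
  filter_upwards [self_mem_nhdsWithin, eventually_forall_mem_Ioo hexp,
    eventually_forall_mem_Ioo hcont, horder] with δ (hδ : 0 < δ) hexp hcont horder
  obtain ⟨𝓑, hfin, hpre, hU⟩ := exists_finite_isPreconnected_sUnion_eq_compl_graphs
    isPreconnected_Ioo (Finset.mem_insert_self (fun _ => -4) _)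
    (Finset.mem_insert_of_mem (Finset.mem_insert_self (fun _ => 4) _))
    (fun b hb s hs => (hcont s hs b hb).continuousWithinAt) horder
  have hP : Continuous fun p : ℝ × ℝ => arcPath m (fun _ => p.2) p.1 := by
    simp only [arcPath]
    fun_prop
  refine ⟨image (fun p : ℝ × ℝ => arcPath m (fun _ => p.2) p.1) '' 𝓑, hfin.image _, ?_, ?_⟩
  · rintro _ ⟨B, hB, rfl⟩
    exact (hpre B hB).image _ hP.continuousOn
  · rw [← image_sUnion, hU, image_arcPath_eq_ball_diff_arcs hm hδ hexp]

end Sectors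

/-! ### Harmonic functions in the plane -/

section Harmonic

variable {h u : ℂ → ℝ} {c : ℂ}

lemma exists_analyticAt_re_eq (hh : HarmonicAt h c) :
    ∃ F : ℂ → ℂ, AnalyticAt ℂ F c ∧ ∀ᶠ z in 𝓝 c, h z = (F z).re := by
  obtain ⟨ε, hε, hball⟩ := Metric.eventually_nhds_iff_ball.1 hh.eventually
  obtain ⟨F, hF, hre⟩ := HarmonicOnNhd.exists_analyticOnNhd_ball_re_eq (f := h) (z := c) (R := ε)
    fun x hx => hball x hx
  refine ⟨F, hF c (Metric.mem_ball_self hε), ?_⟩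
  filter_upwards [Metric.ball_mem_nhds c hε] with z hz
  exact (hre hz).symm

lemma harmonicAt_comp_of_analyticAt {φ : ℂ → ℂ} (hh : HarmonicAt h (φ c))
    (hφ : AnalyticAt ℂ φ c) : HarmonicAt (fun z => h (φ z)) c := by
  obtain ⟨F, hF, hre⟩ := exists_analyticAt_re_eq hh
  refine (harmonicAt_congr_nhds ?_).2 (AnalyticAt.harmonicAt_re (hF.comp hφ))
  filter_upwards [hφ.continuousAt.eventually hre] with z hz
  exact hz

lemma eventually_eq_of_isLocalMax_of_harmonicAt (hu : HarmonicAt u c) (hmax : IsLocalMax u c) :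
    ∀ᶠ z in 𝓝 c, u z = u c := by
  obtain ⟨F, hF, hre⟩ := exists_analyticAt_re_eq hu
  have hE : AnalyticAt ℂ (fun z => Complex.exp (F z)) c := hF.cexp
  have hd : ∀ᶠ z in 𝓝 c, DifferentiableAt ℂ (fun z => Complex.exp (F z)) z :=
    hE.eventually_analyticAt.mono fun z hz => hz.differentiableAt
  have hloc : IsLocalMax (norm ∘ fun z => Complex.exp (F z)) c := by
    filter_upwards [hre, hmax] with z h1 h2
    simp only [Function.comp_apply, Complex.norm_exp]
    rw [← h1, ← hre.self_of_nhds]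
    exact Real.exp_le_exp.2 h2
  filter_upwards [Complex.eventually_eq_of_isLocalMax_norm hd hloc, hre] with z h1 h2
  have hnorm := congrArg norm h1
  rw [Complex.norm_exp, Complex.norm_exp, Real.exp_eq_exp] at hnorm
  rw [h2, hnorm, ← hre.self_of_nhds]

lemma exists_eventually_eq_re_pow_mul_of_harmonicAt (hh : HarmonicAt h c) (h0 : h c = 0)
    (hne : ¬ ∀ᶠ z in 𝓝 c, h z = 0) :
    ∃ (n : ℕ) (g : ℂ → ℂ), n ≠ 0 ∧ AnalyticAt ℂ g c ∧ g c ≠ 0 ∧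
      ∀ᶠ z in 𝓝 c, h z = ((z - c) ^ n * g z).re := by
  obtain ⟨F, hF, hre⟩ := exists_analyticAt_re_eq hh
  have hre' : ∀ᶠ z in 𝓝 c, h z = (F z - F c).re := by
    filter_upwards [hre] with z hz
    rw [hz, Complex.sub_re, ← hre.self_of_nhds, h0, sub_zero]
  have hFne : ¬ ∀ᶠ z in 𝓝 c, F z - F c = 0 := fun hF0 => hne <| by
    filter_upwards [hre', hF0] with z h1 h2
    rw [h1, h2, Complex.zero_re]
  obtain ⟨n, g, hg, hg0, hFg⟩ :=
    (hF.sub analyticAt_const).exists_eventuallyEq_pow_smul_nonzero_iff.2 hFne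
  refine ⟨n, g, ?_, hg, hg0, ?_⟩
  · rintro rfl
    exact hg0 (by simpa using hFg.self_of_nhds.symm)
  · filter_upwards [hre', hFg] with z h1 h2
    rw [h1, ← smul_eq_mul, ← h2, Pi.sub_apply]

end Harmonic

section Implicit

lemma isInvertible_of_apply_one_ne_zero {L : ℝ →L[ℝ] ℝ} (hL : L 1 ≠ 0) : L.IsInvertible := by
  refine ⟨ContinuousLinearEquiv.unitsEquivAut ℝ (Units.mk0 _ hL), ?_⟩
  ext
  simp

variable {Q : ℝ × ℝ → ℝ} {a b : ℝ}

lemma exists_analyticAt_implicit (hQ : AnalyticAt ℝ Q (a, b)) (h0 : Q (a, b) = 0)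
    (hd : deriv (fun θ => Q (a, θ)) b ≠ 0) :
    ∃ β : ℝ → ℝ, AnalyticAt ℝ β a ∧ (∀ᶠ s in 𝓝 a, Q (s, β s) = 0) ∧
      ∀ᶠ p in 𝓝 (a, b), Q p = 0 → β p.1 = p.2 := by
  have hcd : ContDiffAt ℝ ω Q (a, b) := hQ.contDiffAt
  have hinv : (fderiv ℝ Q (a, b) ∘L ContinuousLinearMap.inr ℝ ℝ ℝ).IsInvertible := by
    refine isInvertible_of_apply_one_ne_zero ?_
    have hslice : HasDerivAt (fun θ : ℝ => ((a, θ) : ℝ × ℝ)) (0, 1) b :=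
      (hasDerivAt_const b a).prodMk (hasDerivAt_id b)
    have hpartial : HasDerivAt (fun θ => Q (a, θ)) _ b :=
      hQ.differentiableAt.hasFDerivAt.comp_hasDerivAt b hslice
    rw [hpartial.deriv] at hd
    simpa using hd
  refine ⟨hcd.implicitFunction (by simp) hinv,
    (hcd.contDiffAt_implicitFunction (by simp) hinv).analyticAt, ?_, ?_⟩
  · simpa only [h0] using hcd.eventually_apply_implicitFunction (by simp) hinv
  · filter_upwards [hcd.eventually_apply_eq_iff_implicitFunction (by simp) hinv] with p hp hQp
    exact hp.1 (hQp.trans h0.symm)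

lemma exists_finset_implicit_of_isCompact {K : Set ℝ} (hK : IsCompact K)
    (hQ : ∀ θ ∈ K, AnalyticAt ℝ Q (a, θ))
    (hd : ∀ θ ∈ K, Q (a, θ) = 0 → deriv (fun θ => Q (a, θ)) θ ≠ 0) :
    ∃ A : Finset (ℝ → ℝ), (∀ β ∈ A, AnalyticAt ℝ β a ∧ ∀ᶠ s in 𝓝 a, Q (s, β s) = 0) ∧
      ∀ᶠ s in 𝓝 a, ∀ θ ∈ K, Q (s, θ) = 0 → ∃ β ∈ A, β s = θ := by
  classical
  refine hK.induction_on (p := fun K => ∃ A : Finset (ℝ → ℝ),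
    (∀ β ∈ A, AnalyticAt ℝ β a ∧ ∀ᶠ s in 𝓝 a, Q (s, β s) = 0) ∧
      ∀ᶠ s in 𝓝 a, ∀ θ ∈ K, Q (s, θ) = 0 → ∃ β ∈ A, β s = θ) ⟨∅, by simp⟩ ?_ ?_ ?_
  · rintro s t hst ⟨A, hA, hev⟩
    exact ⟨A, hA, hev.mono fun x hx θ hθ => hx θ (hst hθ)⟩
  · rintro s t ⟨A, hA, hev⟩ ⟨A', hA', hev'⟩
    refine ⟨A ∪ A', fun β hβ => (Finset.mem_union.1 hβ).elim (hA β) (hA' β), ?_⟩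
    filter_upwards [hev, hev'] with x h1 h2 θ hθ hx
    rcases hθ with hθ | hθ
    · exact (h1 θ hθ hx).imp fun β hβ => ⟨Finset.mem_union_left _ hβ.1, hβ.2⟩
    · exact (h2 θ hθ hx).imp fun β hβ => ⟨Finset.mem_union_right _ hβ.1, hβ.2⟩
  · intro θ hθ
    have hlocal : ∃ A : Finset (ℝ → ℝ),
        (∀ β ∈ A, AnalyticAt ℝ β a ∧ ∀ᶠ s in 𝓝 a, Q (s, β s) = 0) ∧
          ∀ᶠ p in 𝓝 (a, θ), Q p = 0 → ∃ β ∈ A, β p.1 = p.2 := by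
      by_cases hz : Q (a, θ) = 0
      · obtain ⟨β, hβ, hβ0, hev⟩ := exists_analyticAt_implicit (hQ θ hθ) hz (hd θ hθ hz)
        exact ⟨{β}, by simpa using ⟨hβ, hβ0⟩, hev.mono fun p hp hQp => ⟨β, by simp, hp hQp⟩⟩
      · refine ⟨∅, by simp, ?_⟩
        filter_upwards [(hQ θ hθ).continuousAt.eventually_ne hz] with p hp hp'
        exact (hp hp').elim
    obtain ⟨A, hA, hev⟩ := hlocal
    rw [nhds_prod_eq] at hev
    obtain ⟨P₁, hP₁, P₂, hP₂, hP⟩ := eventually_prod_iff.1 hev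
    exact ⟨{t | P₂ t}, mem_nhdsWithin_of_mem_nhds hP₂, A, hA, hP₁.mono fun s hs t ht => hP hs ht⟩

end Implicit

section PolarFactor

/-- The quotient of `Re (zⁿ g(z))` by `rⁿ` in polar coordinates `z = r exp (iθ)`, as a function of
`(r, θ)` that makes sense at `r = 0`. -/
noncomputable def polarFactor (n : ℕ) (g : ℂ → ℂ) (p : ℝ × ℝ) : ℝ :=
  (Complex.exp (n * (p.2 * Complex.I)) * g (p.1 * Complex.exp (p.2 * Complex.I))).re

variable {n : ℕ} {g : ℂ → ℂ}

lemma re_polar_pow_mul (n : ℕ) (g : ℂ → ℂ) (r θ : ℝ) :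
    ((r * Complex.exp (θ * Complex.I)) ^ n * g (r * Complex.exp (θ * Complex.I))).re =
      r ^ n * polarFactor n g (r, θ) := by
  rw [mul_pow, ← Complex.exp_nat_mul, mul_assoc, ← Complex.ofReal_pow, Complex.re_ofReal_mul,
    polarFactor]

lemma polarFactor_zero_left (n : ℕ) (g : ℂ → ℂ) (θ : ℝ) :
    polarFactor n g (0, θ) = (Complex.exp (n * (θ * Complex.I)) * g 0).re := by
  simp only [polarFactor, Complex.ofReal_zero, zero_mul]

lemma analyticAt_polarFactor (n : ℕ) (hg : AnalyticAt ℂ g 0) (θ : ℝ) :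
    AnalyticAt ℝ (polarFactor n g) (0, θ) := by
  have hfst : AnalyticAt ℝ (fun p : ℝ × ℝ => (p.1 : ℂ)) (0, θ) :=
    (Complex.ofRealCLM.analyticAt _).comp analyticAt_fst
  have hsnd : AnalyticAt ℝ (fun p : ℝ × ℝ => (p.2 : ℂ)) (0, θ) :=
    (Complex.ofRealCLM.analyticAt _).comp analyticAt_snd
  have hexp (w : ℂ) : AnalyticAt ℝ Complex.exp w := (analyticAt_cexp (z := w)).restrictScalars
  have hpolar : AnalyticAt ℝ (fun p : ℝ × ℝ => p.1 * Complex.exp (p.2 * Complex.I)) (0, θ) :=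
    hfst.mul ((hexp _).fun_comp (hsnd.mul analyticAt_const))
  have hpow : AnalyticAt ℝ (fun p : ℝ × ℝ => Complex.exp (n * (p.2 * Complex.I))) (0, θ) :=
    (hexp _).fun_comp (analyticAt_const.mul (hsnd.mul analyticAt_const))
  have hcomp : AnalyticAt ℝ (fun p : ℝ × ℝ => g (p.1 * Complex.exp (p.2 * Complex.I))) (0, θ) :=
    AnalyticAt.fun_comp (g := g) (by simpa using hg.restrictScalars (𝕜 := ℝ)) hpolar
  exact (Complex.reCLM.analyticAt _).fun_comp (hpow.mul hcomp)

lemma hasDerivAt_polarFactor_zero_left (n : ℕ) (g : ℂ → ℂ) (θ : ℝ) :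
    HasDerivAt (fun θ => polarFactor n g (0, θ))
      (-(n * (Complex.exp (n * (θ * Complex.I)) * g 0).im)) θ := by
  have hlin : HasDerivAt (fun θ : ℝ => (n : ℂ) * ((θ : ℂ) * Complex.I)) (n * (1 * Complex.I)) θ :=
    ((Complex.ofRealCLM.hasDerivAt (x := θ)).mul_const Complex.I).const_mul _
  have hre := Complex.reCLM.hasFDerivAt.comp_hasDerivAt θ (hlin.cexp.mul_const (g 0))
  refine (hre.congr_deriv ?_).congr_of_eventuallyEq
    (Eventually.of_forall fun t => polarFactor_zero_left n g t)
  simp [Complex.mul_re, Complex.mul_im]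
  ring

lemma deriv_polarFactor_zero_left_ne_zero (hn : n ≠ 0) (hg0 : g 0 ≠ 0) {θ : ℝ}
    (hz : polarFactor n g (0, θ) = 0) : deriv (fun θ => polarFactor n g (0, θ)) θ ≠ 0 := by
  rw [(hasDerivAt_polarFactor_zero_left n g θ).deriv, neg_ne_zero]
  refine mul_ne_zero (by exact_mod_cast hn) fun him => ?_
  rw [polarFactor_zero_left] at hz
  exact mul_ne_zero (Complex.exp_ne_zero _) hg0 (Complex.ext hz him)

lemma exists_arcs_re_pow_mul_eq_zero (hn : n ≠ 0) (hg : AnalyticAt ℂ g 0) (hg0 : g 0 ≠ 0) :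
    ∃ A : Finset (ℝ → ℝ), (∀ β ∈ A, AnalyticAt ℝ β 0) ∧
      ∀ᶠ z in 𝓝[≠] (0 : ℂ), ((z ^ n * g z).re = 0 ↔ ∃ β ∈ A, z ∈ arc 1 β) := by
  obtain ⟨A, hA, hev⟩ := exists_finset_implicit_of_isCompact
    (isCompact_Icc (a := -Real.pi) (b := Real.pi)) (fun θ _ => analyticAt_polarFactor n hg θ)
    fun θ _ => deriv_polarFactor_zero_left_ne_zero hn hg0
  refine ⟨A, fun β hβ => (hA β hβ).1, ?_⟩
  have hroot : ∀ᶠ s in 𝓝 (0 : ℝ), ∀ β ∈ A, polarFactor n g (s, β s) = 0 :=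
    A.eventually_all.2 fun β hβ => (hA β hβ).2
  have hnorm : Tendsto (fun z : ℂ => ‖z‖) (𝓝 0) (𝓝 0) := tendsto_norm_zero
  filter_upwards [nhdsWithin_le_nhds (hnorm.eventually (hev.and hroot)), self_mem_nhdsWithin]
    with z ⟨hev, hroot⟩ (hz0 : z ≠ 0)
  have hzpow : ‖z‖ ^ (1 / (1 : ℕ) : ℝ) = ‖z‖ := by simp
  constructor
  · intro hz
    rw [← Complex.norm_mul_exp_arg_mul_I z, re_polar_pow_mul] at hz
    obtain ⟨β, hβ, hβz⟩ := hev _ ⟨(Complex.neg_pi_lt_arg z).le, Complex.arg_le_pi z⟩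
      ((mul_eq_zero.1 hz).resolve_left (pow_ne_zero _ (norm_ne_zero_iff.2 hz0)))
    refine ⟨β, hβ, hz0, ?_⟩
    rw [hzpow, hβz, Complex.norm_mul_exp_arg_mul_I]
  · rintro ⟨β, hβ, -, hzβ⟩
    rw [hzpow] at hzβ
    rw [hzβ, re_polar_pow_mul, hroot β hβ, mul_zero]

lemma exists_arcs_of_harmonicAt {h : ℂ → ℝ} (hh : HarmonicAt h 0)
    (hne : ¬ ∀ᶠ z in 𝓝 (0 : ℂ), h z = 0) :
    ∃ A : Finset (ℝ → ℝ), (∀ β ∈ A, AnalyticAt ℝ β 0) ∧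
      ∀ᶠ z in 𝓝[≠] (0 : ℂ), (h z = 0 ↔ ∃ β ∈ A, z ∈ arc 1 β) := by
  by_cases h0 : h 0 = 0
  · obtain ⟨n, g, hn, hg, hg0, hhg⟩ := exists_eventually_eq_re_pow_mul_of_harmonicAt hh h0 hne
    obtain ⟨A, hA, hev⟩ := exists_arcs_re_pow_mul_eq_zero hn hg hg0
    refine ⟨A, hA, ?_⟩
    filter_upwards [hev, nhdsWithin_le_nhds hhg] with z h1 h2
    rw [← h1, h2, sub_zero]
  · refine ⟨∅, by simp, nhdsWithin_le_nhds ?_⟩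
    filter_upwards [hh.1.continuousAt.eventually_ne h0] with z hz
    simpa using hz

end PolarFactor

section LocalInverse

lemma exists_analyticAt_localInverse {φ : ℂ → ℂ} {a : ℂ} (hφ : AnalyticAt ℂ φ a)
    (hd : deriv φ a ≠ 0) : ∃ ψ : ℂ → ℂ, AnalyticAt ℂ ψ (φ a) ∧ ψ (φ a) = a ∧
      (∀ᶠ z in 𝓝 (φ a), φ (ψ z) = z) ∧ ∀ᶠ ξ in 𝓝 a, ψ (φ ξ) = ξ := by
  have hF := hφ.hasStrictDerivAt.hasStrictFDerivAt_equiv hd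
  refine ⟨hF.localInverse, ?_, hF.localInverse_apply_image, hF.eventually_right_inverse,
    hF.eventually_left_inverse⟩
  exact (hφ.contDiffAt (n := ω)).to_localInverse hF.hasFDerivAt (by simp) |>.analyticAt

/-- `G` is real-valued and harmonic near `w`: the notion `IsHarmonicAt`, read in a coordinate. -/
def EHarmonicAt (G : ℂ → EReal) (w : ℂ) : Prop :=
  ∃ h : ℂ → ℝ, HarmonicAt h w ∧ ∀ᶠ z in 𝓝 w, G z = (h z : EReal)

variable {G G' : ℂ → EReal} {φ : ℂ → ℂ} {w : ℂ}

lemma EHarmonicAt.congr (h : EHarmonicAt G w) (hG : ∀ᶠ z in 𝓝 w, G' z = G z) :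
    EHarmonicAt G' w := by
  obtain ⟨u, hu, hev⟩ := h
  exact ⟨u, hu, by filter_upwards [hev, hG] with z h1 h2; rw [h2, h1]⟩

lemma EHarmonicAt.comp (h : EHarmonicAt G (φ w)) (hφ : AnalyticAt ℂ φ w) :
    EHarmonicAt (fun z => G (φ z)) w := by
  obtain ⟨u, hu, hev⟩ := h
  exact ⟨fun z => u (φ z), harmonicAt_comp_of_analyticAt hu hφ, hφ.continuousAt.eventually hev⟩

lemma eHarmonicAt_comp_iff (hφ : AnalyticAt ℂ φ w) (hd : deriv φ w ≠ 0) :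
    EHarmonicAt (fun z => G (φ z)) w ↔ EHarmonicAt G (φ w) := by
  refine ⟨fun h => ?_, fun h => h.comp hφ⟩
  obtain ⟨ψ, hψ, hψw, hr, -⟩ := exists_analyticAt_localInverse hφ hd
  have h' : EHarmonicAt (fun z => G (φ z)) (ψ (φ w)) := by rwa [hψw]
  exact (h'.comp hψ).congr (hr.mono fun z hz => by simp only [hz])

lemma eHarmonicAt_coe_iff {u : ℂ → ℝ} :
    EHarmonicAt (fun z => (u z : EReal)) w ↔ HarmonicAt u w := by
  refine ⟨fun ⟨h, hh, hev⟩ => (harmonicAt_congr_nhds ?_).2 hh, fun h => ⟨u, h, by simp⟩⟩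
  filter_upwards [hev] with z hz
  exact_mod_cast hz

end LocalInverse

/-! ### Maxima of harmonic functions with logarithmic terms -/

section MaxHarmonic

variable {J : Type*} [Finite J] {U : J → ℂ → ℝ} {ξ : ℂ}

lemma eventuallyEq_iSup_of_harmonicAt {j : J} (hM : HarmonicAt (fun z => ⨆ i, U i z) ξ)
    (hj : HarmonicAt (U j) ξ) (heq : U j ξ = ⨆ i, U i ξ) :
    U j =ᶠ[𝓝 ξ] fun z => ⨆ i, U i z := by
  have hmax : IsLocalMax (U j - fun z => ⨆ i, U i z) ξ := Eventually.of_forall fun z => by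
    simp only [Pi.sub_apply, heq, sub_self, sub_nonpos]
    exact le_ciSup (finite_range fun i => U i z).bddAbove j
  filter_upwards [eventually_eq_of_isLocalMax_of_harmonicAt (hj.sub hM) hmax] with z hz
  simpa only [Pi.sub_apply, heq, sub_self, sub_eq_zero] using hz

variable [Nonempty J]

lemma harmonicAt_iSup_iff (hU : ∀ j, HarmonicAt (U j) ξ) :
    HarmonicAt (fun z => ⨆ i, U i z) ξ ↔
      ∀ i j, U i ξ = ⨆ k, U k ξ → U j ξ = ⨆ k, U k ξ → U i =ᶠ[𝓝 ξ] U j := by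
  refine ⟨fun h i j hi hj => (eventuallyEq_iSup_of_harmonicAt h (hU i) hi).trans
    (eventuallyEq_iSup_of_harmonicAt h (hU j) hj).symm, fun h => ?_⟩
  obtain ⟨i, hi⟩ : ∃ i, U i ξ = ⨆ k, U k ξ := exists_eq_ciSup_of_finite
  refine (harmonicAt_congr_nhds ?_).2 (hU i)
  have hle : ∀ᶠ z in 𝓝 ξ, ∀ j, U j z ≤ U i z := by
    refine eventually_all.2 fun j => ?_
    rcases (le_ciSup (finite_range fun k => U k ξ).bddAbove j).eq_or_lt with hj | hj
    · exact (h j i hj hi).le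
    · rw [← hi] at hj
      exact ((hU j).1.continuousAt.eventually_lt (hU i).1.continuousAt hj).mono fun z hz => hz.le
  filter_upwards [hle] with z hz
  exact le_antisymm (ciSup_le hz) (le_ciSup (finite_range fun k => U k z).bddAbove i)

lemma exists_eventually_eq_iSup_iff {α : Type*} {l : Filter α} {V : J → α → ℝ} {i : J}
    (h : ∀ k, ∃ b : Prop, ∀ᶠ s in l, (V k s ≤ V i s ↔ b)) :
    ∃ b : Prop, ∀ᶠ s in l, (V i s = ⨆ k, V k s ↔ b) := by
  choose b hb using h
  refine ⟨∀ k, b k, ?_⟩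
  filter_upwards [eventually_all.2 hb] with s hs
  have hbdd := (finite_range fun k => V k s).bddAbove
  rw [← forall_congr' hs, ← ciSup_le_iff hbdd]
  exact ⟨fun h => h.ge, fun h => le_antisymm (le_ciSup hbdd i) h⟩

end MaxHarmonic

section LogHarm

variable {ρ ρ' : ℝ} {H H' : ℂ → ℝ} {β : ℝ → ℝ}

/-- The function `ρ log |ξ| + H`, the shape of a function with a logarithmic singularity. -/
noncomputable def logHarm (ρ : ℝ) (H : ℂ → ℝ) (ξ : ℂ) : ℝ := ρ * Real.log ‖ξ‖ + H ξ

lemma eventually_harmonicAt_logHarm (hH : HarmonicAt H 0) :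
    ∀ᶠ ξ in 𝓝[≠] (0 : ℂ), HarmonicAt (logHarm ρ H) ξ := by
  filter_upwards [nhdsWithin_le_nhds hH.eventually, self_mem_nhdsWithin] with ξ h1 h2
  exact ((analyticAt_id.harmonicAt_log_norm h2).const_smul (c := ρ)).add h1

lemma tendsto_log_norm : Tendsto (fun ξ : ℂ => Real.log ‖ξ‖) (𝓝[≠] 0) atBot :=
  Real.tendsto_log_nhdsGT_zero.comp tendsto_norm_nhdsNE_zero

lemma eventually_logHarm_lt (hρ : ρ < ρ') (hH : ContinuousAt H 0) (hH' : ContinuousAt H' 0) :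
    ∀ᶠ ξ in 𝓝[≠] (0 : ℂ), logHarm ρ' H' ξ < logHarm ρ H ξ := by
  have hlog : Tendsto (fun ξ : ℂ => (ρ' - ρ) * Real.log ‖ξ‖) (𝓝[≠] 0) atBot :=
    tendsto_log_norm.const_mul_atBot (sub_pos.2 hρ)
  have hcont : Tendsto (fun ξ : ℂ => H' ξ - H ξ) (𝓝[≠] 0) (𝓝 (H' 0 - H 0)) :=
    (hH'.sub hH).tendsto.mono_left nhdsWithin_le_nhds
  filter_upwards [(hlog.atBot_add hcont).eventually (eventually_lt_atBot 0)] with ξ hξ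
  simp only [logHarm]
  linarith

lemma eventually_not_eventually_eq_zero_of_harmonicAt (hH : HarmonicAt H 0)
    (hne : ¬ ∀ᶠ z in 𝓝 (0 : ℂ), H z = 0) :
    ∀ᶠ ξ in 𝓝 (0 : ℂ), ¬ ∀ᶠ z in 𝓝 ξ, H z = 0 := by
  obtain ⟨ε, hε, hball⟩ := Metric.eventually_nhds_iff_ball.1 hH.eventually
  have hnhds := Metric.ball_mem_nhds (0 : ℂ) hε
  filter_upwards [hnhds] with ξ hξ heq
  have han : AnalyticOnNhd ℝ H (Metric.ball 0 ε) := fun z hz => HarmonicAt.analyticAt (hball z hz)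
  have hzero := han.eqOn_zero_of_preconnected_of_eventuallyEq_zero
    (convex_ball (0 : ℂ) ε).isPreconnected hξ heq
  exact hne (mem_of_superset hnhds hzero)

lemma exists_arcs_logHarm_crossing (hH : HarmonicAt H 0) (hH' : HarmonicAt H' 0) :
    ∃ A : Finset (ℝ → ℝ), (∀ β ∈ A, AnalyticAt ℝ β 0) ∧ ∀ᶠ ξ in 𝓝[≠] (0 : ℂ),
      (logHarm ρ H ξ = logHarm ρ' H' ξ ∧ ¬ logHarm ρ H =ᶠ[𝓝 ξ] logHarm ρ' H' ↔
        ∃ β ∈ A, ξ ∈ arc 1 β) := by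
  rcases eq_or_ne ρ ρ' with rfl | hρ
  · have hiff (ξ : ℂ) : logHarm ρ H ξ = logHarm ρ H' ξ ↔ (H - H') ξ = 0 := by
      simp only [logHarm, add_right_inj, Pi.sub_apply, sub_eq_zero]
    simp only [Filter.EventuallyEq, hiff]
    have hd : HarmonicAt (H - H') 0 := hH.sub hH'
    by_cases h0 : ∀ᶠ z in 𝓝 (0 : ℂ), (H - H') z = 0
    · refine ⟨∅, by simp, nhdsWithin_le_nhds ?_⟩
      filter_upwards [eventually_eventually_nhds.2 h0] with ξ hξ
      exact ⟨fun h => (h.2 hξ).elim, by simp⟩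
    · obtain ⟨A, hA, hev⟩ := exists_arcs_of_harmonicAt hd h0
      refine ⟨A, hA, ?_⟩
      filter_upwards [hev, nhdsWithin_le_nhds
        (eventually_not_eventually_eq_zero_of_harmonicAt hd h0)] with ξ h1 h2
      rw [and_iff_left h2, h1]
  · refine ⟨∅, by simp, ?_⟩
    have hc : ContinuousAt H 0 := hH.1.continuousAt
    have hc' : ContinuousAt H' 0 := hH'.1.continuousAt
    have hne : ∀ᶠ ξ in 𝓝[≠] (0 : ℂ), logHarm ρ H ξ ≠ logHarm ρ' H' ξ := by
      rcases hρ.lt_or_gt with h | h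
      · exact (eventually_logHarm_lt h hc hc').mono fun ξ hξ => hξ.ne'
      · exact (eventually_logHarm_lt h hc' hc).mono fun ξ hξ => hξ.ne
    filter_upwards [hne] with ξ hξ
    simp [hξ]

lemma tendsto_arcPath_one (hβ : ContinuousAt β 0) :
    Tendsto (arcPath 1 β) (𝓝[>] 0) (𝓝[≠] 0) := by
  refine tendsto_nhdsWithin_iff.2 ⟨?_, ?_⟩
  · have h := (continuousAt_arcPath (m := 1) hβ).tendsto
    rw [arcPath_zero one_ne_zero] at h
    exact h.mono_left nhdsWithin_le_nhds
  · filter_upwards [self_mem_nhdsWithin] with s hs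
    exact arcPath_ne_zero hs

lemma analyticAt_arcPath (m : ℕ) {a : ℝ} (hβ : AnalyticAt ℝ β a) :
    AnalyticAt ℝ (arcPath m β) a := by
  have hpow : AnalyticAt ℝ (fun s : ℝ => (s : ℂ) ^ m) a := (Complex.ofRealCLM.analyticAt _).pow m
  have hangle : AnalyticAt ℝ (fun s : ℝ => (β s : ℂ)) a :=
    (Complex.ofRealCLM.analyticAt _).comp hβ
  have hexp (w : ℂ) : AnalyticAt ℝ Complex.exp w := (analyticAt_cexp (z := w)).restrictScalars
  exact hpow.mul ((hexp _).fun_comp (hangle.mul analyticAt_const))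

lemma exists_eventually_logHarm_le_iff (hH : HarmonicAt H 0) (hH' : HarmonicAt H' 0)
    (hβ : AnalyticAt ℝ β 0) :
    ∃ b : Prop, ∀ᶠ s in 𝓝[>] (0 : ℝ),
      (logHarm ρ' H' (arcPath 1 β s) ≤ logHarm ρ H (arcPath 1 β s) ↔ b) := by
  have hc : ContinuousAt H 0 := hH.1.continuousAt
  have hc' : ContinuousAt H' 0 := hH'.1.continuousAt
  have htend := tendsto_arcPath_one hβ.continuousAt
  rcases lt_trichotomy ρ ρ' with h | rfl | h
  · refine ⟨True, ?_⟩
    filter_upwards [htend.eventually (eventually_logHarm_lt h hc hc')] with s hs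
    exact iff_true_intro hs.le
  · have han : AnalyticAt ℝ (fun s => (H - H') (arcPath 1 β s)) 0 := by
      refine AnalyticAt.fun_comp (g := H - H') ?_ (analyticAt_arcPath 1 hβ)
      rw [arcPath_zero one_ne_zero]
      exact HarmonicAt.analyticAt (hH.sub hH')
    obtain ⟨σ, hσ⟩ := exists_eventually_sign_eq_of_analyticAt han
    refine ⟨0 ≤ σ, ?_⟩
    filter_upwards [hσ] with s hs
    rw [← hs, sign_nonneg_iff, Pi.sub_apply, sub_nonneg, logHarm, logHarm, add_le_add_iff_left]
  · refine ⟨False, ?_⟩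
    filter_upwards [htend.eventually (eventually_logHarm_lt h hc' hc)] with s hs
    exact iff_false_intro hs.not_ge

end LogHarm

section MaxLogHarm

/-- The maximum of a finite family of functions `ρⱼ log |ξ| + Hⱼ`. -/
noncomputable def maxLogHarm {J : Type*} (ρ : J → ℝ) (H : J → ℂ → ℝ) (ξ : ℂ) : ℝ :=
  ⨆ j, logHarm (ρ j) (H j) ξ

variable {J : Type*} [Finite J] {ρ : J → ℝ} {H : J → ℂ → ℝ}

lemma logHarm_le_maxLogHarm (ρ : J → ℝ) (H : J → ℂ → ℝ) (ξ : ℂ) (j : J) :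
    logHarm (ρ j) (H j) ξ ≤ maxLogHarm ρ H ξ :=
  le_ciSup (finite_range fun j => logHarm (ρ j) (H j) ξ).bddAbove j

variable [Nonempty J]

lemma exists_logHarm_eq_maxLogHarm (ρ : J → ℝ) (H : J → ℂ → ℝ) (ξ : ℂ) :
    ∃ j, logHarm (ρ j) (H j) ξ = maxLogHarm ρ H ξ :=
  exists_eq_ciSup_of_finite

lemma maxLogHarm_le_iff {ξ : ℂ} {a : ℝ} :
    maxLogHarm ρ H ξ ≤ a ↔ ∀ j, logHarm (ρ j) (H j) ξ ≤ a :=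
  ciSup_le_iff (finite_range _).bddAbove

lemma coe_maxLogHarm (ρ : J → ℝ) (H : J → ℂ → ℝ) (ξ : ℂ) :
    ((maxLogHarm ρ H ξ : ℝ) : EReal) = ⨆ j, ((logHarm (ρ j) (H j) ξ : ℝ) : EReal) := by
  refine le_antisymm ?_ (iSup_le fun j => EReal.coe_le_coe_iff.2 (logHarm_le_maxLogHarm ρ H ξ j))
  obtain ⟨j, hj⟩ := exists_logHarm_eq_maxLogHarm ρ H ξ
  rw [← hj]
  exact le_iSup (fun j => ((logHarm (ρ j) (H j) ξ : ℝ) : EReal)) j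

lemma exists_eventually_logHarm_eq_maxLogHarm_iff (hH : ∀ j, HarmonicAt (H j) 0) (β : ℝ → ℝ) :
    ∃ a : J → Prop, AnalyticAt ℝ β 0 → ∀ᶠ ξ in 𝓝[≠] (0 : ℂ), ξ ∈ arc 1 β →
      ∀ i, (logHarm (ρ i) (H i) ξ = maxLogHarm ρ H ξ ↔ a i) := by
  by_cases hβ : AnalyticAt ℝ β 0
  · have hactive (i : J) : ∃ b : Prop, ∀ᶠ s in 𝓝[>] (0 : ℝ),
        (logHarm (ρ i) (H i) (arcPath 1 β s) = maxLogHarm ρ H (arcPath 1 β s) ↔ b) :=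
      exists_eventually_eq_iSup_iff (V := fun i s => logHarm (ρ i) (H i) (arcPath 1 β s))
        fun k => exists_eventually_logHarm_le_iff (hH i) (hH k) hβ
    choose a ha using hactive
    refine ⟨a, fun _ => ?_⟩
    filter_upwards [(tendsto_norm_rpow one_ne_zero).eventually (eventually_all.2 ha)] with ξ h1 h2
    rwa [← eq_arcPath_of_mem_arc one_ne_zero h2] at h1
  · exact ⟨fun _ => True, fun h => (hβ h).elim⟩

lemma exists_arcs_maxLogHarm (hH : ∀ j, HarmonicAt (H j) 0) :
    ∃ A : Finset (ℝ → ℝ), (∀ β ∈ A, AnalyticAt ℝ β 0) ∧ ∀ᶠ ξ in 𝓝[≠] (0 : ℂ),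
      (¬ HarmonicAt (maxLogHarm ρ H) ξ ↔ ∃ β ∈ A, ξ ∈ arc 1 β) := by
  classical
  cases nonempty_fintype J
  choose A hA hcross using fun i j =>
    exists_arcs_logHarm_crossing (ρ := ρ i) (ρ' := ρ j) (hH i) (hH j)
  choose a ha using exists_eventually_logHarm_eq_maxLogHarm_iff (ρ := ρ) hH
  -- Where two terms cross, the maximum is singular exactly when both of them attain it.
  refine ⟨Finset.univ.biUnion fun p : J × J =>
    (A p.1 p.2).filter fun β => a β p.1 ∧ a β p.2, ?_, ?_⟩
  · intro β hβ
    obtain ⟨p, -, hp⟩ := Finset.mem_biUnion.1 hβ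
    exact hA _ _ β (Finset.mem_filter.1 hp).1
  filter_upwards [eventually_all.2 fun i => eventually_harmonicAt_logHarm (ρ := ρ i) (hH i),
    eventually_all.2 fun i => eventually_all.2 fun j => hcross i j,
    eventually_all.2 fun i => eventually_all.2 fun j =>
      (A i j).eventually_all.2 fun β hβ => ha β (hA i j β hβ)] with ξ hharm hcross hactive
  have hiff : HarmonicAt (maxLogHarm ρ H) ξ ↔ _ := harmonicAt_iSup_iff hharm
  simp only [hiff, not_forall, Finset.mem_biUnion, Finset.mem_univ, true_and, Finset.mem_filter,
    Prod.exists, exists_prop]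
  constructor
  · rintro ⟨i, j, hi, hj, hij⟩
    obtain ⟨β, hβ, hξ⟩ := (hcross i j).1 ⟨hi.trans hj.symm, hij⟩
    exact ⟨β, ⟨i, j, hβ, (hactive i j β hβ hξ i).1 hi, (hactive i j β hβ hξ j).1 hj⟩, hξ⟩
  · rintro ⟨β, ⟨i, j, hβ, hi, hj⟩, hξ⟩
    exact ⟨i, j, (hactive i j β hβ hξ i).2 hi, (hactive i j β hβ hξ j).2 hj,
      ((hcross i j).2 ⟨β, hβ, hξ⟩).2⟩

end MaxLogHarm

/-! ### Power maps -/

section Pow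

variable {m : ℕ}

lemma isOpenMap_pow (hm : m ≠ 0) : IsOpenMap fun ξ : ℂ => ξ ^ m := by
  have han : AnalyticOnNhd ℂ (fun ξ : ℂ => ξ ^ m) univ := fun ξ _ => analyticAt_id.pow m
  rcases han.is_constant_or_isOpen isPreconnected_univ with ⟨w, hw⟩ | hopen
  · have h01 : (0 : ℂ) ^ m = 1 ^ m := (hw 0 (mem_univ _)).trans (hw 1 (mem_univ _)).symm
    rw [zero_pow hm, one_pow] at h01
    exact (zero_ne_one h01).elim
  · exact fun s hs => hopen s (subset_univ s) hs

lemma map_pow_nhds_zero (hm : m ≠ 0) : map (fun ξ : ℂ => ξ ^ m) (𝓝 0) = 𝓝 0 := by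
  rw [(isOpenMap_pow hm).map_nhds_eq (continuous_pow m).continuousAt, zero_pow hm]

lemma eventually_forall_pow_eq (hm : m ≠ 0) {p : ℂ → Prop} (hp : ∀ᶠ ξ in 𝓝[≠] (0 : ℂ), p ξ) :
    ∀ᶠ z in 𝓝[≠] (0 : ℂ), ∀ ξ : ℂ, ξ ^ m = z → p ξ := by
  rw [eventually_nhdsWithin_iff] at hp ⊢
  obtain ⟨ε, hε, hball⟩ := Metric.eventually_nhds_iff_ball.1 hp
  filter_upwards [Metric.ball_mem_nhds (0 : ℂ) (pow_pos hε m)]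
  rintro _ hz hz0 ξ rfl
  rw [mem_ball_zero_iff, norm_pow] at hz
  exact hball ξ (mem_ball_zero_iff.2 (lt_of_pow_lt_pow_left₀ m hε.le hz))
    (ne_zero_pow hm hz0)

lemma analyticAt_of_comp_of_deriv_ne_zero {R φ : ℂ → ℂ} {a : ℂ} (hφ : AnalyticAt ℂ φ a)
    (hd : deriv φ a ≠ 0) (hR : AnalyticAt ℂ (fun ξ => R (φ ξ)) a) : AnalyticAt ℂ R (φ a) := by
  obtain ⟨ψ, hψ, hψa, hright, -⟩ := exists_analyticAt_localInverse hφ hd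
  have hcomp : AnalyticAt ℂ (fun z => R (φ (ψ z))) (φ a) :=
    AnalyticAt.fun_comp (g := fun ξ => R (φ ξ)) (by rwa [hψa]) hψ
  exact hcomp.congr (hright.mono fun z hz => congrArg R hz)

lemma analyticAt_of_comp_pow (hm : m ≠ 0) {R : ℂ → ℂ} (hR : AnalyticAt ℂ (fun ξ => R (ξ ^ m)) 0) :
    AnalyticAt ℂ R 0 := by
  refine Complex.analyticAt_of_differentiable_on_punctured_nhds_of_continuousAt ?_ ?_
  · filter_upwards [eventually_forall_pow_eq hm (nhdsWithin_le_nhds hR.eventually_analyticAt),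
      self_mem_nhdsWithin] with z hz hz0
    obtain ⟨ξ, rfl⟩ := IsAlgClosed.exists_pow_nat_eq z (Nat.pos_of_ne_zero hm)
    have hd : deriv (fun ξ : ℂ => ξ ^ m) ξ ≠ 0 := by
      simpa [hm] using pow_ne_zero (m - 1) (ne_zero_pow hm hz0)
    exact (analyticAt_of_comp_of_deriv_ne_zero (analyticAt_id.pow m) hd (hz ξ rfl)).differentiableAt
  · have hcont := hR.continuousAt.tendsto
    simp only [zero_pow hm] at hcont
    rw [ContinuousAt, ← map_pow_nhds_zero hm]
    exact tendsto_map'_iff.2 hcont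

end Pow

section RootAverage

/-- The average of `F` over the `m`-th roots of `z`, which descends functions along `ξ ↦ ξ ^ m`. -/
noncomputable def rootAverage (m : ℕ) (F : ℂ → ℂ) (z : ℂ) : ℂ :=
  (m : ℂ)⁻¹ * ((Polynomial.nthRoots m z).map F).sum

variable {m : ℕ} {ζ : ℂ} {F : ℂ → ℂ} {G : ℂ → ℝ}

lemma rootAverage_pow (hζ : IsPrimitiveRoot ζ m) (F : ℂ → ℂ) (ξ : ℂ) :
    rootAverage m F (ξ ^ m) = (m : ℂ)⁻¹ * ∑ k ∈ Finset.range m, F (ζ ^ k * ξ) := by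
  rw [rootAverage, hζ.nthRoots_eq rfl, Multiset.map_map]
  rfl

lemma analyticAt_rootAverage (hm : m ≠ 0) (hF : AnalyticAt ℂ F 0) :
    AnalyticAt ℂ (rootAverage m F) 0 := by
  refine analyticAt_of_comp_pow hm ?_
  simp only [rootAverage_pow (Complex.isPrimitiveRoot_exp m hm)]
  refine analyticAt_const.mul (Finset.analyticAt_fun_sum _ fun k _ => ?_)
  exact AnalyticAt.fun_comp (g := F) (by rwa [mul_zero]) (analyticAt_const.mul analyticAt_id)

lemma eventually_re_rootAverage_pow_eq (hm : m ≠ 0)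
    (hF : ∀ᶠ ξ in 𝓝 (0 : ℂ), G (ξ ^ m) = (F ξ).re) :
    ∀ᶠ ξ in 𝓝 (0 : ℂ), G (ξ ^ m) = (rootAverage m F (ξ ^ m)).re := by
  have hζ := Complex.isPrimitiveRoot_exp m hm
  set ζ : ℂ := Complex.exp (2 * Real.pi * Complex.I / m)
  have hrot (k : ℕ) : Tendsto (fun ξ : ℂ => ζ ^ k * ξ) (𝓝 0) (𝓝 0) :=
    (continuous_const_mul (ζ ^ k)).tendsto' 0 0 (mul_zero _)
  filter_upwards [(Finset.range m).eventually_all.2 fun k _ => (hrot k).eventually hF] with ξ hξ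
  have hterm : ∀ k ∈ Finset.range m, (F (ζ ^ k * ξ)).re = G (ξ ^ m) := fun k hk => by
    rw [← hξ k hk, mul_pow, ← pow_mul, mul_comm k m, pow_mul, hζ.pow_eq_one, one_pow, one_mul]
  rw [rootAverage_pow hζ, ← Complex.ofReal_natCast, ← Complex.ofReal_inv, Complex.re_ofReal_mul,
    Complex.re_sum, Finset.sum_congr rfl hterm, Finset.sum_const, Finset.card_range, nsmul_eq_mul,
    inv_mul_cancel_left₀ (Nat.cast_ne_zero.2 hm)]

lemma harmonicAt_of_comp_pow (hm : m ≠ 0) (hG : HarmonicAt (fun ξ => G (ξ ^ m)) 0) :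
    HarmonicAt G 0 := by
  obtain ⟨F, hF, hre⟩ := exists_analyticAt_re_eq hG
  refine (harmonicAt_congr_nhds ?_).2 (analyticAt_rootAverage hm hF).harmonicAt_re
  rw [Filter.EventuallyEq, ← map_pow_nhds_zero hm, eventually_map]
  exact eventually_re_rootAverage_pow_eq hm hre

end RootAverage

section PowArc

variable {m : ℕ}

lemma arcPath_one_pow (m : ℕ) (β : ℝ → ℝ) (s : ℝ) :
    arcPath 1 β s ^ m = arcPath m (fun s => m * β s) s := by
  simp only [arcPath, pow_one, mul_pow, ← Complex.exp_nat_mul, Complex.ofReal_mul,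
    Complex.ofReal_natCast, mul_assoc]

lemma arc_eq_image_arcPath (hm : m ≠ 0) (β : ℝ → ℝ) : arc m β = arcPath m β '' Ioi 0 := by
  refine Subset.antisymm (fun z hz => ⟨‖z‖ ^ (1 / m : ℝ), ?_, (eq_arcPath_of_mem_arc hm hz).symm⟩)
    (image_subset_iff.2 fun s hs => arcPath_mem_arc hm hs)
  exact Real.rpow_pos_of_pos (norm_pos_iff.2 hz.1) _

lemma image_pow_arc_one (hm : m ≠ 0) (β : ℝ → ℝ) :
    (· ^ m) '' arc 1 β = arc m fun s => m * β s := by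
  simp only [arc_eq_image_arcPath hm, arc_eq_image_arcPath one_ne_zero, image_image,
    arcPath_one_pow]

lemma exists_arcs_of_comp_pow (hm : m ≠ 0) {T : Set ℂ} {A : Finset (ℝ → ℝ)}
    (hA : ∀ β ∈ A, AnalyticAt ℝ β 0)
    (hT : ∀ᶠ ξ in 𝓝[≠] (0 : ℂ), (ξ ^ m ∈ T ↔ ∃ β ∈ A, ξ ∈ arc 1 β)) :
    ∃ B : Finset (ℝ → ℝ), (∀ β ∈ B, AnalyticAt ℝ β 0) ∧
      ∀ᶠ z in 𝓝[≠] (0 : ℂ), (z ∈ T ↔ ∃ β ∈ B, z ∈ arc m β) := by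
  classical
  refine ⟨A.image fun β s => m * β s, ?_, ?_⟩
  · exact Finset.forall_mem_image.2 fun β hβ => analyticAt_const.mul (hA β hβ)
  filter_upwards [eventually_forall_pow_eq hm hT] with z hz
  simp only [Finset.mem_image, exists_exists_and_eq_and, ← image_pow_arc_one hm]
  constructor
  · intro hzT
    obtain ⟨ξ, rfl⟩ := IsAlgClosed.exists_pow_nat_eq z (Nat.pos_of_ne_zero hm)
    obtain ⟨β, hβ, hξ⟩ := (hz ξ rfl).1 hzT
    exact ⟨β, hβ, mem_image_of_mem _ hξ⟩
  · rintro ⟨β, hβ, ξ, hξ, rfl⟩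
    exact (hz ξ rfl).2 ⟨β, hβ, hξ⟩

end PowArc

section NormalForm

lemma deriv_ne_zero_of_eventually_comp_eq {φ ψ : ℂ → ℂ} {b : ℂ} (hψ : DifferentiableAt ℂ ψ b)
    (hφ : DifferentiableAt ℂ φ (ψ b)) (h : ∀ᶠ z in 𝓝 b, φ (ψ z) = z) : deriv ψ b ≠ 0 := by
  intro hd
  have hid : HasDerivAt (φ ∘ ψ) 1 b := (hasDerivAt_id b).congr_of_eventuallyEq h
  have hcomp := hφ.hasDerivAt.comp b hψ.hasDerivAt
  rw [hd, mul_zero] at hcomp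
  exact one_ne_zero (hid.unique hcomp)

lemma exists_analyticAt_eventually_pow_eq {e : ℂ → ℂ} {a : ℂ} {k : ℕ} (hk : k ≠ 0)
    (he : AnalyticAt ℂ e a) (he0 : e a ≠ 0) :
    ∃ E : ℂ → ℂ, AnalyticAt ℂ E a ∧ E a ≠ 0 ∧ ∀ᶠ w in 𝓝 a, E w ^ k = e w := by
  obtain ⟨r, hr⟩ := IsAlgClosed.exists_pow_nat_eq (e a) (Nat.pos_of_ne_zero hk)
  have hk' : (k : ℂ) ≠ 0 := Nat.cast_ne_zero.2 hk
  have hr0 : r ≠ 0 := ne_zero_pow hk (hr ▸ he0)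
  refine ⟨fun w => r * Complex.exp (Complex.log (e w / e a) / k), ?_,
    mul_ne_zero hr0 (Complex.exp_ne_zero _), ?_⟩
  · refine analyticAt_const.mul (AnalyticAt.cexp (AnalyticAt.div ?_ analyticAt_const hk'))
    refine (he.fun_div analyticAt_const he0).clog ?_
    simpa only [div_self he0] using Complex.one_mem_slitPlane
  · filter_upwards [he.continuousAt.eventually_ne he0] with w hw
    rw [mul_pow, hr, ← Complex.exp_nat_mul, mul_div_cancel₀ _ hk',
      Complex.exp_log (div_ne_zero hw he0), mul_div_cancel₀ _ he0]

/-- `ψ` is the inverse of a holomorphic coordinate centred at `a` in which `p` is the power map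
of degree `k`. -/
structure IsPowNormalForm (p : ℂ → ℂ) (a : ℂ) (k : ℕ) (ψ : ℂ → ℂ) : Prop where
  ne_zero : k ≠ 0
  analyticAt : AnalyticAt ℂ ψ 0
  map_zero : ψ 0 = a
  deriv_ne_zero : deriv ψ 0 ≠ 0
  eventually_eq_pow : ∀ᶠ t in 𝓝 (0 : ℂ), p (ψ t) = t ^ k

lemma exists_isPowNormalForm {p : ℂ → ℂ} {a : ℂ} (hp : AnalyticAt ℂ p a) (h0 : p a = 0)
    (hne : ¬ ∀ᶠ w in 𝓝 a, p w = 0) : ∃ k ψ, IsPowNormalForm p a k ψ := by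
  obtain ⟨k, e, he, he0, hpe⟩ := hp.exists_eventuallyEq_pow_smul_nonzero_iff.2 hne
  have hk : k ≠ 0 := by
    rintro rfl
    have := hpe.self_of_nhds
    simp only [h0, pow_zero, one_smul] at this
    exact he0 this.symm
  obtain ⟨E, hE, hE0, hEk⟩ := exists_analyticAt_eventually_pow_eq hk he he0
  set Z : ℂ → ℂ := fun w => (w - a) * E w
  have hZ : AnalyticAt ℂ Z a := (analyticAt_id.sub analyticAt_const).mul hE
  have hZ0 : Z a = 0 := by simp only [Z, sub_self, zero_mul]
  have hZd : HasDerivAt Z (E a) a := by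
    simpa using ((hasDerivAt_id' a).sub_const a).fun_mul hE.differentiableAt.hasDerivAt
  obtain ⟨ψ, hψ, hψa, hright, -⟩ := exists_analyticAt_localInverse hZ (hZd.deriv.symm ▸ hE0)
  rw [hZ0] at hψ hψa hright
  have hZψ : DifferentiableAt ℂ Z (ψ 0) := hψa.symm ▸ hZ.differentiableAt
  refine ⟨k, ψ, hk, hψ, hψa,
    deriv_ne_zero_of_eventually_comp_eq hψ.differentiableAt hZψ hright, ?_⟩
  have hψt : Tendsto ψ (𝓝 0) (𝓝 a) := by simpa only [hψa] using hψ.continuousAt.tendsto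
  filter_upwards [hright, hψt.eventually (hpe.and hEk)] with t h1 ⟨h2, h3⟩
  rw [h2, smul_eq_mul, ← h3, ← mul_pow]
  exact congrArg (· ^ k) h1

namespace IsPowNormalForm

variable {p ψ : ℂ → ℂ} {a : ℂ} {k : ℕ}

lemma map_nhds (h : IsPowNormalForm p a k ψ) : map ψ (𝓝 0) = 𝓝 a := by
  simpa only [h.map_zero] using h.analyticAt.hasStrictDerivAt.map_nhds_eq h.deriv_ne_zero

end IsPowNormalForm

end NormalForm

section PuncturedBall

lemma isPreconnected_ball_diff_singleton {E : Type*} [NormedAddCommGroup E] [NormedSpace ℝ E]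
    (hE : 1 < Module.rank ℝ E) (x : E) (ε : ℝ) : IsPreconnected (Metric.ball x ε \ {x}) := by
  have himage : Metric.ball x ε \ {x} =
      (fun p : ℝ × E => x + p.1 • p.2) '' (Ioo 0 ε ×ˢ Metric.sphere 0 1) := by
    ext y
    constructor
    · rintro ⟨hy, hyx⟩
      have hpos : 0 < ‖y - x‖ := norm_pos_iff.2 (sub_ne_zero.2 hyx)
      refine ⟨(‖y - x‖, ‖y - x‖⁻¹ • (y - x)), ⟨⟨hpos, mem_ball_iff_norm.1 hy⟩, ?_⟩, ?_⟩
      · rw [mem_sphere_zero_iff_norm, norm_smul, norm_inv, norm_norm, inv_mul_cancel₀ hpos.ne']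
      · simp only [smul_inv_smul₀ hpos.ne', add_sub_cancel]
    · rintro ⟨⟨s, u⟩, ⟨hs, hu⟩, rfl⟩
      have hnorm : ‖s • u‖ = s := by
        rw [norm_smul, mem_sphere_zero_iff_norm.1 hu, mul_one, Real.norm_of_nonneg hs.1.le]
      refine ⟨?_, fun h => hs.1.ne' ?_⟩
      · simpa only [mem_ball_iff_norm, add_sub_cancel_left, hnorm] using hs.2
      · rw [← hnorm, norm_eq_zero, ← add_eq_left (a := x)]
        exact h
  rw [himage]
  exact (isPreconnected_Ioo.prod (isPreconnected_sphere hE 0 1)).image _ (by fun_prop)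

lemma exists_eventually_maxLogHarm_eq {J : Type*} [Finite J] [Nonempty J] {ρ : J → ℝ}
    {H : J → ℂ → ℝ} (hH : ∀ j, HarmonicAt (H j) 0)
    (hM : ∀ᶠ ξ in 𝓝[≠] (0 : ℂ), HarmonicAt (maxLogHarm ρ H) ξ) :
    ∃ j, ∀ᶠ ξ in 𝓝[≠] (0 : ℂ), maxLogHarm ρ H ξ = logHarm (ρ j) (H j) ξ := by
  have hev := hM.and (eventually_all.2 fun j => eventually_harmonicAt_logHarm (ρ := ρ j) (hH j))
  obtain ⟨ε, hε, hball⟩ := Metric.eventually_nhds_iff_ball.1 (eventually_nhdsWithin_iff.1 hev)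
  replace hball : ∀ ξ ∈ Metric.ball (0 : ℂ) ε \ {0}, _ := fun ξ hξ => hball ξ hξ.1 hξ.2
  have hpunctured : Metric.ball (0 : ℂ) ε \ {0} ∈ 𝓝[≠] (0 : ℂ) :=
    sdiff_mem_nhdsWithin_compl (Metric.ball_mem_nhds 0 hε) _
  obtain ⟨a, ha⟩ := Filter.nonempty_of_mem hpunctured
  obtain ⟨j, hj⟩ := exists_logHarm_eq_maxLogHarm ρ H a
  have heq : logHarm (ρ j) (H j) =ᶠ[𝓝 a] maxLogHarm ρ H :=
    eventuallyEq_iSup_of_harmonicAt (hball a ha).1 ((hball a ha).2 j) hj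
  refine ⟨j, mem_of_superset hpunctured fun ξ hξ => ?_⟩
  refine AnalyticOnNhd.eqOn_of_preconnected_of_eventuallyEq (𝕜 := ℝ)
    (fun z hz => HarmonicAt.analyticAt (hball z hz).1)
    (fun z hz => HarmonicAt.analyticAt ((hball z hz).2 j))
    (isPreconnected_ball_diff_singleton ?_ 0 ε) ha heq.symm hξ
  rw [Complex.rank_real_complex]
  exact Nat.one_lt_ofNat

end PuncturedBall

/-! ### Coordinates on Riemann surfaces -/

lemma eventually_symm_transition_eq {X : Type*} [TopologicalSpace X]
    {e e' : OpenPartialHomeomorph X ℂ} {x : X} (hx : x ∈ e.source) (hx' : x ∈ e'.source) :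
    ∀ᶠ w in 𝓝 (e x), e'.symm (e' (e.symm w)) = e.symm w :=
  (e.tendsto_symm hx).eventually (e'.eventually_left_inverse hx')

section Charts

variable {X X' : Type*} [TopologicalSpace X] [ChartedSpace ℂ X]
  [TopologicalSpace X'] [ChartedSpace ℂ X'] {e e' : OpenPartialHomeomorph X ℂ} {x : X}

lemma analyticAt_comp_symm_of_mdifferentiable {ν : X → X'} (hν : MDifferentiable 𝓘(ℂ) 𝓘(ℂ) ν)
    {d : OpenPartialHomeomorph X' ℂ} (he : e ∈ IsManifold.maximalAtlas 𝓘(ℂ) ω X)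
    (hd : d ∈ IsManifold.maximalAtlas 𝓘(ℂ) ω X') (hx : x ∈ e.source) (hνx : ν x ∈ d.source) :
    AnalyticAt ℂ (fun w => d (ν (e.symm w))) (e x) := by
  have htarget : ∀ᶠ w in 𝓝 (e x), w ∈ e.target := e.open_target.mem_nhds (e.map_source hx)
  have hsource : ∀ᶠ w in 𝓝 (e x), ν (e.symm w) ∈ d.source :=
    ((hν.continuous.tendsto x).comp (e.tendsto_symm hx)).eventually (d.open_source.mem_nhds hνx)
  refine Complex.analyticAt_iff_eventually_differentiableAt.2 ?_
  filter_upwards [htarget, hsource] with w hw hνw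
  have hsymm : MDifferentiableAt 𝓘(ℂ) 𝓘(ℂ) e.symm w :=
    (contMDiffAt_symm_of_mem_maximalAtlas he hw).mdifferentiableAt (by simp)
  have hchart : MDifferentiableAt 𝓘(ℂ) 𝓘(ℂ) d (ν (e.symm w)) :=
    (contMDiffAt_of_mem_maximalAtlas hd hνw).mdifferentiableAt (by simp)
  exact (hchart.comp w ((hν _).comp w hsymm)).differentiableAt

lemma analyticAt_transition (he : e ∈ IsManifold.maximalAtlas 𝓘(ℂ) ω X)
    (he' : e' ∈ IsManifold.maximalAtlas 𝓘(ℂ) ω X) (hx : x ∈ e.source) (hx' : x ∈ e'.source) :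
    AnalyticAt ℂ (fun w => e' (e.symm w)) (e x) :=
  analyticAt_comp_symm_of_mdifferentiable (ν := fun x => x) mdifferentiable_id he he' hx hx'

lemma deriv_transition_ne_zero (he : e ∈ IsManifold.maximalAtlas 𝓘(ℂ) ω X)
    (he' : e' ∈ IsManifold.maximalAtlas 𝓘(ℂ) ω X) (hx : x ∈ e.source) (hx' : x ∈ e'.source) :
    deriv (fun w => e' (e.symm w)) (e x) ≠ 0 := by
  refine deriv_ne_zero_of_eventually_comp_eq (φ := fun w => e (e'.symm w))
    (analyticAt_transition he he' hx hx').differentiableAt ?_ ?_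
  · simpa only [e.left_inv hx] using (analyticAt_transition he' he hx' hx).differentiableAt
  · filter_upwards [eventually_symm_transition_eq hx hx', e.eventually_right_inverse' hx]
      with w hw hw'
    rw [hw, hw']

lemma isHarmonicAt_iff_chartAt {g : X → EReal} : IsHarmonicAt g x ↔
    EHarmonicAt (fun w => g ((chartAt ℂ x).symm w)) (chartAt ℂ x x) := by
  set e := chartAt ℂ x
  have hx : x ∈ e.source := mem_chart_source ℂ x
  refine ⟨fun ⟨h, hh, hev⟩ => ⟨h, hh, ?_⟩, fun ⟨h, hh, hev⟩ => ⟨h, hh, ?_⟩⟩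
  · filter_upwards [(e.tendsto_symm hx).eventually hev, e.eventually_right_inverse' hx]
      with w hw hw'
    rw [hw, hw']
  · filter_upwards [(e.continuousAt hx).eventually hev, e.eventually_left_inverse hx]
      with y hy hy'
    rw [← hy, hy']

lemma isHarmonicAt_iff [IsManifold 𝓘(ℂ) ω X] {g : X → EReal}
    (he : e ∈ IsManifold.maximalAtlas 𝓘(ℂ) ω X) (hx : x ∈ e.source) :
    IsHarmonicAt g x ↔ EHarmonicAt (fun w => g (e.symm w)) (e x) := by
  have he₀ : chartAt ℂ x ∈ IsManifold.maximalAtlas 𝓘(ℂ) ω X := IsManifold.chart_mem_maximalAtlas x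
  have hx₀ : x ∈ (chartAt ℂ x).source := mem_chart_source ℂ x
  have hcomp := eHarmonicAt_comp_iff (G := fun w => g ((chartAt ℂ x).symm w))
    (analyticAt_transition he he₀ hx hx₀) (deriv_transition_ne_zero he he₀ hx hx₀)
  have heq : ∀ᶠ w in 𝓝 (e x), g ((chartAt ℂ x).symm (chartAt ℂ x (e.symm w))) = g (e.symm w) :=
    (eventually_symm_transition_eq hx hx₀).mono fun w hw => congrArg g hw
  rw [e.left_inv hx] at hcomp
  rw [isHarmonicAt_iff_chartAt, ← hcomp]
  exact ⟨fun h => h.congr (heq.mono fun _ => Eq.symm), fun h => h.congr heq⟩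

lemma continuousAt_of_isHarmonicAt {g : X → EReal} (h : IsHarmonicAt g x) :
    ContinuousAt g x := by
  obtain ⟨u, hu, hev⟩ := h
  have hcont : ContinuousAt (fun y => (u (chartAt ℂ x y) : EReal)) x :=
    continuous_coe_real_ereal.continuousAt.comp
      (hu.1.continuousAt.comp ((chartAt ℂ x).continuousAt (mem_chart_source ℂ x)))
  exact hcont.congr (hev.mono fun y hy => hy.symm)

end Charts

/-! ### The local model of the tropical trace -/

section Suprema

lemma continuousAt_iSup_of_finite {X L J : Type*} [TopologicalSpace X] [TopologicalSpace L]
    [ConditionallyCompleteLattice L] [ContinuousSup L] [Finite J] [Nonempty J] {U : J → X → L}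
    {x : X} (hU : ∀ j, ContinuousAt (U j) x) : ContinuousAt (fun z => ⨆ j, U j z) x := by
  cases nonempty_fintype J
  simp only [← Finset.sup'_univ_eq_ciSup]
  exact ContinuousAt.finset_sup'_apply _ fun j _ => hU j

lemma logHarm_zero (H : ℂ → ℝ) : logHarm 0 H = H := by
  funext ξ
  rw [logHarm, zero_mul, zero_add]

variable {J : Type*} [Finite J] [Nonempty J] {ρ : J → ℝ} {H : J → ℂ → ℝ}

lemma continuousAt_maxLogHarm (hH : ∀ j, ContinuousAt (H j) 0) (hρ : ∀ j, ρ j = 0) :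
    ContinuousAt (maxLogHarm ρ H) 0 :=
  continuousAt_iSup_of_finite fun j => by simpa only [hρ j, logHarm_zero] using hH j

lemma exists_eventually_maxLogHarm_eq_logHarm
    (hH : ∀ j, ∀ᶠ ξ in 𝓝 (0 : ℂ), ContinuousAt (H j) ξ) :
    ∃ (r : ℝ) (h : ℂ → ℝ), (∀ᶠ ξ in 𝓝 (0 : ℂ), ContinuousAt h ξ) ∧
      (∃ j, ρ j = r ∧ H j 0 = h 0) ∧ ∀ᶠ ξ in 𝓝[≠] (0 : ℂ), maxLogHarm ρ H ξ = logHarm r h ξ := by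
  obtain ⟨i, hi⟩ := Finite.exists_min ρ
  have : Nonempty {j // ρ j = ρ i} := ⟨i, rfl⟩
  have hlt : ∀ᶠ ξ in 𝓝[≠] (0 : ℂ), ∀ j, ρ i < ρ j →
      logHarm (ρ j) (H j) ξ < logHarm (ρ i) (H i) ξ :=
    eventually_all.2 fun j => eventually_imp_distrib_left.2 fun h =>
      eventually_logHarm_lt h (hH i).self_of_nhds (hH j).self_of_nhds
  refine ⟨ρ i, fun ξ => ⨆ j : {j // ρ j = ρ i}, H j ξ, ?_, ?_, hlt.mono fun ξ hξ => ?_⟩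
  · exact (eventually_all.2 hH).mono fun ξ hξ => continuousAt_iSup_of_finite fun j => hξ j
  · obtain ⟨j, hj⟩ := exists_eq_ciSup_of_finite (f := fun j : {j // ρ j = ρ i} => H j 0)
    exact ⟨j, j.2, hj⟩
  · have hle (j : J) (hj : ρ j = ρ i) : logHarm (ρ j) (H j) ξ ≤
        logHarm (ρ i) (fun ξ => ⨆ j : {j // ρ j = ρ i}, H j ξ) ξ := by
      rw [logHarm, logHarm, hj]
      exact add_le_add_right
        (le_ciSup (finite_range fun j : {j // ρ j = ρ i} => H j ξ).bddAbove ⟨j, hj⟩) _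
    refine le_antisymm (maxLogHarm_le_iff.2 fun j => ?_) ?_
    · rcases (hi j).eq_or_lt with h | h
      · exact hle j h.symm
      · exact (hξ j h).le.trans (hle i rfl)
    · obtain ⟨j, hj⟩ := exists_eq_ciSup_of_finite (f := fun j : {j // ρ j = ρ i} => H j ξ)
      simpa only [logHarm, j.2, ← hj] using logHarm_le_maxLogHarm ρ H ξ j

end Suprema

section PowChart

variable {X : Type*} [TopologicalSpace X] [ChartedSpace ℂ X] {m : ℕ}

/-- The inverse of the chart at `q`, precomposed with a translation so that `q` is the image
of `0`. -/
noncomputable def centredChart (q : X) (z : ℂ) : X :=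
  (chartAt ℂ q).symm (chartAt ℂ q q + z)

/-- The substitution `z = ξ ^ m` in the centred coordinate `z` at `q`. -/
noncomputable def powChart (q : X) (m : ℕ) (ξ : ℂ) : X :=
  centredChart q (ξ ^ m)

lemma centredChart_zero (q : X) : centredChart q 0 = q := by
  rw [centredChart, add_zero, (chartAt ℂ q).left_inv (mem_chart_source ℂ q)]

lemma powChart_zero (q : X) (hm : m ≠ 0) : powChart q m 0 = q := by
  rw [powChart, zero_pow hm, centredChart_zero]

lemma map_const_add_pow (c : ℂ) (hm : m ≠ 0) (ξ : ℂ) :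
    map (fun ξ : ℂ => c + ξ ^ m) (𝓝 ξ) = 𝓝 (c + ξ ^ m) :=
  ((isOpenMap_add_left c).comp (isOpenMap_pow hm)).map_nhds_eq (by fun_prop)

lemma map_const_add_pow_zero (c : ℂ) (hm : m ≠ 0) :
    map (fun ξ : ℂ => c + ξ ^ m) (𝓝 0) = 𝓝 c := by
  simpa only [zero_pow hm, add_zero] using map_const_add_pow c hm 0

lemma map_powChart (q : X) (hm : m ≠ 0) : map (powChart q m) (𝓝 0) = 𝓝 q := by
  rw [← (chartAt ℂ q).symm_map_nhds_eq (mem_chart_source ℂ q),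
    ← map_const_add_pow_zero (chartAt ℂ q q) hm, Filter.map_map]
  rfl

lemma eventually_nhds_powChart_iff {q : X} (hm : m ≠ 0) {p : X → Prop} :
    (∀ᶠ ξ in 𝓝 (0 : ℂ), p (powChart q m ξ)) ↔ ∀ᶠ x in 𝓝 q, p x := by
  rw [← map_powChart q hm, eventually_map]

lemma eventually_chartAt_powChart (q : X) (hm : m ≠ 0) :
    ∀ᶠ ξ in 𝓝 (0 : ℂ), powChart q m ξ ∈ (chartAt ℂ q).source ∧
      chartAt ℂ q (powChart q m ξ) = chartAt ℂ q q + ξ ^ m := by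
  have htarget := (chartAt ℂ q).open_target.mem_nhds (mem_chart_target ℂ q)
  rw [← map_const_add_pow_zero _ hm] at htarget
  exact Eventually.mono htarget fun ξ hξ =>
    ⟨(chartAt ℂ q).map_target hξ, (chartAt ℂ q).right_inv hξ⟩

lemma eventually_powChart_eq_iff (q : X) (hm : m ≠ 0) :
    ∀ᶠ ξ in 𝓝 (0 : ℂ), (powChart q m ξ = q ↔ ξ = 0) := by
  filter_upwards [eventually_chartAt_powChart q hm] with ξ hξ
  refine ⟨fun h => ?_, fun h => by rw [h, powChart_zero q hm]⟩
  rw [h, left_eq_add] at hξ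
  exact eq_zero_of_pow_eq_zero hξ.2

lemma eventually_nhdsNE_powChart_iff {q : X} (hm : m ≠ 0) {p : X → Prop} :
    (∀ᶠ ξ in 𝓝[≠] (0 : ℂ), p (powChart q m ξ)) ↔ ∀ᶠ x in 𝓝[≠] q, p x := by
  rw [eventually_nhdsWithin_iff, eventually_nhdsWithin_iff,
    ← eventually_nhds_powChart_iff (q := q) hm]
  refine eventually_congr ((eventually_powChart_eq_iff q hm).mono fun ξ hξ => ?_)
  exact imp_congr_left (not_congr hξ.symm)

end PowChart

section RootBranch

variable {k d l : ℕ} {ξ t : ℂ}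

/-- The branches of the multivalued function `(ξ ^ (k * d)) ^ (1 / k)`, indexed by the exponent `l`
of a primitive `k`-th root of unity. -/
noncomputable def rootBranch (k d l : ℕ) (ξ : ℂ) : ℂ :=
  Complex.exp (2 * Real.pi * Complex.I / k) ^ l * ξ ^ d

lemma rootBranch_zero (hd : d ≠ 0) : rootBranch k d l 0 = 0 := by
  rw [rootBranch, zero_pow hd, mul_zero]

lemma analyticAt_rootBranch : AnalyticAt ℂ (rootBranch k d l) ξ :=
  analyticAt_const.mul (analyticAt_id.pow _)

lemma norm_rootBranch (hk : k ≠ 0) : ‖rootBranch k d l ξ‖ = ‖ξ‖ ^ d := by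
  rw [rootBranch, norm_mul, norm_pow, norm_pow,
    (Complex.isPrimitiveRoot_exp k hk).norm'_eq_one hk, one_pow, one_mul]

lemma rootBranch_pow (hk : k ≠ 0) : rootBranch k d l ξ ^ k = ξ ^ (k * d) := by
  rw [rootBranch, mul_pow, ← pow_mul, mul_comm l, pow_mul,
    (Complex.isPrimitiveRoot_exp k hk).pow_eq_one, one_pow, one_mul, ← pow_mul, mul_comm d]

lemma exists_rootBranch_eq (hk : k ≠ 0) (h : t ^ k = ξ ^ (k * d)) :
    ∃ l : Fin k, rootBranch k d l ξ = t := by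
  have hmem : t ∈ Polynomial.nthRoots k (ξ ^ (k * d)) :=
    (Polynomial.mem_nthRoots (Nat.pos_of_ne_zero hk)).2 h
  rw [(Complex.isPrimitiveRoot_exp k hk).nthRoots_eq (by rw [← pow_mul, mul_comm]),
    Multiset.mem_map] at hmem
  obtain ⟨l, hl, hlt⟩ := hmem
  exact ⟨⟨l, Multiset.mem_range.1 hl⟩, hlt⟩

lemma tendsto_rootBranch (hd : d ≠ 0) : Tendsto (rootBranch k d l) (𝓝 0) (𝓝 0) := by
  simpa only [rootBranch_zero hd] using
    (analyticAt_rootBranch (k := k) (d := d) (l := l)).continuousAt.tendsto (x := 0)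

lemma tendsto_rootBranch_nhdsNE (hk : k ≠ 0) (hd : d ≠ 0) :
    Tendsto (rootBranch k d l) (𝓝[≠] 0) (𝓝[≠] 0) := by
  refine (tendsto_rootBranch hd).inf (tendsto_principal_principal.2 fun ξ hξ => ?_)
  rw [mem_compl_singleton_iff, ← norm_ne_zero_iff, norm_rootBranch hk]
  exact pow_ne_zero d (norm_ne_zero_iff.2 hξ)

lemma logHarm_rootBranch (hk : k ≠ 0) (r : ℝ) (H : ℂ → ℝ) (ξ : ℂ) :
    logHarm r H (rootBranch k d l ξ) = logHarm (r * d) (fun ξ => H (rootBranch k d l ξ)) ξ := by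
  rw [logHarm, logHarm, norm_rootBranch hk, Real.log_pow, mul_assoc]

end RootBranch

section Covering

universe v w

variable {Y : Type v} {Y' : Type w} [TopologicalSpace Y] [ChartedSpace ℂ Y]
  [TopologicalSpace Y'] [ChartedSpace ℂ Y']

lemma HasLogSingularityAt.eq_zero_of_notMem_pol {f : Y → EReal} {y : Y} {r : ℝ}
    (h : HasLogSingularityAt f y r) (hy : y ∉ pol f) : r = 0 := by
  by_contra hr
  exact hy ((lt_or_gt_of_ne hr).imp (fun hr => ⟨r, hr, h⟩) fun hr => ⟨r, hr, h⟩)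

lemma HasLogSingularityAt.nonneg_of_notMem_polNeg {f : Y → EReal} {y : Y} {r : ℝ}
    (h : HasLogSingularityAt f y r) (hy : y ∉ polNeg f) : 0 ≤ r :=
  not_lt.1 fun hr => hy ⟨r, hr, h⟩

lemma hasLogSingularityAt_zero_of_isHarmonicAt {f : Y → EReal} {y : Y} (h : IsHarmonicAt f y) :
    HasLogSingularityAt f y 0 := by
  have hcont := continuousAt_of_isHarmonicAt h
  obtain ⟨u, hu, hev⟩ := h
  refine ⟨u, hu, nhdsWithin_le_nhds (hev.mono fun z hz => ?_), hcont⟩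
  rw [hz, zero_mul, zero_add]

lemma exists_hasLogSingularityAt {f : Y → EReal} (hf : ∀ y, y ∉ pol f → IsHarmonicAt f y) (y : Y) :
    ∃ r, HasLogSingularityAt f y r := by
  by_cases hy : y ∈ pol f
  · rcases hy with ⟨r, -, hr⟩ | ⟨r, -, hr⟩ <;> exact ⟨r, hr⟩
  · exact ⟨0, hasLogSingularityAt_zero_of_isHarmonicAt (hf y hy)⟩

lemma exists_analyticAt_eq_add_mul {ψ : ℂ → ℂ} {c : ℂ} (hψ : AnalyticAt ℂ ψ c) :
    ∃ E : ℂ → ℂ, AnalyticAt ℂ E c ∧ E c = deriv ψ c ∧ ∀ t, ψ t = ψ c + (t - c) * E t := by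
  obtain ⟨p, hp⟩ := hψ
  refine ⟨dslope ψ c, hp.has_fpower_series_dslope_fslope.analyticAt, dslope_same ψ c, fun t => ?_⟩
  rw [← smul_eq_mul, sub_smul_dslope, add_sub_cancel]

lemma HasLogSingularityAt.exists_eventually_eq_logHarm {f : Y → EReal} {y : Y} {r : ℝ}
    (hf : HasLogSingularityAt f y r) {ψ : ℂ → ℂ} (hψ : AnalyticAt ℂ ψ 0)
    (hψ0 : ψ 0 = chartAt ℂ y y) (hd : deriv ψ 0 ≠ 0) :
    ∃ H, HarmonicAt H 0 ∧
      ∀ᶠ t in 𝓝[≠] (0 : ℂ), f ((chartAt ℂ y).symm (ψ t)) = ((logHarm r H t : ℝ) : EReal) := by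
  obtain ⟨h, hh, hexp, -⟩ := hf
  obtain ⟨E, hE, hE0, hψE⟩ := exists_analyticAt_eq_add_mul hψ
  set e := chartAt ℂ y
  have hy : y ∈ e.source := mem_chart_source ℂ y
  rw [← hE0] at hd
  simp only [hψ0, sub_zero] at hψE
  refine ⟨fun t => r * Real.log ‖E t‖ + h (ψ t),
    ((hE.harmonicAt_log_norm hd).const_smul (c := r)).add
    (harmonicAt_comp_of_analyticAt (by rwa [hψ0]) hψ), ?_⟩
  have hψt : Tendsto ψ (𝓝 0) (𝓝 (e y)) := hψ0 ▸ hψ.continuousAt.tendsto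
  have hev := ((e.tendsto_symm hy).comp hψt).eventually (eventually_nhdsWithin_iff.1 hexp)
  filter_upwards [nhdsWithin_le_nhds hev, nhdsWithin_le_nhds (hE.continuousAt.eventually_ne hd),
    self_mem_nhdsWithin, nhdsWithin_le_nhds (hψt.eventually (e.eventually_right_inverse' hy))]
    with t hft hEt ht hright
  have hne : e.symm (ψ t) ≠ y := fun h => mul_ne_zero ht hEt <| by
    rw [h, hψE, left_eq_add] at hright
    exact hright
  have hsub : ψ t - e y = t * E t := by rw [hψE, add_sub_cancel_left]
  simp only [Function.comp_apply, hright, hsub] at hft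
  rw [hft hne, norm_mul, Real.log_mul (norm_ne_zero_iff.2 ht) (norm_ne_zero_iff.2 hEt), logHarm,
    mul_add, add_assoc]

/-- The map `ν` read in the chart at `y` and the chart at `ν y`, the latter centred at `ν y`. -/
noncomputable def coordMap (ν : Y → Y') (y : Y) (w : ℂ) : ℂ :=
  chartAt ℂ (ν y) (ν ((chartAt ℂ y).symm w)) - chartAt ℂ (ν y) (ν y)

variable {ν : Y → Y'}

lemma exists_isPowNormalForm_coordMap [IsManifold 𝓘(ℂ) ω Y] [IsManifold 𝓘(ℂ) ω Y']
    (hν : MDifferentiable 𝓘(ℂ) 𝓘(ℂ) ν) {y : Y} (hfin : (ν ⁻¹' {ν y}).Finite) :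
    ∃ k ψ, IsPowNormalForm (coordMap ν y) (chartAt ℂ y y) k ψ := by
  have hy : y ∈ (chartAt ℂ y).source := mem_chart_source ℂ y
  have hνy : ν y ∈ (chartAt ℂ (ν y)).source := mem_chart_source ℂ (ν y)
  refine exists_isPowNormalForm ((analyticAt_comp_symm_of_mdifferentiable hν
    (IsManifold.chart_mem_maximalAtlas y) (IsManifold.chart_mem_maximalAtlas (ν y)) hy
    hνy).fun_sub analyticAt_const) ?_ fun hzero => ?_
  · rw [coordMap, (chartAt ℂ y).left_inv hy, sub_self]
  have hsource := ((hν.continuous.tendsto y).comp ((chartAt ℂ y).tendsto_symm hy)).eventually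
    ((chartAt ℂ (ν y)).open_source.mem_nhds hνy)
  have htarget := (chartAt ℂ y).open_target.mem_nhds ((chartAt ℂ y).map_source hy)
  have hfiber : ∀ᶠ w in 𝓝 (chartAt ℂ y y),
      w ∈ (chartAt ℂ y).target ∩ (chartAt ℂ y).symm ⁻¹' (ν ⁻¹' {ν y}) := by
    filter_upwards [hzero, hsource, htarget] with w hw hνw hwt
    exact ⟨hwt, (chartAt ℂ (ν y)).injOn hνw hνy (sub_eq_zero.1 hw)⟩
  refine infinite_of_mem_nhds _ hfiber (Set.Finite.of_finite_image (hfin.subset ?_)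
    ((chartAt ℂ y).symm.injOn.mono fun w hw => hw.1))
  rintro _ ⟨w, hw, rfl⟩
  exact hw.2

namespace IsPowNormalForm

variable {y : Y} {k : ℕ} {ψ : ℂ → ℂ}

lemma map_chartAt_symm_comp {p : ℂ → ℂ} (h : IsPowNormalForm p (chartAt ℂ y y) k ψ) :
    map (fun t => (chartAt ℂ y).symm (ψ t)) (𝓝 0) = 𝓝 y := by
  rw [← (chartAt ℂ y).symm_map_nhds_eq (mem_chart_source ℂ y), ← h.map_nhds, Filter.map_map]
  rfl

lemma tendsto_chartAt_symm_comp {p : ℂ → ℂ} (h : IsPowNormalForm p (chartAt ℂ y y) k ψ) :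
    Tendsto (fun t => (chartAt ℂ y).symm (ψ t)) (𝓝 0) (𝓝 y) :=
  h.map_chartAt_symm_comp.le

lemma eventually_coordMap (h : IsPowNormalForm (coordMap ν y) (chartAt ℂ y y) k ψ)
    (hν : Continuous ν) {q : Y'} (hq : ν y = q) : ∀ᶠ t in 𝓝 (0 : ℂ),
      ν ((chartAt ℂ y).symm (ψ t)) ∈ (chartAt ℂ q).source ∧
        chartAt ℂ q (ν ((chartAt ℂ y).symm (ψ t))) = chartAt ℂ q q + t ^ k := by
  subst hq
  have htend : Tendsto (fun t => ν ((chartAt ℂ y).symm (ψ t))) (𝓝 0) (𝓝 (ν y)) :=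
    (hν.tendsto y).comp h.tendsto_chartAt_symm_comp
  filter_upwards [h.eventually_eq_pow, htend.eventually (chart_source_mem_nhds ℂ (ν y))]
    with t ht hsource
  exact ⟨hsource, by rw [← ht, coordMap, add_sub_cancel]⟩

lemma exists_comp_rootBranch_eq_logHarm {p : ℂ → ℂ}
    (h : IsPowNormalForm p (chartAt ℂ y y) k ψ) {f : Y → EReal} {r : ℝ}
    (hf : HasLogSingularityAt f y r) {d : ℕ} (hd : d ≠ 0) (l : ℕ) :
    ContinuousAt (fun ξ => f ((chartAt ℂ y).symm (ψ (rootBranch k d l ξ)))) 0 ∧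
    ∃ H, HarmonicAt H 0 ∧ ∀ᶠ ξ in 𝓝[≠] (0 : ℂ),
      f ((chartAt ℂ y).symm (ψ (rootBranch k d l ξ))) = ((logHarm (r * d) H ξ : ℝ) : EReal) := by
  obtain ⟨H, hH, hlog⟩ :=
    hf.exists_eventually_eq_logHarm h.analyticAt h.map_zero h.deriv_ne_zero
  refine ⟨?_, fun ξ => H (rootBranch k d l ξ), harmonicAt_comp_of_analyticAt
    (by rwa [rootBranch_zero hd]) analyticAt_rootBranch, ?_⟩
  · obtain ⟨-, -, -, hcont⟩ := hf
    rw [ContinuousAt, rootBranch_zero hd, h.map_zero,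
      (chartAt ℂ y).left_inv (mem_chart_source ℂ y)]
    exact hcont.tendsto.comp (h.tendsto_chartAt_symm_comp.comp (tendsto_rootBranch hd))
  · filter_upwards [(tendsto_rootBranch_nhdsNE h.ne_zero hd).eventually hlog] with ξ hξ
    rw [hξ, logHarm_rootBranch h.ne_zero]

end IsPowNormalForm

lemma eventually_preimage_powChart_eq (hν : Continuous ν) (hclosed : IsClosedMap ν) {q : Y'}
    {k d : ν ⁻¹' {q} → ℕ} {ψ : ν ⁻¹' {q} → ℂ → ℂ} {m : ℕ} (hfin : (ν ⁻¹' {q}).Finite)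
    (hψ : ∀ y : ν ⁻¹' {q}, IsPowNormalForm (coordMap ν y) (chartAt ℂ (y : Y) y) (k y) (ψ y))
    (hm : m ≠ 0) (hd : ∀ y, m = k y * d y) :
    ∀ᶠ ξ in 𝓝 (0 : ℂ), ν ⁻¹' {powChart q m ξ} = range fun j : Σ y, Fin (k y) =>
      (chartAt ℂ (j.1 : Y)).symm (ψ j.1 (rootBranch (k j.1) (d j.1) j.2 ξ)) := by
  have := hfin.to_subtype
  have hd0 (y : ν ⁻¹' {q}) : d y ≠ 0 := right_ne_zero_of_mul (hd y ▸ hm)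
  have hcoord (y : ν ⁻¹' {q}) := (hψ y).eventually_coordMap hν y.2
  have hcover : ∀ᶠ z in 𝓝 q, ∀ x ∈ ν ⁻¹' {z}, ∃ (y : ν ⁻¹' {q}) (t : ℂ),
      (chartAt ℂ (y : Y)).symm (ψ y t) = x ∧ chartAt ℂ q (ν x) = chartAt ℂ q q + t ^ k y := by
    refine hclosed.eventually_nhds_fiber q fun y hy => ?_
    rw [← (hψ ⟨y, hy⟩).map_chartAt_symm_comp, eventually_map]
    exact (hcoord ⟨y, hy⟩).mono fun t ht => ⟨⟨y, hy⟩, t, rfl, ht.2⟩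
  have hbranch := eventually_all.2 fun j : Σ y, Fin (k y) =>
    (tendsto_rootBranch (k := k j.1) (l := j.2) (hd0 j.1)).eventually (hcoord j.1)
  filter_upwards [(eventually_nhds_powChart_iff hm).2 hcover, hbranch,
    eventually_chartAt_powChart q hm] with ξ hcover hbranch hξ
  refine Subset.antisymm (fun x hx => ?_) (range_subset_iff.2 fun j => ?_)
  · obtain ⟨y, t, rfl, ht⟩ := hcover x hx
    rw [mem_preimage, mem_singleton_iff] at hx
    rw [hx, hξ.2, add_right_inj, hd y] at ht
    obtain ⟨l, hl⟩ := exists_rootBranch_eq (hψ y).ne_zero ht.symm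
    exact ⟨⟨y, l⟩, by simp only [hl]⟩
  · obtain ⟨hsource, heq⟩ := hbranch j
    rw [rootBranch_pow (hψ j.1).ne_zero, ← hd] at heq
    rw [mem_preimage, mem_singleton_iff, powChart, centredChart, ← heq,
      (chartAt ℂ q).left_inv hsource]

/-- After the substitution `z = ξ ^ m`, the function `g` is near `q` the maximum of finitely many
harmonic functions with logarithmic terms. -/
structure IsLocalModel {X J : Type*} [TopologicalSpace X] [ChartedSpace ℂ X]
    (g : X → EReal) (q : X) (m : ℕ) (ρ : J → ℝ) (H : J → ℂ → ℝ) : Prop where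
  ne_zero : m ≠ 0
  harmonicAt : ∀ j, HarmonicAt (H j) 0
  continuousAt : ContinuousAt g q
  eventually_eq : ∀ᶠ ξ in 𝓝[≠] (0 : ℂ), g (powChart q m ξ) = ((maxLogHarm ρ H ξ : ℝ) : EReal)

lemma exists_isLocalModel [IsManifold 𝓘(ℂ) ω Y] [IsManifold 𝓘(ℂ) ω Y']
    (hν : IsBranchedCovering ν) {f : Y → EReal} (hf : ∀ y, y ∉ pol f → IsHarmonicAt f y) (q : Y') :
    ∃ (J : Type v) (_ : Finite J) (_ : Nonempty J) (m : ℕ) (ρ : J → ℝ) (H : J → ℂ → ℝ),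
      IsLocalModel (tropicalTrace ν f) q m ρ H ∧
      (q ∉ ν '' pol f → ∀ j, ρ j = 0) ∧ (q ∉ ν '' polNeg f → ∀ j, 0 ≤ ρ j) := by
  choose r hr using exists_hasLogSingularityAt hf
  choose k ψ hψ using fun y : ν ⁻¹' {q} =>
    exists_isPowNormalForm_coordMap hν.holomorphic (hν.finite_fiber (ν y))
  have := (hν.finite_fiber q).to_subtype
  cases nonempty_fintype (ν ⁻¹' {q})
  have hm : ∏ y, k y ≠ 0 := Finset.prod_ne_zero_iff.2 fun y _ => (hψ y).ne_zero
  choose d hd using fun y => Finset.dvd_prod_of_mem k (Finset.mem_univ y)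
  have hd0 (y) : d y ≠ 0 := right_ne_zero_of_mul (hd y ▸ hm : k y * d y ≠ 0)
  choose hcont H hH hlog using fun j : Σ y : ν ⁻¹' {q}, Fin (k y) =>
    (hψ j.1).exists_comp_rootBranch_eq_logHarm (hr j.1) (hd0 j.1) j.2
  have : Nonempty (Σ y : ν ⁻¹' {q}, Fin (k y)) :=
    have ⟨y, hy⟩ := hν.surjective q
    ⟨⟨⟨y, hy⟩, ⟨0, Nat.pos_of_ne_zero (hψ ⟨y, hy⟩).ne_zero⟩⟩⟩
  have htrace : ∀ᶠ ξ in 𝓝 (0 : ℂ), tropicalTrace ν f (powChart q (∏ y, k y) ξ) =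
      ⨆ j : Σ y : ν ⁻¹' {q}, Fin (k y),
        f ((chartAt ℂ (j.1 : Y)).symm (ψ j.1 (rootBranch (k j.1) (d j.1) j.2 ξ))) :=
    (eventually_preimage_powChart_eq hν.proper.continuous hν.proper.isClosedMap
      (hν.finite_fiber q) hψ hm hd).mono fun ξ hξ => by rw [tropicalTrace, hξ, iSup_range]
  refine ⟨Σ y : ν ⁻¹' {q}, Fin (k y), inferInstance, this, ∏ y, k y, fun j => r j.1 * d j.1, H,
    ⟨hm, hH, ?_, ?_⟩, fun hq j => ?_, fun hq j => ?_⟩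
  · have hcomp := (continuousAt_iSup_of_finite hcont).congr (htrace.mono fun _ => Eq.symm)
    rw [ContinuousAt, powChart_zero q hm] at hcomp
    rwa [ContinuousAt, ← map_powChart q hm, tendsto_map'_iff]
  · filter_upwards [nhdsWithin_le_nhds htrace, eventually_all.2 hlog] with ξ hξ hlogξ
    rw [hξ, coe_maxLogHarm]
    exact iSup_congr hlogξ
  · dsimp only
    rw [(hr j.1).eq_zero_of_notMem_pol fun hmem => hq ⟨j.1, hmem, j.1.2⟩, zero_mul]
  · exact mul_nonneg ((hr j.1).nonneg_of_notMem_polNeg fun hmem => hq ⟨j.1, hmem, j.1.2⟩)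
      (Nat.cast_nonneg _)

end Covering

namespace IsLocalModel

section Manifold

variable {X J : Type*} [TopologicalSpace X] [ChartedSpace ℂ X]
  {g k : X → EReal} {q : X} {m : ℕ} {ρ : J → ℝ} {H : J → ℂ → ℝ}

lemma eventually_eq_toReal (M : IsLocalModel g q m ρ H) :
    ∀ᶠ x in 𝓝[≠] q, g x = (((g x).toReal : ℝ) : EReal) :=
  (eventually_nhdsNE_powChart_iff M.ne_zero).1
    (M.eventually_eq.mono fun ξ hξ => by rw [hξ, EReal.toReal_coe])

lemma continuousAt_powChart (M : IsLocalModel g q m ρ H) :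
    ContinuousAt (fun ξ => g (powChart q m ξ)) 0 := by
  rw [ContinuousAt, powChart_zero q M.ne_zero]
  exact M.continuousAt.tendsto.comp (map_powChart q M.ne_zero).le

lemma eventually_isHarmonicAt_powChart_iff [IsManifold 𝓘(ℂ) ω X] (M : IsLocalModel g q m ρ H) :
    ∀ᶠ ξ in 𝓝[≠] (0 : ℂ), (IsHarmonicAt g (powChart q m ξ) ↔ HarmonicAt (maxLogHarm ρ H) ξ) := by
  filter_upwards [eventually_nhdsNE_eventually_nhds_iff.2 M.eventually_eq,
    nhdsWithin_le_nhds (eventually_chartAt_powChart q M.ne_zero), self_mem_nhdsWithin]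
    with ξ heq ⟨hsource, hchart⟩ (hξ : ξ ≠ 0)
  have hd : deriv (fun ξ : ℂ => chartAt ℂ q q + ξ ^ m) ξ ≠ 0 := by
    simp [M.ne_zero, hξ]
  rw [isHarmonicAt_iff (IsManifold.chart_mem_maximalAtlas q) hsource, ← eHarmonicAt_coe_iff, hchart,
    ← eHarmonicAt_comp_iff (by fun_prop) hd]
  exact ⟨fun h => h.congr (heq.mono fun _ => Eq.symm), fun h => h.congr heq⟩

variable [Finite J] [Nonempty J]

lemma eventually_nhds_eq_maxLogHarm (M : IsLocalModel g q m ρ H) (hρ : ∀ j, ρ j = 0) :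
    ∀ᶠ ξ in 𝓝 (0 : ℂ), g (powChart q m ξ) = ((maxLogHarm ρ H ξ : ℝ) : EReal) :=
  (M.continuousAt_powChart.eventuallyEq_nhds_iff_eventuallyEq_nhdsNE
    (continuous_coe_real_ereal.continuousAt.comp
      (continuousAt_maxLogHarm (fun j => (M.harmonicAt j).1.continuousAt) hρ))).1 M.eventually_eq

lemma exists_eventually_eq_of_eventually_isHarmonicAt [IsManifold 𝓘(ℂ) ω X]
    (M : IsLocalModel g q m ρ H) (hρ : ∀ j, ρ j = 0)
    (hiso : ∀ᶠ x in 𝓝[≠] q, IsHarmonicAt g x) :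
    ∃ j, ∀ᶠ ξ in 𝓝 (0 : ℂ), g (powChart q m ξ) = ((H j ξ : ℝ) : EReal) := by
  have hharm : ∀ᶠ ξ in 𝓝[≠] (0 : ℂ), HarmonicAt (maxLogHarm ρ H) ξ := by
    filter_upwards [(eventually_nhdsNE_powChart_iff M.ne_zero).2 hiso,
      M.eventually_isHarmonicAt_powChart_iff] with ξ hξ hiff
    exact hiff.1 hξ
  obtain ⟨j, hj⟩ := exists_eventually_maxLogHarm_eq M.harmonicAt hharm
  refine ⟨j, (M.continuousAt_powChart.eventuallyEq_nhds_iff_eventuallyEq_nhdsNE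
    (continuous_coe_real_ereal.continuousAt.comp (M.harmonicAt j).1.continuousAt)).1 ?_⟩
  filter_upwards [M.eventually_eq, hj] with ξ hξ hjξ
  rw [hξ, hjξ, hρ j, logHarm_zero, Function.comp_apply]

lemma isHarmonicAt_of_eventually_isHarmonicAt [IsManifold 𝓘(ℂ) ω X] (M : IsLocalModel g q m ρ H)
    (hρ : ∀ j, ρ j = 0) (hiso : ∀ᶠ x in 𝓝[≠] q, IsHarmonicAt g x) : IsHarmonicAt g q := by
  obtain ⟨j, hj⟩ := M.exists_eventually_eq_of_eventually_isHarmonicAt hρ hiso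
  set e := chartAt ℂ q
  let G : ℂ → ℝ := fun z => (g (e.symm (e q + z))).toReal
  have hG : HarmonicAt G 0 := by
    refine harmonicAt_of_comp_pow M.ne_zero ((harmonicAt_congr_nhds ?_).2 (M.harmonicAt j))
    filter_upwards [hj] with ξ hξ
    exact congrArg EReal.toReal hξ
  refine ⟨fun w => G (w - e q), harmonicAt_comp_of_analyticAt (φ := fun w => w - e q)
    (by rwa [sub_self]) (analyticAt_id.sub analyticAt_const), ?_⟩
  have hreal : ∀ᶠ x in 𝓝 q, g x = (((g x).toReal : ℝ) : EReal) :=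
    (eventually_nhds_powChart_iff M.ne_zero).1 (hj.mono fun ξ hξ => by rw [hξ, EReal.toReal_coe])
  filter_upwards [hreal, chart_source_mem_nhds ℂ q] with x hx hsource
  simpa only [G, add_sub_cancel, e, (chartAt ℂ q).left_inv hsource] using hx

lemma exists_toReal_eq_add_log (M : IsLocalModel g q m ρ H) :
    ∃ (r : ℝ) (h : ℂ → ℝ), (∀ᶠ w in 𝓝 (chartAt ℂ q q), ContinuousAt h w) ∧
      ∀ w ≠ chartAt ℂ q q, (g ((chartAt ℂ q).symm w)).toReal =
        r * Real.log ‖w - chartAt ℂ q q‖ + h w := by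
  classical
  obtain ⟨r, h₀, hh₀, -, hmax⟩ := exists_eventually_maxLogHarm_eq_logHarm (ρ := ρ) fun j =>
    (M.harmonicAt j).eventually.mono fun ξ hξ => hξ.1.continuousAt
  set e := chartAt ℂ q
  let h : ℂ → ℝ := fun w => if w = e q then h₀ 0 else
    (g (e.symm w)).toReal - r / m * Real.log ‖w - e q‖
  have hm : (m : ℝ) ≠ 0 := Nat.cast_ne_zero.2 M.ne_zero
  have heq : ∀ᶠ ξ in 𝓝 (0 : ℂ), h (e q + ξ ^ m) = h₀ ξ := by
    filter_upwards [eventually_nhdsWithin_iff.1 (M.eventually_eq.and hmax)] with ξ hξ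
    rcases eq_or_ne ξ 0 with rfl | hne
    · simp only [h, zero_pow M.ne_zero, add_zero, if_true]
    · have hg : (g (e.symm (e q + ξ ^ m))).toReal = logHarm r h₀ ξ := by
        rw [← (hξ hne).2]
        exact congrArg EReal.toReal (hξ hne).1
      simp only [h, add_eq_left, pow_eq_zero_iff M.ne_zero, if_neg hne, hg, logHarm,
        add_sub_cancel_left, norm_pow, Real.log_pow]
      field_simp
      ring
  refine ⟨r / m, h, ?_, fun w hw => by simp only [h, if_neg hw, add_sub_cancel]⟩
  rw [← map_const_add_pow_zero (e q) M.ne_zero, eventually_map]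
  filter_upwards [eventually_eventually_nhds.2 heq, hh₀] with ξ hξ hcont
  rw [ContinuousAt, ← map_const_add_pow (e q) M.ne_zero, tendsto_map'_iff, hξ.self_of_nhds]
  exact hcont.tendsto.congr' (hξ.mono fun _ => Eq.symm)

lemma hasAtMostLogSingularityAt (M : IsLocalModel g q m ρ H) : HasAtMostLogSingularityAt g q := by
  obtain ⟨r, h, hh, heq⟩ := M.exists_toReal_eq_add_log
  refine ⟨r, h, hh, ?_, M.continuousAt⟩
  filter_upwards [M.eventually_eq_toReal, self_mem_nhdsWithin,
    nhdsWithin_le_nhds (chart_source_mem_nhds ℂ q)] with x hx hne hsource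
  rw [hx, ← heq _ fun h => hne ((chartAt ℂ q).injOn hsource (mem_chart_source ℂ q) h),
    (chartAt ℂ q).left_inv hsource]

lemma exists_tendsto_logHarm (M : IsLocalModel g q m ρ H) :
    ∃ (j : J) (h : ℂ → ℝ), ContinuousAt h 0 ∧ h 0 = H j 0 ∧
      Tendsto (fun ξ => ((logHarm (ρ j) h ξ : ℝ) : EReal)) (𝓝[≠] 0) (𝓝 (g q)) := by
  obtain ⟨_, h, hh, ⟨j, rfl, hj⟩, hmax⟩ := exists_eventually_maxLogHarm_eq_logHarm (ρ := ρ)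
    fun j => (M.harmonicAt j).eventually.mono fun ξ hξ => hξ.1.continuousAt
  refine ⟨j, h, hh.self_of_nhds, hj.symm, ?_⟩
  have hlim := M.continuousAt_powChart.tendsto.mono_left (nhdsWithin_le_nhds (s := {0}ᶜ))
  rw [powChart_zero q M.ne_zero] at hlim
  refine hlim.congr' ?_
  filter_upwards [M.eventually_eq, hmax] with ξ hξ hmaxξ
  rw [hξ, hmaxξ]

lemma lt_top_of_nonneg (M : IsLocalModel g q m ρ H) (hρ : ∀ j, 0 ≤ ρ j) : g q < ⊤ := by
  obtain ⟨j, h, hh, -, hlim⟩ := M.exists_tendsto_logHarm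
  refine lt_of_le_of_lt (le_of_tendsto_of_tendsto hlim ((continuous_coe_real_ereal.tendsto _).comp
    (hh.tendsto.mono_left nhdsWithin_le_nhds)) ?_) (EReal.coe_lt_top (h 0))
  filter_upwards [tendsto_log_norm.eventually_le_atBot 0] with ξ hξ
  exact EReal.coe_le_coe_iff.2 (add_le_of_nonpos_left (mul_nonpos_of_nonneg_of_nonpos (hρ j) hξ))

lemma exists_eventually_le_of_nonneg (M : IsLocalModel g q m ρ H) (hρ : ∀ j, 0 ≤ ρ j)
    (hq : g q ≠ ⊥) :
    ∃ j, g q = ((H j 0 : ℝ) : EReal) ∧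
      ∀ᶠ ξ in 𝓝 (0 : ℂ), ((H j ξ : ℝ) : EReal) ≤ g (powChart q m ξ) := by
  obtain ⟨j, h, hh, hj, hlim⟩ := M.exists_tendsto_logHarm
  have hh0 := hh.tendsto.mono_left (nhdsWithin_le_nhds (s := {0}ᶜ))
  have hr : ρ j = 0 := by
    refine ((hρ j).eq_or_lt.resolve_right fun hpos => hq ?_).symm
    exact tendsto_nhds_unique hlim <| EReal.tendsto_coe_atBot.comp <|
      (tendsto_log_norm.const_mul_atBot hpos).atBot_add hh0
  have hgq : g q = ((H j 0 : ℝ) : EReal) := by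
    rw [hr, logHarm_zero] at hlim
    rw [← hj]
    exact tendsto_nhds_unique hlim ((continuous_coe_real_ereal.tendsto _).comp hh0)
  refine ⟨j, hgq, ?_⟩
  filter_upwards [eventually_nhdsWithin_iff.1 M.eventually_eq] with ξ hξ
  rcases eq_or_ne ξ 0 with rfl | hne
  · rw [powChart_zero q M.ne_zero, hgq]
  · rw [hξ hne, EReal.coe_le_coe_iff]
    simpa only [hr, logHarm_zero] using logHarm_le_maxLogHarm ρ H ξ j

lemma eventually_eq_of_le (M : IsLocalModel g q m ρ H) (hρ : ∀ j, 0 ≤ ρ j)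
    (hk : IsHarmonicAt k q) (hle : ∀ᶠ x in 𝓝 q, g x ≤ k x) (heq : g q = k q) :
    ∀ᶠ x in 𝓝 q, g x = k x := by
  rw [isHarmonicAt_iff_chartAt] at hk
  obtain ⟨κ, hκ, hκk : ∀ᶠ ξ in 𝓝 0, k (powChart q m ξ) = κ ξ⟩ :=
    EHarmonicAt.comp (φ := fun ξ : ℂ => chartAt ℂ q q + ξ ^ m)
      (by rwa [zero_pow M.ne_zero, add_zero]) (analyticAt_const.add (analyticAt_id.pow m))
  have hgκ : g q = ((κ 0 : ℝ) : EReal) := by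
    rw [heq, ← hκk.self_of_nhds, powChart_zero q M.ne_zero]
  obtain ⟨j, hj, hjg⟩ := M.exists_eventually_le_of_nonneg hρ (hgκ ▸ EReal.coe_ne_bot _)
  have hj0 : H j 0 - κ 0 = 0 := sub_eq_zero.2 (EReal.coe_injective (hj.symm.trans hgκ))
  have hgk := (eventually_nhds_powChart_iff M.ne_zero).2 hle
  have hmax : IsLocalMax (H j - κ) 0 := by
    filter_upwards [hgk, hjg, hκk] with ξ hξ hjξ hκξ
    rw [hκξ] at hξ
    rw [Pi.sub_apply, Pi.sub_apply, hj0, sub_nonpos]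
    exact EReal.coe_le_coe_iff.1 (hjξ.trans hξ)
  refine (eventually_nhds_powChart_iff M.ne_zero).1 ?_
  filter_upwards [eventually_eq_of_isLocalMax_of_harmonicAt ((M.harmonicAt j).sub hκ) hmax, hgk,
    hjg, hκk] with ξ hξ hgξ hjξ hκξ
  rw [Pi.sub_apply, Pi.sub_apply, hj0, sub_eq_zero] at hξ
  exact hgξ.antisymm (hκξ.trans_le (hξ ▸ hjξ))

end Manifold

end IsLocalModel

/-! ### Curves which are locally finite unions of arcs -/

section ArcStar

variable {m : ℕ} {B : Finset (ℝ → ℝ)}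

/-- The union of finitely many arcs, completed by their common end point `0`. -/
def arcStar (m : ℕ) (B : Finset (ℝ → ℝ)) : Set ℂ :=
  ⋃ β ∈ B, insert 0 (arc m β)

lemma mem_arcStar {z : ℂ} : z ∈ arcStar m B ↔ ∃ β ∈ B, z = 0 ∨ z ∈ arc m β := by
  simp only [arcStar, mem_iUnion, mem_insert_iff, exists_prop]

lemma zero_mem_arcStar : 0 ∈ arcStar m B ↔ B.Nonempty := by
  simp only [mem_arcStar, true_or, and_true, Finset.Nonempty]

lemma mem_arcStar_of_ne_zero {z : ℂ} (hz : z ≠ 0) : z ∈ arcStar m B ↔ ∃ β ∈ B, z ∈ arc m β := by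
  simp only [mem_arcStar, hz, false_or]

lemma isSemianalyticAt_arcStar (hm : m ≠ 0) (hB : ∀ β ∈ B, AnalyticAt ℝ β 0) :
    IsSemianalyticAt (arcStar m B) 0 :=
  .biUnion B fun β hβ => (isSemianalyticAt_singleton 0).union (isSemianalyticAt_arc hm (hB β hβ))

lemma eventually_accPt_arc {β : ℝ → ℝ} (hm : m ≠ 0) (hβ : ∀ᶠ s in 𝓝 0, ContinuousAt β s) :
    ∀ᶠ z in 𝓝 (0 : ℂ), (z = 0 ∨ z ∈ arc m β) → AccPt z (𝓟 (arc m β)) := by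
  filter_upwards [eventually_nhdsWithin_iff.1
    ((tendsto_norm_rpow hm).eventually (nhdsWithin_le_nhds hβ))] with z hz
  rintro (rfl | hmem)
  · simpa only [arcPath_zero hm] using accPt_arcPath hm le_rfl hβ.self_of_nhds
  · exact accPt_of_mem_arc hm hmem (hz hmem.1)

lemma isPreconnected_arcStar_inter_ball {δ : ℝ} (hm : m ≠ 0) (hδ : 0 < δ)
    (hB : ∀ β ∈ B, ∀ s ∈ Ico 0 δ, ContinuousAt β s) :
    IsPreconnected (arcStar m B ∩ Metric.ball 0 (δ ^ m)) := by
  have h0 : (0 : ℂ) ∈ Metric.ball (0 : ℂ) (δ ^ m) := Metric.mem_ball_self (pow_pos hδ m)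
  simp only [arcStar, iUnion₂_inter, insert_inter_of_mem h0]
  rw [← Finset.set_biUnion_coe, biUnion_eq_iUnion]
  exact isPreconnected_iUnion ⟨0, mem_iInter.2 fun _ => mem_insert _ _⟩ fun β =>
    isPreconnected_insert_arc_inter_ball hm hδ (hB β β.2)

lemma exists_isPreconnected_arcStar_inter_ball {ε : ℝ} (hm : m ≠ 0)
    (hB : ∀ β ∈ B, AnalyticAt ℝ β 0) (hε : 0 < ε) :
    ∃ r, 0 < r ∧ r ≤ ε ∧ IsPreconnected (arcStar m B ∩ Metric.ball 0 r) := by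
  have hcont : ∀ᶠ s in 𝓝 (0 : ℝ), ∀ β ∈ B, ContinuousAt β s :=
    (eventually_all_finset B).2 fun β hβ =>
      (hB β hβ).eventually_analyticAt.mono fun s hs => hs.continuousAt
  have hpow : ∀ᶠ s in 𝓝 (0 : ℝ), s ^ m < ε :=
    (continuous_pow m).continuousAt.eventually_lt continuousAt_const (by rwa [zero_pow hm])
  obtain ⟨δ, hδ, hδB⟩ := Metric.eventually_nhds_iff_ball.1 hcont
  have hsmall : ∀ᶠ s in 𝓝[>] (0 : ℝ), s ^ m < ε ∧ s < δ :=
    nhdsWithin_le_nhds (hpow.and (Iio_mem_nhds hδ))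
  obtain ⟨s, ⟨hsε, hsδ⟩, hs⟩ := (hsmall.and self_mem_nhdsWithin).exists
  refine ⟨s ^ m, pow_pos hs m, hsε.le, isPreconnected_arcStar_inter_ball hm hs fun β hβ t ht => ?_⟩
  refine hδB t ?_ β hβ
  rw [mem_ball_zero_iff, Real.norm_of_nonneg ht.1]
  exact ht.2.trans hsδ

end ArcStar

lemma accPt_mono_of_eventually {Z : Type*} [TopologicalSpace Z] {z : Z} {A A' : Set Z}
    (h : AccPt z (𝓟 A))
    (hA : ∀ᶠ w in 𝓝[≠] z, w ∈ A → w ∈ A') : AccPt z (𝓟 A') := by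
  rw [accPt_iff_frequently_nhdsNE] at h ⊢
  exact h.mp hA

section Curve

variable {X : Type*} [TopologicalSpace X] [ChartedSpace ℂ X]

lemma eventually_add_mem_target {q : X} {z : ℂ}
    (hz : chartAt ℂ q q + z ∈ (chartAt ℂ q).target) :
    ∀ᶠ w in 𝓝 z, chartAt ℂ q q + w ∈ (chartAt ℂ q).target :=
  (continuous_const_add (chartAt ℂ q q)).continuousAt.eventually_mem
    ((chartAt ℂ q).open_target.mem_nhds hz)

lemma eventually_nhds_zero_add_mem_target (q : X) :
    ∀ᶠ z in 𝓝 (0 : ℂ), chartAt ℂ q q + z ∈ (chartAt ℂ q).target :=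
  eventually_add_mem_target (by rw [add_zero]; exact mem_chart_target ℂ q)

lemma map_centredChart {q : X} {z : ℂ} (hz : chartAt ℂ q q + z ∈ (chartAt ℂ q).target) :
    map (centredChart q) (𝓝 z) = 𝓝 (centredChart q z) := by
  rw [centredChart, ← (chartAt ℂ q).symm.map_nhds_eq hz,
    ← (isOpenMap_add_left _).map_nhds_eq (continuous_const_add _).continuousAt, Filter.map_map]
  rfl

lemma map_centredChart_zero (q : X) : map (centredChart q) (𝓝 0) = 𝓝 q := by
  rw [map_centredChart (eventually_nhds_zero_add_mem_target q).self_of_nhds, centredChart_zero]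

lemma injOn_centredChart (q : X) :
    InjOn (centredChart q) {z | chartAt ℂ q q + z ∈ (chartAt ℂ q).target} :=
  fun _ hz _ hw h => add_left_cancel ((chartAt ℂ q).symm.injOn hz hw h)

lemma continuousOn_centredChart (q : X) :
    ContinuousOn (centredChart q) {z | chartAt ℂ q q + z ∈ (chartAt ℂ q).target} :=
  (chartAt ℂ q).continuousOn_symm.comp (by fun_prop) fun _ hz => hz

lemma accPt_centredChart_iff {q : X} {z : ℂ} (hz : chartAt ℂ q q + z ∈ (chartAt ℂ q).target)
    {T : Set X} : AccPt (centredChart q z) (𝓟 T) ↔ AccPt z (𝓟 (centredChart q ⁻¹' T)) := by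
  rw [accPt_iff_frequently, accPt_iff_frequently, ← map_centredChart hz, frequently_map]
  refine frequently_congr ((eventually_add_mem_target hz).mono fun w hw => ?_)
  rw [mem_preimage, (injOn_centredChart q).ne_iff hw hz]

lemma isSemianalytic_iff {S : Set X} : IsSemianalytic S ↔
    ∀ q : X, IsSemianalyticAt ((chartAt ℂ q).symm ⁻¹' S) (chartAt ℂ q q) := by
  refine forall_congr' fun q => ⟨?_, ?_⟩
  · rintro ⟨V, hV, hqV, -, n, m, F, G, hF, hG, hS⟩
    exact ⟨Fin n, Fin m, inferInstance, inferInstance, F, G, fun i => hF i _ hqV,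
      fun i j => hG i j _ hqV, Filter.mem_of_superset (hV.mem_nhds hqV) hS⟩
  · rintro ⟨ι, κ, _, _, F, G, hF, hG, hS⟩
    obtain ⟨n, ⟨eι⟩⟩ := Finite.exists_equiv_fin ι
    obtain ⟨m, ⟨eκ⟩⟩ := Finite.exists_equiv_fin κ
    have hF' : ∀ᶠ w in 𝓝 (chartAt ℂ q q), ∀ i, AnalyticAt ℝ (F i) w :=
      eventually_all.2 fun i => (hF i).eventually_analyticAt
    have hG' : ∀ᶠ w in 𝓝 (chartAt ℂ q q), ∀ i j, AnalyticAt ℝ (G i j) w :=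
      eventually_all.2 fun i => eventually_all.2 fun j => (hG i j).eventually_analyticAt
    obtain ⟨V, hVsub, hV, hqV⟩ := mem_nhds_iff.1 (hF'.and (hG'.and
      (((chartAt ℂ q).open_target.eventually_mem (mem_chart_target ℂ q)).and hS)))
    refine ⟨V, hV, hqV, fun w hw => (hVsub hw).2.2.1, n, m, fun i => F (eι.symm i),
      fun i j => G (eι.symm i) (eκ.symm j), fun i w hw => (hVsub hw).1 _,
      fun i j w hw => (hVsub hw).2.1 _ _, fun w hw => ?_⟩
    refine (hVsub hw).2.2.2.trans ?_
    rw [← eι.symm.exists_congr_right]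
    exact exists_congr fun i => and_congr_right fun _ => eκ.symm.forall_congr_right.symm

/-- `T` is near `q`, except perhaps for `q` itself, the union of the arcs `arc m β` with `β ∈ B`
in the centred coordinate at `q`. -/
structure HasArcsAt (T : Set X) (q : X) (m : ℕ) (B : Finset (ℝ → ℝ)) : Prop where
  ne_zero : m ≠ 0
  analyticAt : ∀ β ∈ B, AnalyticAt ℝ β 0
  eventually_mem_iff : ∀ᶠ z in 𝓝[≠] (0 : ℂ), (centredChart q z ∈ T ↔ ∃ β ∈ B, z ∈ arc m β)

lemma IsLocalModel.exists_hasArcsAt {J : Type*} [Finite J] [Nonempty J] [IsManifold 𝓘(ℂ) ω X]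
    {g : X → EReal} {q : X} {m : ℕ} {ρ : J → ℝ} {H : J → ℂ → ℝ} (M : IsLocalModel g q m ρ H) :
    ∃ B, HasArcsAt {x | ¬ IsHarmonicAt g x} q m B := by
  obtain ⟨A, hA, hAev⟩ := exists_arcs_maxLogHarm (ρ := ρ) M.harmonicAt
  obtain ⟨B, hB, hBev⟩ := exists_arcs_of_comp_pow M.ne_zero (A := A)
    (T := centredChart q ⁻¹' {x | ¬ IsHarmonicAt g x}) hA <| by
      filter_upwards [hAev, M.eventually_isHarmonicAt_powChart_iff] with ξ hξ hiff
      rw [← hξ, ← hiff]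
      rfl
  exact ⟨B, M.ne_zero, hB, hBev⟩

namespace HasArcsAt

variable {T : Set X} {q : X} {m : ℕ} {B : Finset (ℝ → ℝ)}

lemma eventually_eventually_mem_iff (h : HasArcsAt T q m B) :
    ∀ᶠ z in 𝓝 (0 : ℂ), ∀ᶠ w in 𝓝[≠] z, (centredChart q w ∈ T ↔ ∃ β ∈ B, w ∈ arc m β) := by
  filter_upwards [eventually_nhdsWithin_iff.1
    (eventually_nhdsNE_eventually_nhds_iff.2 h.eventually_mem_iff)] with z hz
  rcases eq_or_ne z 0 with rfl | h0
  exacts [h.eventually_mem_iff, nhdsWithin_le_nhds (hz h0)]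

lemma eventually_accPt (h : HasArcsAt T q m B) :
    ∀ᶠ z in 𝓝 (0 : ℂ), z ∈ arcStar m B → AccPt z (𝓟 (centredChart q ⁻¹' T)) := by
  have hacc : ∀ᶠ z in 𝓝 (0 : ℂ), ∀ β ∈ B, (z = 0 ∨ z ∈ arc m β) → AccPt z (𝓟 (arc m β)) :=
    (eventually_all_finset B).2 fun β hβ => eventually_accPt_arc h.ne_zero <|
      (h.analyticAt β hβ).eventually_analyticAt.mono fun s hs => hs.continuousAt
  filter_upwards [hacc, h.eventually_eventually_mem_iff] with z hz hzT hmem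
  obtain ⟨β, hβ, hzβ⟩ := mem_arcStar.1 hmem
  exact accPt_mono_of_eventually (hz β hβ hzβ) (hzT.mono fun w hw hwβ => hw.2 ⟨β, hβ, hwβ⟩)

lemma eventually_mem_derivedSet_iff (hT : IsClosed T) (h : HasArcsAt T q m B) :
    ∀ᶠ z in 𝓝 (0 : ℂ), (centredChart q z ∈ derivedSet T ↔ z ∈ arcStar m B) := by
  filter_upwards [h.eventually_accPt, h.eventually_eventually_mem_iff,
    eventually_nhds_zero_add_mem_target q, eventually_nhdsWithin_iff.1 h.eventually_mem_iff]
    with z hacc hnear htarget hz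
  rw [mem_derivedSet]
  refine ⟨fun hzT => ?_, fun hmem => (accPt_centredChart_iff htarget).2 (hacc hmem)⟩
  rcases eq_or_ne z 0 with rfl | h0
  · rw [accPt_centredChart_iff htarget, accPt_iff_frequently_nhdsNE] at hzT
    obtain ⟨w, hwT, hw⟩ := (hzT.and_eventually hnear).exists
    obtain ⟨β, hβ, -⟩ := hw.1 hwT
    exact zero_mem_arcStar.2 ⟨β, hβ⟩
  · exact (mem_arcStar_of_ne_zero h0).2
      ((hz h0).1 (hT.closure_subset (derivedSet_subset_closure T hzT)))

lemma mem_derivedSet_iff (hT : IsClosed T) (h : HasArcsAt T q m B) :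
    q ∈ derivedSet T ↔ B.Nonempty := by
  simpa only [centredChart_zero, zero_mem_arcStar] using
    (h.eventually_mem_derivedSet_iff hT).self_of_nhds

lemma isSemianalyticAt_derivedSet (hT : IsClosed T) (h : HasArcsAt T q m B) :
    IsSemianalyticAt ((chartAt ℂ q).symm ⁻¹' derivedSet T) (chartAt ℂ q q) := by
  have hstar : IsSemianalyticAt (arcStar m B) (chartAt ℂ q q - chartAt ℂ q q) := by
    simpa only [sub_self] using isSemianalyticAt_arcStar h.ne_zero h.analyticAt
  refine (hstar.preimage (φ := fun w => w - chartAt ℂ q q) (by fun_prop)).congr ?_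
  have htend : Tendsto (fun w => w - chartAt ℂ q q) (𝓝 (chartAt ℂ q q)) (𝓝 0) :=
    Continuous.tendsto' (by fun_prop) _ _ (sub_self _)
  filter_upwards [htend.eventually (h.eventually_mem_derivedSet_iff hT)] with w hw
  rw [mem_preimage, mem_preimage, ← hw, centredChart, add_sub_cancel]

lemma accPt_derivedSet (hT : IsClosed T) (h : HasArcsAt T q m B) (hq : q ∈ derivedSet T) :
    AccPt q (𝓟 (derivedSet T)) := by
  have hev := h.eventually_mem_derivedSet_iff hT
  obtain ⟨β, hβ⟩ := (h.mem_derivedSet_iff hT).1 hq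
  have hacc := (eventually_accPt_arc h.ne_zero
    ((h.analyticAt β hβ).eventually_analyticAt.mono fun s hs => hs.continuousAt)).self_of_nhds
      (Or.inl rfl)
  rw [← centredChart_zero q,
    accPt_centredChart_iff (eventually_nhds_zero_add_mem_target q).self_of_nhds]
  exact accPt_mono_of_eventually hacc (nhdsWithin_le_nhds
    (hev.mono fun w hw hwβ => hw.2 (mem_arcStar.2 ⟨β, hβ, Or.inr hwβ⟩)))

lemma notMem_interior_derivedSet (hT : IsClosed T) (h : HasArcsAt T q m B) :
    q ∉ interior (derivedSet T) := by
  rw [mem_interior_iff_mem_nhds, ← map_centredChart_zero q]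
  refine fun hq => not_eventually_mem_arc m B ?_
  filter_upwards [nhdsWithin_le_nhds (h.eventually_mem_derivedSet_iff hT), nhdsWithin_le_nhds hq,
    self_mem_nhdsWithin] with z hz hmem h0
  exact (mem_arcStar_of_ne_zero h0).1 (hz.1 hmem)

lemma eventually_mem_connectedComponentIn (hT : IsClosed T) (h : HasArcsAt T q m B) :
    ∀ᶠ x in 𝓝 q, x ∈ derivedSet T → x ∈ connectedComponentIn (derivedSet T) q := by
  obtain ⟨ε, hε, hball⟩ := Metric.eventually_nhds_iff_ball.1
    ((h.eventually_mem_derivedSet_iff hT).and (eventually_nhds_zero_add_mem_target q))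
  obtain ⟨r, hr, hrε, hconn⟩ := exists_isPreconnected_arcStar_inter_ball h.ne_zero h.analyticAt hε
  have hsub := Metric.ball_subset_ball (x := (0 : ℂ)) hrε
  have himage := hconn.image (centredChart q)
    ((continuousOn_centredChart q).mono fun z hz => (hball z (hsub hz.2)).2)
  rw [← map_centredChart_zero q, eventually_map]
  filter_upwards [Metric.ball_mem_nhds (0 : ℂ) hr] with z hz hzT
  have hmem := (hball z (hsub hz)).1.1 hzT
  obtain ⟨β, hβ, -⟩ := mem_arcStar.1 hmem
  refine himage.subset_connectedComponentIn
    ⟨0, ⟨zero_mem_arcStar.2 ⟨β, hβ⟩, Metric.mem_ball_self hr⟩, centredChart_zero q⟩ ?_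
    ⟨z, ⟨hmem, hz⟩, rfl⟩
  rintro _ ⟨w, hw, rfl⟩
  exact (hball w (hsub hw.2)).1.2 hw.1

end HasArcsAt

lemma isSemianalyticCurve_derivedSet {T : Set X} (hT : IsClosed T)
    (harcs : ∀ q, ∃ m B, HasArcsAt T q m B) : IsSemianalyticCurve (derivedSet T) := by
  have := ChartedSpace.t1Space ℂ X
  choose m B h using harcs
  exact ⟨isSemianalytic_iff.2 fun q => (h q).isSemianalyticAt_derivedSet hT,
    ⟨isClosed_derivedSet T, fun q hq => (h q).accPt_derivedSet hT hq⟩,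
    eq_empty_of_forall_notMem fun q => (h q).notMem_interior_derivedSet hT⟩

end Curve

section Components

variable {X : Type*} [TopologicalSpace X] {S : Set X}

lemma eventually_mem_connectedComponentIn_iff_or_eventually_notMem (hS : IsClosed S)
    (hcomp : ∀ q ∈ S, ∀ᶠ x in 𝓝 q, x ∈ S → x ∈ connectedComponentIn S q) (x q : X) :
    (∀ᶠ y in 𝓝 q, (y ∈ connectedComponentIn S x ↔ y ∈ S)) ∨
      ∀ᶠ y in 𝓝 q, y ∉ connectedComponentIn S x := by
  by_cases hqS : q ∈ S
  · by_cases hq : q ∈ connectedComponentIn S x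
    · refine Or.inl ((hcomp q hqS).mono fun y hy => ?_)
      rw [connectedComponentIn_eq hq]
      exact ⟨fun h => connectedComponentIn_subset _ _ h, hy⟩
    · refine Or.inr ((hcomp q hqS).mono fun y hy hyx => hq ?_)
      rw [connectedComponentIn_eq hyx,
        ← connectedComponentIn_eq (hy (connectedComponentIn_subset _ _ hyx))]
      exact mem_connectedComponentIn hqS
  · refine Or.inr ((hS.isOpen_compl.eventually_mem hqS).mono fun y hy h => hy ?_)
    exact connectedComponentIn_subset _ _ h

lemma isClosed_connectedComponentIn_of_eventually (hS : IsClosed S)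
    (hcomp : ∀ q ∈ S, ∀ᶠ x in 𝓝 q, x ∈ S → x ∈ connectedComponentIn S q) (x : X) :
    IsClosed (connectedComponentIn S x) := by
  refine isOpen_compl_iff.1 (isOpen_iff_mem_nhds.2 fun q hq => ?_)
  rcases eventually_mem_connectedComponentIn_iff_or_eventually_notMem hS hcomp x q with h | h
  · have hqS : q ∉ S := fun hqS => hq (h.self_of_nhds.2 hqS)
    filter_upwards [h, hS.isOpen_compl.eventually_mem hqS] with y hy hyS hyx
    exact hyS (hy.1 hyx)
  · exact h

lemma locallyFinite_connectedComponentIn (hS : IsClosed S)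
    (hcomp : ∀ q ∈ S, ∀ᶠ x in 𝓝 q, x ∈ S → x ∈ connectedComponentIn S q) :
    LocallyFinite fun C : {C | ∃ x ∈ S, C = connectedComponentIn S x} => (C : Set X) := by
  intro q
  by_cases hq : q ∈ S
  · have heq : ∀ C ∈ {C | ∃ x ∈ S, C = connectedComponentIn S x},
        (C ∩ {x | x ∈ S → x ∈ connectedComponentIn S q}).Nonempty →
        C = connectedComponentIn S q := by
      rintro _ ⟨x, -, rfl⟩ ⟨y, hy, hyq⟩
      rw [connectedComponentIn_eq hy, ← connectedComponentIn_eq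
        (hyq (connectedComponentIn_subset _ _ hy))]
    refine ⟨_, hcomp q hq, Set.Subsingleton.finite fun C hC D hD => Subtype.ext ?_⟩
    exact (heq C C.2 hC).trans (heq D D.2 hD).symm
  · refine ⟨_, hS.isOpen_compl.mem_nhds hq, Set.Subsingleton.finite ?_⟩
    rintro ⟨_, x, _, rfl⟩ ⟨y, hy, hyS⟩
    exact absurd (connectedComponentIn_subset _ _ hy) hyS

lemma finite_setOf_connectedComponentIn_of_inter_subset {U N : Set X} {𝓑 : Set (Set X)}
    (hfin : 𝓑.Finite) (hpre : ∀ D ∈ 𝓑, IsPreconnected D) (hU : ∀ D ∈ 𝓑, D ⊆ U)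
    (hN : U ∩ N ⊆ ⋃₀ 𝓑) :
    {C | (∃ y ∈ U, C = connectedComponentIn U y) ∧ (C ∩ N).Nonempty}.Finite := by
  refine (hfin.image fun D => ⋃ z ∈ D, connectedComponentIn U z).subset ?_
  rintro _ ⟨⟨y, -, rfl⟩, x, hx, hxN⟩
  obtain ⟨D, hD, hxD⟩ := hN ⟨connectedComponentIn_subset _ _ hx, hxN⟩
  refine ⟨D, hD, ?_⟩
  have heq : ∀ z ∈ D, connectedComponentIn U z = connectedComponentIn U y := fun z hz => by
    rw [connectedComponentIn_eq hx, connectedComponentIn_eq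
      ((hpre D hD).subset_connectedComponentIn hxD (hU D hD) hz)]
  exact (iUnion₂_congr heq).trans (biUnion_const ⟨x, hxD⟩ _)

variable [ChartedSpace ℂ X]

lemma tendsto_chartAt_symm (q : X) : Tendsto (chartAt ℂ q).symm (𝓝 (chartAt ℂ q q)) (𝓝 q) :=
  (chartAt ℂ q).tendsto_symm (mem_chart_source ℂ q)

lemma isSemianalyticCurve_connectedComponentIn (hS : IsSemianalyticCurve S)
    (hcomp : ∀ q ∈ S, ∀ᶠ x in 𝓝 q, x ∈ S → x ∈ connectedComponentIn S q) (x : X) :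
    IsSemianalyticCurve (connectedComponentIn S x) := by
  have hor := eventually_mem_connectedComponentIn_iff_or_eventually_notMem
    hS.perfect.closed hcomp x
  refine ⟨isSemianalytic_iff.2 fun q => ?_,
    ⟨isClosed_connectedComponentIn_of_eventually hS.perfect.closed hcomp x, fun q hq => ?_⟩,
    subset_empty_iff.1 (hS.interior_eq_empty ▸ interior_mono (connectedComponentIn_subset S x))⟩
  · rcases hor q with h | h
    · exact (isSemianalytic_iff.1 hS.semianalytic q).congr
        ((tendsto_chartAt_symm q).eventually h)
    · exact (isSemianalyticAt_empty _).congr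
        (((tendsto_chartAt_symm q).eventually h).mono fun w hw => iff_of_false hw (notMem_empty w))
  · rcases hor q with h | h
    · exact accPt_mono_of_eventually (hS.perfect.acc q (connectedComponentIn_subset _ _ hq))
        (nhdsWithin_le_nhds (h.mono fun _ hy => hy.2))
    · exact absurd hq h.self_of_nhds

lemma IsSemianalyticCurve.exists_locallyFinite_connected (hS : IsSemianalyticCurve S)
    (hcomp : ∀ q ∈ S, ∀ᶠ x in 𝓝 q, x ∈ S → x ∈ connectedComponentIn S q) :
    ∃ 𝒞 : Set (Set X), (∀ C ∈ 𝒞, IsSemianalyticCurve C ∧ IsConnected C) ∧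
      LocallyFinite (fun C : 𝒞 => (C : Set X)) ∧ ⋃₀ 𝒞 = S ∧ (CompactSpace X → 𝒞.Finite) := by
  have hlf := locallyFinite_connectedComponentIn hS.perfect.closed hcomp
  refine ⟨_, ?_, hlf, Subset.antisymm (sUnion_subset ?_) fun x hx =>
    ⟨_, ⟨x, hx, rfl⟩, mem_connectedComponentIn hx⟩, fun _ => finite_coe_iff.1 <|
      finite_univ_iff.1 <| hlf.finite_of_compact ?_⟩
  · rintro _ ⟨x, hx, rfl⟩
    exact ⟨isSemianalyticCurve_connectedComponentIn hS hcomp x,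
      isConnected_connectedComponentIn_iff.2 hx⟩
  · rintro _ ⟨x, -, rfl⟩
    exact connectedComponentIn_subset S x
  · rintro ⟨_, x, hx, rfl⟩
    exact ⟨x, mem_connectedComponentIn hx⟩

namespace HasArcsAt

variable {T W : Set X} {q : X} {m : ℕ} {B : Finset (ℝ → ℝ)}

lemma exists_image_ball_diff_derivedSet_eq (hT : IsClosed T) (h : HasArcsAt T q m B)
    (hW : W ∈ 𝓝 q) : ∃ N ∈ 𝓝 q, ∃ 𝓑 : Set (Set X), 𝓑.Finite ∧
      (∀ D ∈ 𝓑, IsPreconnected D ∧ D ⊆ W \ derivedSet T) ∧ (N \ derivedSet T) \ {q} ⊆ ⋃₀ 𝓑 := by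
  rw [← map_centredChart_zero q] at hW
  obtain ⟨ε, hε, hball⟩ := Metric.eventually_nhds_iff_ball.1
    ((h.eventually_mem_derivedSet_iff hT).and
      ((eventually_nhds_zero_add_mem_target q).and (mem_map.1 hW)))
  have hpow : ∀ᶠ δ in 𝓝[>] (0 : ℝ), δ ^ m < ε := nhdsWithin_le_nhds <|
    (continuous_pow m).continuousAt.eventually_lt continuousAt_const (by rwa [zero_pow h.ne_zero])
  obtain ⟨δ, ⟨hδε, 𝓑, hfin, hpre, hcov⟩, hδ⟩ := ((hpow.and
    (exists_finite_isPreconnected_sUnion_eq_ball_diff_arcs h.ne_zero h.analyticAt)).and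
      self_mem_nhdsWithin).exists
  have hsub : Metric.ball (0 : ℂ) (δ ^ m) ⊆ Metric.ball 0 ε := Metric.ball_subset_ball hδε.le
  refine ⟨centredChart q '' Metric.ball 0 (δ ^ m), ?_, image (centredChart q) '' 𝓑,
    hfin.image _, ?_, ?_⟩
  · rw [← map_centredChart_zero q]
    exact image_mem_map (Metric.ball_mem_nhds 0 (pow_pos hδ m))
  · rintro _ ⟨D, hD, rfl⟩
    have hDsub : ∀ z ∈ D, z ∈ Metric.ball (0 : ℂ) (δ ^ m) ∧ z ≠ 0 ∧ ∀ β ∈ B, z ∉ arc m β :=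
      fun z hz => (Set.ext_iff.1 hcov z).1 ⟨D, hD, hz⟩
    refine ⟨(hpre D hD).image _ ((continuousOn_centredChart q).mono fun z hz =>
      (hball z (hsub (hDsub z hz).1)).2.1), ?_⟩
    rintro _ ⟨z, hz, rfl⟩
    obtain ⟨hzδ, h0, hzB⟩ := hDsub z hz
    obtain ⟨hmem, -, hzW⟩ := hball z (hsub hzδ)
    refine ⟨hzW, fun hzT => ?_⟩
    obtain ⟨β, hβ, hzβ⟩ := (mem_arcStar_of_ne_zero h0).1 (hmem.1 hzT)
    exact hzB β hβ hzβ
  · rintro _ ⟨⟨⟨z, hz, rfl⟩, hzT⟩, hzq⟩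
    have h0 : z ≠ 0 := by
      rintro rfl
      exact hzq (centredChart_zero q)
    obtain ⟨D, hD, hzD⟩ := (Set.ext_iff.1 hcov z).2 ⟨hz, h0, fun β hβ hzβ =>
      hzT ((hball z (hsub hz)).1.2 ((mem_arcStar_of_ne_zero h0).2 ⟨β, hβ, hzβ⟩))⟩
    exact ⟨_, mem_image_of_mem _ hD, z, hzD, rfl⟩

lemma finite_setOf_connectedComponentIn_diff_derivedSet (hT : IsClosed T)
    (h : HasArcsAt T q m B) (hW : W ∈ 𝓝 q) : ∃ N ∈ 𝓝 q,
      {C | (∃ y ∈ W \ derivedSet T, C = connectedComponentIn (W \ derivedSet T) y) ∧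
        (C ∩ N).Nonempty}.Finite := by
  obtain ⟨N, hN, 𝓑, hfin, h𝓑, hcov⟩ := h.exists_image_ball_diff_derivedSet_eq hT hW
  refine ⟨N, hN, finite_setOf_connectedComponentIn_of_inter_subset
    (hfin.insert ({q} ∩ (W \ derivedSet T))) (forall_mem_insert.2 ⟨?_, fun D hD => (h𝓑 D hD).1⟩)
    (forall_mem_insert.2 ⟨inter_subset_right, fun D hD => (h𝓑 D hD).2⟩) ?_⟩
  · exact (subsingleton_singleton.anti inter_subset_left).isPreconnected
  · rintro x ⟨hxU, hxN⟩
    rw [sUnion_insert]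
    by_cases hxq : x ∈ ({q} : Set X)
    exacts [Or.inl ⟨hxq, hxU⟩, Or.inr (hcov ⟨⟨hxN, hxU.2⟩, hxq⟩)]

end HasArcsAt

end Components

/-! ### The distributional Laplacian -/

section Laplacian

open Laplacian

lemma exists_contDiff_hasCompactSupport_eqOn_ball {E F : Type*} [NormedAddCommGroup E]
    [NormedSpace ℝ E] [FiniteDimensional ℝ E] [NormedAddCommGroup F] [NormedSpace ℝ F]
    {n : ℕ∞} {h : E → F} {c : E} (hh : ∀ᶠ x in 𝓝 c, ContDiffAt ℝ n h x) :
    ∃ r > 0, ∃ φ : E → F, ContDiff ℝ n φ ∧ HasCompactSupport φ ∧ EqOn φ h (Metric.ball c r) := by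
  obtain ⟨r, hr, hball⟩ := Metric.eventually_nhds_iff_ball.1 hh
  let χ : ContDiffBump c := ⟨r / 3, r / 2, by positivity, by linarith⟩
  refine ⟨r / 3, by positivity, fun x => χ x • h x, contDiff_iff_contDiffAt.2 fun x => ?_,
    χ.hasCompactSupport.smul_right, fun x hx => ?_⟩
  · by_cases hx : x ∈ tsupport (fun x => χ x • h x)
    · have hxr : x ∈ Metric.closedBall c (r / 2) := χ.tsupport_eq ▸ tsupport_smul_subset_left _ _ hx
      exact χ.contDiff.contDiffAt.smul
        (hball x (Metric.closedBall_subset_ball (half_lt_self hr) hxr))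
    · exact contDiffAt_const.congr_of_eventuallyEq (notMem_tsupport_iff_eventuallyEq.1 hx)
  · simp only [χ.one_of_mem_closedBall (Metric.ball_subset_closedBall hx), one_smul]

section

variable {E : Type*} [NormedAddCommGroup E] [InnerProductSpace ℝ E] [FiniteDimensional ℝ E]

lemma laplacian_eq_zero_of_notMem_tsupport {F : Type*} [NormedAddCommGroup F] [NormedSpace ℝ F]
    {ψ : E → F} {x : E} (hx : x ∉ tsupport ψ) : Δ ψ x = 0 := by
  rw [(laplacian_congr_nhds (notMem_tsupport_iff_eventuallyEq.1 hx)).self_of_nhds]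
  exact congr_fun (laplacian_const (c := (0 : F))) x

variable [MeasurableSpace E] [BorelSpace E]

lemma integral_mul_laplacian_eq_zero_of_eqOn {h φ ψ : E → ℝ} (hφ : ContDiff ℝ ∞ φ)
    (hφc : HasCompactSupport φ) (hψ : ContDiff ℝ ∞ ψ) (hψc : HasCompactSupport ψ)
    (hh : EqOn φ h (tsupport ψ)) (hΔ : ∀ x ∈ tsupport ψ, Δ φ x = 0) :
    ∫ x, h x * Δ ψ x = 0 := by
  have hl : ∀ x, h x * Δ ψ x = φ x * Δ ψ x := fun x => by
    by_cases hx : x ∈ tsupport ψ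
    · rw [hh hx]
    · rw [laplacian_eq_zero_of_notMem_tsupport hx, mul_zero, mul_zero]
  have hr : ∀ x, Δ φ x * ψ x = 0 := fun x => by
    by_cases hx : x ∈ tsupport ψ
    · rw [hΔ x hx, zero_mul]
    · rw [image_eq_zero_of_notMem_tsupport hx, mul_zero]
  have hparts := SchwartzMap.integral_mul_laplacian_right_eq_left (μ := (volume : Measure E))
    (hφc.toSchwartzMap hφ) (hψc.toSchwartzMap hψ)
  simp only [SchwartzMap.laplacian_apply] at hparts
  calc ∫ x, h x * Δ ψ x = ∫ x, φ x * Δ ψ x := integral_congr_ae (.of_forall hl)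
    _ = ∫ x, Δ φ x * ψ x := hparts
    _ = 0 := by simp only [hr, integral_zero]

lemma exists_integral_mul_laplacian_eq_zero {h : E → ℝ} {c : E} (hh : HarmonicAt h c)
    (hsmooth : ∀ᶠ x in 𝓝 c, ContDiffAt ℝ ∞ h x) :
    ∃ r > 0, ∀ ψ : E → ℝ, ContDiff ℝ ∞ ψ → HasCompactSupport ψ → tsupport ψ ⊆ Metric.ball c r →
      ∫ x, h x * Δ ψ x = 0 := by
  obtain ⟨r₁, hr₁, φ, hφ, hφc, hφh⟩ := exists_contDiff_hasCompactSupport_eqOn_ball hsmooth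
  obtain ⟨r₂, hr₂, hΔ⟩ := Metric.eventually_nhds_iff_ball.1 hh.2
  refine ⟨min r₁ r₂, lt_min hr₁ hr₂, fun ψ hψ hψc hψs => ?_⟩
  have hsub₁ := hψs.trans (Metric.ball_subset_ball (min_le_left r₁ r₂))
  have hsub₂ := hψs.trans (Metric.ball_subset_ball (min_le_right r₁ r₂))
  refine integral_mul_laplacian_eq_zero_of_eqOn hφ hφc hψ hψc (hφh.mono hsub₁) fun x hx => ?_
  have heq : φ =ᶠ[𝓝 x] h := hφh.eventuallyEq_of_mem (Metric.isOpen_ball.mem_nhds (hsub₁ hx))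
  rw [(laplacian_congr_nhds heq).self_of_nhds, hΔ x (hsub₂ hx), Pi.zero_apply]

end

lemma notMem_laplacianSupport {X : Type*} [TopologicalSpace X] [ChartedSpace ℂ X]
    {g : X → EReal} {x : X} (h : IsHarmonicAt g x) : x ∉ laplacianSupport g := by
  obtain ⟨u, hu, hev⟩ := isHarmonicAt_iff_chartAt.1 h
  obtain ⟨r, hr, hint⟩ := exists_integral_mul_laplacian_eq_zero hu
    ((HarmonicAt.analyticAt hu).eventually_analyticAt.mono fun w hw => hw.contDiffAt)
  obtain ⟨V, hVsub, hV, hxV⟩ := mem_nhds_iff.1 (hev.and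
    (((chartAt ℂ x).open_target.eventually_mem (mem_chart_target ℂ x)).and
      (Metric.ball_mem_nhds (chartAt ℂ x x) hr)))
  refine not_not.2 ⟨V, hV, hxV, fun w hw => (hVsub hw).2.1, fun ψ hψ hψc hψs => ?_⟩
  rw [← hint ψ hψ hψc fun w hw => (hVsub (hψs hw)).2.2]
  refine integral_congr_ae (.of_forall fun w => ?_)
  by_cases hw : w ∈ tsupport ψ
  · simp only [(hVsub (hψs hw)).1, EReal.toReal_coe]
  · simp only [laplacian_eq_zero_of_notMem_tsupport hw, mul_zero]

end Laplacian

/-! ### Local integrability -/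

section Integrability

lemma integrableAtFilter_of_norm_le_inv {f : ℂ → ℝ} {c : ℂ} {C : ℝ}
    (hf : ∀ᶠ w in 𝓝[≠] c, ‖f w‖ ≤ C * ‖w - c‖⁻¹) {s : Set ℂ} (hs : s ∈ 𝓝 c)
    (hm : AEStronglyMeasurable f (volume.restrict s)) : IntegrableAtFilter f (𝓝 c) volume := by
  obtain ⟨δ, hδ, hball⟩ := Metric.eventually_nhds_iff_ball.1
    ((eventually_nhdsWithin_iff.1 hf).and hs)
  have hinv : LocallyIntegrable (fun z : ℂ => C * ‖z‖⁻¹) volume := by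
    refine locallyIntegrable_of_norm_le_rpow (C := |C|) (α := 1) (by simp) (by simp)
      (.of_forall fun z => ?_) (measurable_norm.inv.const_mul C).aestronglyMeasurable
    rw [Real.rpow_neg_one, norm_mul, norm_inv, norm_norm, Real.norm_eq_abs]
  have hball_int : IntegrableOn (fun z : ℂ => C * ‖z‖⁻¹) (Metric.ball 0 δ) :=
    (hinv.integrableOn_isCompact (isCompact_closedBall (0 : ℂ) δ)).mono_set
      Metric.ball_subset_closedBall
  have hshift := ((integrable_indicator_iff measurableSet_ball).2 hball_int).comp_sub_right c
  refine ⟨Metric.ball c δ, Metric.ball_mem_nhds c hδ, Integrable.mono' hshift.integrableOn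
    (hm.mono_measure (Measure.restrict_mono (fun w hw => (hball w hw).2) le_rfl)) ?_⟩
  filter_upwards [ae_restrict_of_ae (Measure.ae_ne volume c), ae_restrict_mem measurableSet_ball]
    with w hw hwb
  rw [indicator_of_mem (by rwa [mem_ball_zero_iff, ← mem_ball_iff_norm])]
  exact (hball w hwb).1 hw

lemma abs_log_le_inv {t : ℝ} (ht : 0 < t) (ht1 : t ≤ 1) : |Real.log t| ≤ t⁻¹ := by
  rw [abs_of_nonpos (Real.log_nonpos ht.le ht1), ← Real.log_inv]
  exact (Real.log_le_sub_one_of_pos (inv_pos.2 ht)).trans (by linarith)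

lemma eventually_mul_norm_le_norm_sub {𝕜 : Type*} [NontriviallyNormedField 𝕜] {τ : 𝕜 → 𝕜}
    {c : 𝕜} (hτ : DifferentiableAt 𝕜 τ c) {a : ℝ} (ha : a < ‖deriv τ c‖) :
    ∀ᶠ w in 𝓝[≠] c, a * ‖w - c‖ ≤ ‖τ w - τ c‖ := by
  have hslope := (hasDerivAt_iff_tendsto_slope.1 hτ.hasDerivAt).norm
  filter_upwards [hslope.eventually (lt_mem_nhds ha), self_mem_nhdsWithin] with w hw hne
  rw [slope_def_field, norm_div, lt_div_iff₀ (norm_pos_iff.2 (sub_ne_zero.2 hne))] at hw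
  exact hw.le

lemma exists_abs_log_norm_sub_le {𝕜 : Type*} [NontriviallyNormedField 𝕜] {τ : 𝕜 → 𝕜} {c : 𝕜}
    (hτ : DifferentiableAt 𝕜 τ c) (hd : deriv τ c ≠ 0) :
    ∃ C, ∀ᶠ w in 𝓝[≠] c, |Real.log ‖τ w - τ c‖| ≤ C * ‖w - c‖⁻¹ := by
  have ha : 0 < ‖deriv τ c‖ / 2 := half_pos (norm_pos_iff.2 hd)
  have hle : ∀ᶠ w in 𝓝[≠] c, ‖τ w - τ c‖ ≤ 1 := nhdsWithin_le_nhds <|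
    (tendsto_iff_norm_sub_tendsto_zero.1 hτ.continuousAt).eventually_le_const one_pos
  refine ⟨(‖deriv τ c‖ / 2)⁻¹, ?_⟩
  filter_upwards [eventually_mul_norm_le_norm_sub hτ (half_lt_self (norm_pos_iff.2 hd)), hle,
    self_mem_nhdsWithin] with w hw hw1 hne
  have hpos := mul_pos ha (norm_pos_iff.2 (sub_ne_zero.2 hne))
  rw [← mul_inv]
  exact (abs_log_le_inv (hpos.trans_le hw) hw1).trans (inv_anti₀ hpos hw)

lemma exists_norm_log_add_le {𝕜 : Type*} [NontriviallyNormedField 𝕜] {τ : 𝕜 → 𝕜} {c : 𝕜}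
    (hτ : DifferentiableAt 𝕜 τ c) (hd : deriv τ c ≠ 0) (r : ℝ) {k : 𝕜 → ℝ}
    (hk : ContinuousAt k c) :
    ∃ C, ∀ᶠ w in 𝓝[≠] c, ‖r * Real.log ‖τ w - τ c‖ + k w‖ ≤ C * ‖w - c‖⁻¹ := by
  obtain ⟨C, hC⟩ := exists_abs_log_norm_sub_le hτ hd
  have hkle : ∀ᶠ w in 𝓝[≠] c, ‖k w‖ ≤ ‖k c‖ + 1 := nhdsWithin_le_nhds <|
    hk.norm.tendsto.eventually_le_const (lt_add_one _)
  have hle : ∀ᶠ w in 𝓝[≠] c, ‖w - c‖ ≤ 1 := nhdsWithin_le_nhds <|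
    (tendsto_iff_norm_sub_tendsto_zero.1 tendsto_id).eventually_le_const one_pos
  refine ⟨|r| * C + (‖k c‖ + 1), ?_⟩
  filter_upwards [hC, hkle, hle, self_mem_nhdsWithin] with w hlog hkw hw hne
  have hone : 1 ≤ ‖w - c‖⁻¹ := (one_le_inv₀ (norm_pos_iff.2 (sub_ne_zero.2 hne))).2 hw
  calc ‖r * Real.log ‖τ w - τ c‖ + k w‖
      ≤ |r| * |Real.log ‖τ w - τ c‖| + ‖k w‖ := by
        rw [← abs_mul]
        exact norm_add_le _ _
    _ ≤ |r| * (C * ‖w - c‖⁻¹) + (‖k c‖ + 1) * ‖w - c‖⁻¹ := by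
        gcongr
        exact hkw.trans (le_mul_of_one_le_right (by positivity) hone)
    _ = (|r| * C + (‖k c‖ + 1)) * ‖w - c‖⁻¹ := by ring

lemma tendsto_symm_nhdsNE {X Z : Type*} [TopologicalSpace X] [TopologicalSpace Z]
    {e : OpenPartialHomeomorph X Z} {c : Z} (hc : c ∈ e.target) :
    Tendsto e.symm (𝓝[≠] c) (𝓝[≠] (e.symm c)) :=
  tendsto_nhdsWithin_of_tendsto_nhds_of_eventually_within _
    ((e.symm.continuousAt hc).tendsto.mono_left nhdsWithin_le_nhds) <| by
      filter_upwards [nhdsWithin_le_nhds (e.open_target.mem_nhds hc), self_mem_nhdsWithin]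
        with w hw hne heq using hne (e.symm.injOn hw hc heq)

variable {X : Type*} [TopologicalSpace X] [ChartedSpace ℂ X] [IsManifold 𝓘(ℂ) ω X]

lemma HasAtMostLogSingularityAt.exists_norm_toReal_le {g : X → EReal}
    {e : OpenPartialHomeomorph X ℂ} (he : e ∈ IsManifold.maximalAtlas 𝓘(ℂ) ω X) {c : ℂ}
    (hc : c ∈ e.target) (hg : HasAtMostLogSingularityAt g (e.symm c)) :
    ∃ C, ∀ᶠ w in 𝓝[≠] c, ‖(g (e.symm w)).toReal‖ ≤ C * ‖w - c‖⁻¹ := by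
  obtain ⟨r, k, hk, hexp, -⟩ := hg
  set p := e.symm c
  have hp : p ∈ e.source := e.map_target hc
  have hep : e p = c := e.right_inv hc
  have hp' := mem_chart_source ℂ p
  have he' : chartAt ℂ p ∈ IsManifold.maximalAtlas 𝓘(ℂ) ω X := IsManifold.chart_mem_maximalAtlas p
  have hτ : AnalyticAt ℂ (fun w => chartAt ℂ p (e.symm w)) c :=
    hep ▸ analyticAt_transition he he' hp hp'
  obtain ⟨C, hC⟩ := exists_norm_log_add_le hτ.differentiableAt
    (hep ▸ deriv_transition_ne_zero he he' hp hp') r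
    (ContinuousAt.comp (g := k) hk.self_of_nhds hτ.continuousAt)
  refine ⟨C, ?_⟩
  filter_upwards [hC, (tendsto_symm_nhdsNE hc).eventually hexp] with w hle heq
  rw [heq, EReal.toReal_coe]
  exact hle

lemma isLocallyIntegrableOn_of_hasAtMostLogSingularityAt {g : X → EReal} {U : Set X}
    (hU : IsOpen U) (hg : ContinuousOn g U) (hlog : ∀ x ∈ U, HasAtMostLogSingularityAt g x) :
    IsLocallyIntegrableOn g U := by
  intro x c hc
  set e := chartAt ℂ x
  obtain ⟨C, hC⟩ := (hlog _ hc.2).exists_norm_toReal_le (IsManifold.chart_mem_maximalAtlas x) hc.1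
  have hopen : IsOpen (e.target ∩ e.symm ⁻¹' U) := e.isOpen_inter_preimage_symm hU
  have hcont : ContinuousOn (fun w => g (e.symm w)) (e.target ∩ e.symm ⁻¹' U) :=
    hg.comp (e.continuousOn_symm.mono inter_subset_left) fun w hw => hw.2
  refine (integrableAtFilter_of_norm_le_inv hC (hopen.mem_nhds hc) ?_).filter_mono
    nhdsWithin_le_nhds
  exact (measurable_ereal_toReal.comp_aemeasurable
    (hcont.aemeasurable hopen.measurableSet)).aestronglyMeasurable

end Integrability

/-! ### Subharmonicity -/

section Subharmonic

lemma forall_le_of_isCompact_of_eventually_eq {E α : Type*} [TopologicalSpace E] [T2Space E]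
    [PreconnectedSpace E] [NoncompactSpace E] [LinearOrder α] [TopologicalSpace α]
    [OrderClosedTopology α] {K : Set E} {v : E → α} {b : α} (hK : IsCompact K)
    (hv : ContinuousOn v K) (hbd : ∀ w ∈ K \ interior K, v w ≤ b)
    (hmax : ∀ w ∈ interior K, b < v w → IsMaxOn v K w → ∀ᶠ w' in 𝓝 w, v w' = v w) :
    ∀ w ∈ K, v w ≤ b := by
  by_contra! ⟨w₁, hw₁, hlt₁⟩
  obtain ⟨w₂, hw₂, hmax₂⟩ := hK.exists_isMaxOn ⟨w₁, hw₁⟩ hv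
  have hlt₂ : b < v w₂ := hlt₁.trans_le (hmax₂ hw₁)
  set Z : Set E := K ∩ v ⁻¹' {v w₂}
  have hclosed : IsClosed Z := hv.preimage_isClosed_of_isClosed hK.isClosed isClosed_singleton
  have hopen : IsOpen Z := by
    rw [isOpen_iff_mem_nhds]
    rintro w ⟨hwK, hw : v w = v w₂⟩
    have hint : w ∈ interior K := by
      by_contra hwint
      exact (hbd w ⟨hwK, hwint⟩).not_gt (hw ▸ hlt₂)
    filter_upwards [hmax w hint (hw ▸ hlt₂) fun x hx => (hmax₂ hx).trans_eq hw.symm,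
      mem_interior_iff_mem_nhds.1 hint] with x hx hxK
    exact ⟨hxK, hx.trans hw⟩
  have huniv : Z = univ := IsClopen.eq_univ ⟨hclosed, hopen⟩ ⟨w₂, hw₂, rfl⟩
  exact hK.ne_univ (univ_subset_iff.1 (huniv ▸ inter_subset_left))

lemma sub_coe_le_coe_iff {x : EReal} {a b : ℝ} :
    x - (b : EReal) ≤ a ↔ x ≤ ((b + a : ℝ) : EReal) := by
  rw [EReal.sub_le_iff_le_add (.inl (EReal.coe_ne_bot _)) (.inl (EReal.coe_ne_top _)),
    EReal.coe_add, add_comm]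

lemma sub_coe_eq_coe_iff {x : EReal} {a b : ℝ} :
    x - (b : EReal) = a ↔ x = ((b + a : ℝ) : EReal) := by
  rw [le_antisymm_iff, le_antisymm_iff, sub_coe_le_coe_iff,
    EReal.le_sub_iff_add_le (.inl (EReal.coe_ne_bot _)) (.inl (EReal.coe_ne_top _)),
    EReal.coe_add, add_comm (a : EReal)]

lemma continuousOn_sub_coe {E : Type*} [TopologicalSpace E] {G : E → EReal} {h : E → ℝ} {K : Set E}
    (hG : ContinuousOn G K) (hh : ContinuousOn h K) :
    ContinuousOn (fun w => G w - (h w : EReal)) K := fun w hw =>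
  (EReal.continuousAt_add (p := (G w, -(h w : EReal))) (.inr (EReal.coe_ne_bot (-h w)))
    (.inr (EReal.coe_ne_top (-h w)))).comp_continuousWithinAt
    (f := fun w => (G w, -(h w : EReal))) ((hG w hw).prodMk
      (continuous_coe_real_ereal.continuousAt.comp_continuousWithinAt (hh w hw).neg))

variable {X : Type*} [TopologicalSpace X] [ChartedSpace ℂ X] {g : X → EReal}

/-- The maximum principle at `q`, as a comparison with harmonic functions: a harmonic function which
dominates `g` near `q` and agrees with it at `q` agrees with it near `q`. -/
def MaximumPrincipleAt (g : X → EReal) (q : X) : Prop :=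
  ∀ k : X → EReal, IsHarmonicAt k q → (∀ᶠ x in 𝓝 q, g x ≤ k x) → g q = k q →
    ∀ᶠ x in 𝓝 q, g x = k x

lemma neBot_nhdsNE (q : X) : (𝓝[≠] q).NeBot := by
  have := (tendsto_symm_nhdsNE (mem_chart_target ℂ q)).neBot
  rwa [(chartAt ℂ q).left_inv (mem_chart_source ℂ q)] at this

variable [IsManifold 𝓘(ℂ) ω X] {e : OpenPartialHomeomorph X ℂ} {h : ℂ → ℝ}

lemma MaximumPrincipleAt.eventually_sub_eq (he : e ∈ IsManifold.maximalAtlas 𝓘(ℂ) ω X) {w : ℂ}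
    (hw : w ∈ e.target) (hg : MaximumPrincipleAt g (e.symm w)) (hh : HarmonicAt h w) {a : ℝ}
    (hle : ∀ᶠ w' in 𝓝 w, g (e.symm w') - h w' ≤ a) (heq : g (e.symm w) - h w = a) :
    ∀ᶠ w' in 𝓝 w, g (e.symm w') - h w' = a := by
  have hq : e.symm w ∈ e.source := e.map_target hw
  have hright : e (e.symm w) = w := e.right_inv hw
  have hk : IsHarmonicAt (fun x => ((h (e x) + a : ℝ) : EReal)) (e.symm w) := by
    rw [isHarmonicAt_iff he hq, hright]
    refine ⟨fun w' => h w' + a, hh.add (harmonicAt_const a), ?_⟩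
    filter_upwards [e.open_target.mem_nhds hw] with w' hw'
    rw [e.right_inv hw']
  have htend : Tendsto e (𝓝 (e.symm w)) (𝓝 w) := by
    simpa only [hright] using (e.continuousAt hq).tendsto
  have hres := hg _ hk ?_ (by rw [hright, sub_coe_eq_coe_iff.1 heq])
  · filter_upwards [(e.symm.continuousAt hw).eventually hres, e.open_target.mem_nhds hw]
      with w' hw' htarget
    rwa [e.right_inv htarget, ← sub_coe_eq_coe_iff] at hw'
  · filter_upwards [htend.eventually hle, e.open_source.mem_nhds hq] with x hx hsource
    rwa [sub_coe_le_coe_iff, e.left_inv hsource] at hx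

lemma isSubharmonicOn_of_maximumPrincipleAt {U : Set X} (hU : IsOpen U) (hg : ContinuousOn g U)
    (hlt : ∀ x ∈ U, g x < ⊤) (hne : ∀ x ∈ U, ∃ᶠ y in 𝓝 x, g y ≠ ⊥)
    (hmax : ∀ x ∈ U, MaximumPrincipleAt g x) : IsSubharmonicOn g U := by
  refine ⟨hg.upperSemicontinuousOn, hlt, fun x hx => ?_, ?_⟩
  · have := ChartedSpace.locallyConnectedSpace ℂ X
    obtain ⟨y, hy, hmem⟩ := ((hne x hx).and_eventually
      (connectedComponentIn_mem_nhds (hU.mem_nhds hx))).exists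
    exact ⟨y, hmem, hy⟩
  intro e he c R hR hsub hKU h hh hharm hbd
  have hGU : ∀ w ∈ Metric.closedBall c R, e.symm w ∈ U := fun w hw => hKU ⟨w, hw, rfl⟩
  have hcont : ContinuousOn (fun w => g (e.symm w) - h w) (Metric.closedBall c R) :=
    continuousOn_sub_coe (hg.comp (e.continuousOn_symm.mono hsub) hGU) hh
  have hle0 (w : ℂ) : g (e.symm w) - h w ≤ ((0 : ℝ) : EReal) ↔ g (e.symm w) ≤ h w := by
    rw [sub_coe_le_coe_iff, add_zero]
  suffices hsuff : ∀ w ∈ Metric.closedBall c R, g (e.symm w) - h w ≤ ((0 : ℝ) : EReal) from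
    fun w hw => (hle0 w).1 (hsuff w (Metric.ball_subset_closedBall hw))
  refine forall_le_of_isCompact_of_eventually_eq (isCompact_closedBall c R) hcont ?_ ?_
  all_goals rw [interior_closedBall c hR.ne']
  · rw [Metric.closedBall_sdiff_ball]
    exact fun w hw => (hle0 w).2 (hbd w hw)
  · intro w hw hpos hmaxw
    have hwK := Metric.ball_subset_closedBall hw
    have htop : g (e.symm w) - h w ≠ ⊤ :=
      EReal.add_ne_top (hlt _ (hGU w hwK)).ne (EReal.coe_ne_top (-h w))
    have ha := EReal.coe_toReal htop (ne_bot_of_gt hpos)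
    rw [← ha]
    refine (hmax _ (hGU w hwK)).eventually_sub_eq he (hsub hwK) (hharm w hw) ?_ ha.symm
    rw [ha]
    filter_upwards [Metric.closedBall_mem_nhds_of_mem hw] with w' hw' using hmaxw hw'

end Subharmonic

/-! ### Poles -/

section Poles

variable {Y : Type*} [TopologicalSpace Y] [ChartedSpace ℂ Y] {f : Y → EReal} {y : Y}

lemma HasLogSingularityAt.eq_zero_of_eq_coe {r a : ℝ} (h : HasLogSingularityAt f y r)
    (ha : f y = a) : r = 0 := by
  obtain ⟨H, hH, hev⟩ := h.exists_eventually_eq_logHarm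
    (ψ := fun t => chartAt ℂ y y + t) (analyticAt_const.add analyticAt_id) (add_zero _) (by simp)
  obtain ⟨-, -, -, hcont⟩ := h
  have hlim : Tendsto (fun t => ((logHarm r H t : ℝ) : EReal)) (𝓝[≠] 0) (𝓝 (a : EReal)) := by
    rw [ContinuousAt, ha, ← map_centredChart_zero, tendsto_map'_iff] at hcont
    exact (hcont.mono_left nhdsWithin_le_nhds).congr' hev
  have hlog : Tendsto (fun t : ℂ => r * Real.log ‖t‖) (𝓝[≠] 0) (𝓝 (a - H 0)) := by
    simpa only [logHarm, add_sub_cancel_right] using (EReal.tendsto_coe.1 hlim).sub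
      (hH.1.continuousAt.tendsto.mono_left nhdsWithin_le_nhds)
  rcases lt_trichotomy r 0 with hr | hr | hr
  · exact absurd hlog <|
      not_tendsto_nhds_of_tendsto_atTop (tendsto_log_norm.const_mul_atBot_of_neg hr) _
  · exact hr
  · exact absurd hlog <| not_tendsto_nhds_of_tendsto_atBot (tendsto_log_norm.const_mul_atBot hr) _

lemma HasLogSingularityAt.eventually_notMem_pol {r : ℝ} (h : HasLogSingularityAt f y r) :
    ∀ᶠ x in 𝓝[≠] y, x ∉ pol f := by
  obtain ⟨_, _, hev, _⟩ := h
  filter_upwards [hev] with x hx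
  rintro (⟨r, hr, hxr⟩ | ⟨r, hr, hxr⟩)
  · exact hr.ne (hxr.eq_zero_of_eq_coe hx)
  · exact hr.ne' (hxr.eq_zero_of_eq_coe hx)

lemma isClosed_of_subset_pol (hf : ∀ y, y ∉ pol f → IsHarmonicAt f y) {A : Set Y}
    (hA : A ⊆ pol f) : IsClosed A := by
  refine (isClosed_iff_derivedSet_subset A).2 fun y hy => ?_
  obtain ⟨r, hr⟩ := exists_hasLogSingularityAt hf y
  rw [mem_derivedSet, accPt_iff_frequently_nhdsNE] at hy
  exact absurd (hr.eventually_notMem_pol.mono fun x hx hxA => hx (hA hxA)) hy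

end Poles

/-! ### The tropical trace -/

section Trace

section HarmonicLocus

variable {X : Type*} [TopologicalSpace X] [ChartedSpace ℂ X] [IsManifold 𝓘(ℂ) ω X]

lemma isOpen_setOf_isHarmonicAt (g : X → EReal) : IsOpen {x | IsHarmonicAt g x} := by
  rw [isOpen_iff_mem_nhds]
  intro x hx
  obtain ⟨h, hh, hev⟩ := isHarmonicAt_iff_chartAt.1 hx
  have hs := mem_chart_source ℂ x
  filter_upwards [((chartAt ℂ x).continuousAt hs).eventually
    (hh.eventually.and hev.eventually_nhds), (chartAt ℂ x).open_source.mem_nhds hs] with y hy hys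
  exact (isHarmonicAt_iff (IsManifold.chart_mem_maximalAtlas x) hys).2 ⟨h, hy.1, hy.2⟩

lemma isClosed_setOf_not_isHarmonicAt (g : X → EReal) : IsClosed {x | ¬ IsHarmonicAt g x} :=
  (isOpen_setOf_isHarmonicAt g).isClosed_compl

/-- The points at which the points of non-harmonicity of `g` accumulate. Passing to the derived set
discards the isolated poles, so that the corner locus of a tropical trace is a curve. -/
def cornerLocus (g : X → EReal) : Set X := derivedSet {x | ¬ IsHarmonicAt g x}

end HarmonicLocus

variable {Y Y' : Type*} [TopologicalSpace Y] [ChartedSpace ℂ Y] [TopologicalSpace Y']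
  [ChartedSpace ℂ Y'] {ν : Y → Y'} {f : Y → EReal}

lemma isClosed_image_of_subset_pol (hν : IsBranchedCovering ν)
    (hf : ∀ y, y ∉ pol f → IsHarmonicAt f y) {A : Set Y} (hA : A ⊆ pol f) : IsClosed (ν '' A) :=
  hν.proper.isClosedMap _ (isClosed_of_subset_pol hf hA)

variable [IsManifold 𝓘(ℂ) ω Y] [IsManifold 𝓘(ℂ) ω Y']

lemma continuous_tropicalTrace (hν : IsBranchedCovering ν)
    (hf : ∀ y, y ∉ pol f → IsHarmonicAt f y) : Continuous (tropicalTrace ν f) :=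
  continuous_iff_continuousAt.2 fun q =>
    have ⟨_, _, _, _, _, _, M, _⟩ := exists_isLocalModel hν hf q
    M.continuousAt

lemma tropicalTrace_ne_bot_and_ne_top (hν : IsBranchedCovering ν)
    (hf : ∀ y, y ∉ pol f → IsHarmonicAt f y) {q : Y'} (hq : q ∉ ν '' pol f) :
    tropicalTrace ν f q ≠ ⊥ ∧ tropicalTrace ν f q ≠ ⊤ := by
  obtain ⟨J, _, _, m, ρ, H, M, hpol, -⟩ := exists_isLocalModel hν hf q
  have heq := (M.eventually_nhds_eq_maxLogHarm (hpol hq)).self_of_nhds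
  rw [powChart_zero q M.ne_zero] at heq
  exact heq ▸ ⟨EReal.coe_ne_bot _, EReal.coe_ne_top _⟩

lemma hasAtMostLogSingularityAt_tropicalTrace (hν : IsBranchedCovering ν)
    (hf : ∀ y, y ∉ pol f → IsHarmonicAt f y) (q : Y') :
    HasAtMostLogSingularityAt (tropicalTrace ν f) q :=
  have ⟨_, _, _, _, _, _, M, _⟩ := exists_isLocalModel hν hf q
  M.hasAtMostLogSingularityAt

lemma isSubharmonicOn_tropicalTrace (hν : IsBranchedCovering ν)
    (hf : ∀ y, y ∉ pol f → IsHarmonicAt f y) :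
    IsSubharmonicOn (tropicalTrace ν f) (ν '' polNeg f)ᶜ := by
  refine isSubharmonicOn_of_maximumPrincipleAt
    (isClosed_image_of_subset_pol hν hf subset_union_left).isOpen_compl
    (continuous_tropicalTrace hν hf).continuousOn ?_ ?_ ?_
  all_goals
    intro q hq
    obtain ⟨J, _, _, m, ρ, H, M, -, hneg⟩ := exists_isLocalModel hν hf q
  · exact M.lt_top_of_nonneg (hneg hq)
  · have := neBot_nhdsNE q
    exact (M.eventually_eq_toReal.mono fun x hx => hx ▸ EReal.coe_ne_bot _).frequently.filter_mono
      nhdsWithin_le_nhds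
  · exact fun k => M.eventually_eq_of_le (hneg hq)

lemma exists_hasArcsAt_tropicalTrace (hν : IsBranchedCovering ν)
    (hf : ∀ y, y ∉ pol f → IsHarmonicAt f y) (q : Y') :
    ∃ m B, HasArcsAt {z | ¬ IsHarmonicAt (tropicalTrace ν f) z} q m B :=
  have ⟨_, _, _, m, _, _, M, _⟩ := exists_isLocalModel hν hf q
  ⟨m, M.exists_hasArcsAt⟩

lemma isHarmonicAt_tropicalTrace (hν : IsBranchedCovering ν)
    (hf : ∀ y, y ∉ pol f → IsHarmonicAt f y) {q : Y'} (hq : q ∉ ν '' pol f)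
    (hcorner : q ∉ cornerLocus (tropicalTrace ν f)) : IsHarmonicAt (tropicalTrace ν f) q := by
  obtain ⟨J, _, _, m, ρ, H, M, hpol, -⟩ := exists_isLocalModel hν hf q
  refine M.isHarmonicAt_of_eventually_isHarmonicAt (hpol hq) ?_
  rw [cornerLocus, mem_derivedSet, accPt_iff_frequently_nhdsNE, not_frequently] at hcorner
  exact hcorner.mono fun x hx => not_not.1 hx

lemma laplacianSupport_tropicalTrace_subset (hν : IsBranchedCovering ν)
    (hf : ∀ y, y ∉ pol f → IsHarmonicAt f y) :
    laplacianSupport (tropicalTrace ν f) ⊆ cornerLocus (tropicalTrace ν f) ∪ ν '' pol f :=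
  fun _ hq => or_iff_not_imp_left.2 fun hcorner => not_not.1 fun hpol =>
    notMem_laplacianSupport (isHarmonicAt_tropicalTrace hν hf hpol hcorner) hq

lemma isSemianalyticCurve_cornerLocus_tropicalTrace (hν : IsBranchedCovering ν)
    (hf : ∀ y, y ∉ pol f → IsHarmonicAt f y) :
    IsSemianalyticCurve (cornerLocus (tropicalTrace ν f)) :=
  isSemianalyticCurve_derivedSet (isClosed_setOf_not_isHarmonicAt _)
    (exists_hasArcsAt_tropicalTrace hν hf)

lemma eventually_mem_connectedComponentIn_cornerLocus_tropicalTrace (hν : IsBranchedCovering ν)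
    (hf : ∀ y, y ∉ pol f → IsHarmonicAt f y) (q : Y') :
    ∀ᶠ x in 𝓝 q, x ∈ cornerLocus (tropicalTrace ν f) →
      x ∈ connectedComponentIn (cornerLocus (tropicalTrace ν f)) q :=
  have ⟨_, _, harcs⟩ := exists_hasArcsAt_tropicalTrace hν hf q
  harcs.eventually_mem_connectedComponentIn (isClosed_setOf_not_isHarmonicAt _)

lemma isPiecewiseHarmonicOn_tropicalTrace (hν : IsBranchedCovering ν)
    (hf : ∀ y, y ∉ pol f → IsHarmonicAt f y) :
    IsPiecewiseHarmonicOn (tropicalTrace ν f) (ν '' pol f)ᶜ := by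
  refine ⟨cornerLocus (tropicalTrace ν f), isSemianalyticCurve_cornerLocus_tropicalTrace hν hf,
    fun q hq => isHarmonicAt_tropicalTrace hν hf hq.1 hq.2, fun q hq => ?_⟩
  obtain ⟨m, B, harcs⟩ := exists_hasArcsAt_tropicalTrace hν hf q
  exact harcs.finite_setOf_connectedComponentIn_diff_derivedSet (isClosed_setOf_not_isHarmonicAt _)
    ((isClosed_image_of_subset_pol hν hf Subset.rfl).isOpen_compl.mem_nhds hq)

end Trace

end TropicalTrace

theorem mainTheorem7_general
    {Y Y' : Type*}
    [TopologicalSpace Y] [ChartedSpace ℂ Y] [IsManifold 𝓘(ℂ) ω Y]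
    [TopologicalSpace Y'] [ChartedSpace ℂ Y'] [IsManifold 𝓘(ℂ) ω Y']
    (ν : Y → Y') (hν : IsBranchedCovering ν)
    (f : Y → EReal) (hf : ∀ y, y ∉ pol f → IsHarmonicAt f y) :
    (∀ z ∈ (ν '' pol f)ᶜ, tropicalTrace ν f z ≠ ⊥ ∧ tropicalTrace ν f z ≠ ⊤) ∧
    ContinuousOn (tropicalTrace ν f) (ν '' pol f)ᶜ ∧
    IsPiecewiseHarmonicOn (tropicalTrace ν f) (ν '' pol f)ᶜ ∧
    IsSubharmonicOn (tropicalTrace ν f) (ν '' polNeg f)ᶜ ∧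
    (∀ z ∈ ν '' pol f, HasAtMostLogSingularityAt (tropicalTrace ν f) z) ∧
    IsLocallyIntegrableOn (tropicalTrace ν f) (ν '' polNeg f)ᶜ ∧
    ∃ 𝒞 : Set (Set Y'),
      (∀ C ∈ 𝒞, IsSemianalyticCurve C ∧ IsConnected C) ∧
      LocallyFinite (fun C : 𝒞 => (C : Set Y')) ∧
      IsSemianalyticCurve (⋃₀ 𝒞) ∧
      (CompactSpace Y' → 𝒞.Finite) ∧
      laplacianSupport (tropicalTrace ν f) ∩ (ν '' polNeg f)ᶜ ⊆ ⋃₀ 𝒞 ∪ ν '' pol f := by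
  have hcont := continuous_tropicalTrace hν hf
  have hlog := hasAtMostLogSingularityAt_tropicalTrace hν hf
  have hcurve := isSemianalyticCurve_cornerLocus_tropicalTrace hν hf
  obtain ⟨𝒞, h𝒞, hlf, hunion, hfin⟩ := hcurve.exists_locallyFinite_connected fun q _ =>
    eventually_mem_connectedComponentIn_cornerLocus_tropicalTrace hν hf q
  rw [← hunion] at hcurve
  refine ⟨fun z => tropicalTrace_ne_bot_and_ne_top hν hf, hcont.continuousOn,
    isPiecewiseHarmonicOn_tropicalTrace hν hf, isSubharmonicOn_tropicalTrace hν hf,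
    fun z _ => hlog z, ?_, 𝒞, h𝒞, hlf, hcurve, hfin, ?_⟩
  · exact isLocallyIntegrableOn_of_hasAtMostLogSingularityAt
      (isClosed_image_of_subset_pol hν hf subset_union_left).isOpen_compl hcont.continuousOn
      fun z _ => hlog z
  · rw [hunion]
    exact inter_subset_left.trans (laplacianSupport_tropicalTrace_subset hν hf)

theorem mainTheorem7
    {Y Y' : Type*}
    [TopologicalSpace Y] [T2Space Y] [ChartedSpace ℂ Y] [IsManifold 𝓘(ℂ) ω Y]
    [TopologicalSpace Y'] [T2Space Y'] [ChartedSpace ℂ Y'] [IsManifold 𝓘(ℂ) ω Y']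
    (ν : Y → Y') (hν : IsBranchedCovering ν)
    (f : Y → EReal) (hf : IsHarmonicWithLogPoles f) :
    -- real-valued, continuous and piecewise harmonic off the images of the poles
    (∀ z ∈ (ν '' pol f)ᶜ, tropicalTrace ν f z ≠ ⊥ ∧ tropicalTrace ν f z ≠ ⊤) ∧
    ContinuousOn (tropicalTrace ν f) (ν '' pol f)ᶜ ∧
    IsPiecewiseHarmonicOn (tropicalTrace ν f) (ν '' pol f)ᶜ ∧
    -- subharmonic off the images of the poles with negative residue
    IsSubharmonicOn (tropicalTrace ν f) (ν '' polNeg f)ᶜ ∧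
    -- at most logarithmic singularities
    (∀ z ∈ ν '' pol f, HasAtMostLogSingularityAt (tropicalTrace ν f) z) ∧
    -- the distributional Laplacian and its support
    IsLocallyIntegrableOn (tropicalTrace ν f) (ν '' polNeg f)ᶜ ∧
    ∃ (𝒞 : Set (Set Y')) (Q : Set Y'),
      (∀ C ∈ 𝒞, IsSemianalyticCurve C ∧ IsConnected C) ∧
      LocallyFinite (fun C : 𝒞 => (C : Set Y')) ∧
      IsSemianalyticCurve (⋃₀ 𝒞) ∧
      (CompactSpace Y' → 𝒞.Finite) ∧
      Q.Finite ∧ Q ⊆ ν '' pol f ∧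
      laplacianSupport (tropicalTrace ν f) ∩ (ν '' polNeg f)ᶜ ⊆ ⋃₀ 𝒞 ∪ Q := by
  obtain ⟨hreal, hcont, hpw, hsub, hlog, hint, 𝒞, h𝒞, hlf, hcurve, hfin, hsupp⟩ :=
    mainTheorem7_general ν hν f hf.harmonic
  exact ⟨hreal, hcont, hpw, hsub, hlog, hint, 𝒞, ν '' pol f, h𝒞, hlf, hcurve, hfin,
    hf.finite_pol.image ν, subset_rfl, hsupp⟩
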